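/- A two-qutrit state is a positive semidefinite matrix $\rho$ of trace one on $\mathbb C^3\otimes\mathbb C^3$; it is absolutely PPT if for every unitary $U$ of order nine the partial transpose of $U\rho U^\dagger$ is positive semidefinite. Let $\mathcal{AP}_{3,3}$ be the convex set of absolutely PPT two-qutrit states. For $1\le k\le 6$ and $a>b>c>0$ put $\nu_{2,k,7-k}=\mathrm{diag}(a,a,b,\dots,b,c,\dots,c)$, with $k$ entries $b$ and $7-k$ entries $c$. For $x=(x_1,\dots,x_9)\in\mathbb R^9$ let $$L_1(x)=\begin{bmatrix}2x_9&x_8-x_1&x_6-x_2\\x_8-x_1&2x_7&x_5-x_3\\x_6-x_2&x_5-x_3&2x_4\end{bmatrix},\quad L_2(x)=\begin{bmatrix}2x_9&x_8-x_1&x_7-x_2\\x_8-x_1&2x_6&x_5-x_3\\x_7-x_2&x_5-x_3&2x_4\end{bmatrix},\quad l_i=\det L_i .$$ Let $\zeta_2=\frac1{9+2\sqrt2}\mathrm{diag}((\sqrt2+1)^{2},1^{7})$, $\zeta_3=\frac1{12}\mathrm{diag}(2^{3},1^{6})$, $\zeta_4=\frac1{10+\sqrt{17}}\mathrm{diag}\big((\tfrac{5+\sqrt{17}}4)^{4},1^{5}\big)$,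 $\zeta_5=\frac1{5x+4}\mathrm{diag}(x^{5},1^{4})$, $\zeta_6=\frac1{21}\mathrm{diag}(3^{6},1^{3})$, $\zeta_7=\frac1{23+14\sqrt2}\mathrm{diag}((3+2\sqrt2)^{7},1^{2})$, $\zeta_8=\frac18\mathrm{diag}(1^{8},0)$, where in these diagonal lists an exponent denotes the number of repetitions and $x\approx2.70928$ (within $10^{-5}$) is a root of $x^3-x^2-5x+1=0$. Put $c_2=\frac{9-2\sqrt2}{73}$, $c_4=\frac{10-\sqrt{17}}{83}$, $c_7=\frac{23-14\sqrt2}{137}$, $c_*=\frac{85-14\sqrt{10}}{585}$, and let $y=0.056991\cdots$ be the second smallest real root of $481y^3-37y^2-17y+1=0$. For real $a>b>c>0$, the matrix $\nu_{2,k,7-k}$ is an extreme point of $\mathcal{AP}_{3,3}$ if and only if $(a,b,c)$ is listed below for that $k$; conversely, every listed triple satisfies $a>b>c>0$. "Second root" means second smallest real root, which exists for all $c$ in the range stated. Limits at the ends of a range are one-sided, from inside the range. * $\nu_{2,1,6}$: $a=2c+\sqrt{12c^2-c}$, $b=1-10c-2\sqrt{12c^2-c}$, $\frac1{12}<c<c_2$;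 the limits are $\zeta_3$ as $c\to\frac1{12}$ and $\zeta_2$ as $c\to c_2$. * $\nu_{2,2,5}$: $a=\frac{1-2b-5c}2$, $b$ the second root of $-4b^3+(4-30c)b^2+(-37c^2+14c-1)b-2c^3=0$, $c_4<c<c_2$; the limits are $\zeta_4$ as $c\to c_4$ and $\zeta_2$ as $c\to c_2$. * $\nu_{2,3,4}$: $a=\frac{1-3b-4c}2$, $b$ the second root of $-9b^3+(6-45c)b^2+(-56c^2+18c-1)b-c(1-6c)^2=0$, $y<c<c_2$; the limits are $\zeta_5$ as $c\to y$ and $\zeta_2$ as $c\to c_2$. * $\nu_{2,4,3}$: one of two branches. * $\nu_{2,4,3}^{(1)}$: $a=\frac{1-4b-3c}2$, $b$ the second root of $-16b^3+(8-76c)b^2+(-45c^2+22c-1)b-c(1-3c)^2=0$, $\frac1{21}<c\le c_*$. With $\lambda=(a,a,b,b,b,b,c,c,c)$, these are exactly the solutions of $a>b>c>0$, $2a+4b+3c=1$, $l_1(\lambda)=0$, $L_2(\lambda)\succeq0$. The limit as $c\to\frac1{21}$ is $\zeta_6$. * $\nu_{2,4,3}^{(2)}$: $a=\frac{c+\sqrt{2c-9c^2}}2$,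 $b=\frac{1-4c-\sqrt{2c-9c^2}}4$, $c_*\le c<c_2$. These are exactly the solutions of $a>b>c>0$, $2a+4b+3c=1$, $l_2(\lambda)=0$, $L_1(\lambda)\succeq0$. The limit as $c\to c_2$ is $\zeta_2$. * The two branches meet at $\nu_{2,4,3}^{(3)}$: $c=c_*$, $b=\frac{36-\frac{19}{117}(85-14\sqrt{10})}{7(85-14\sqrt{10})}$, $a=\frac{1-4b-3c}2$. It is the only solution of $a>b>c>0$, $2a+4b+3c=1$, $l_1(\lambda)=l_2(\lambda)=0$, and it is the limit of both branches as $c\to c_*$. * $\nu_{2,5,2}$: $a=\frac{7-9c+5\sqrt{-201c^2+66c-1}}{74}$, $b=\frac{6-13c-\sqrt{-201c^2+66c-1}}{37}$, $c_7<c<c_2$; the limits are $\zeta_7$ as $c\to c_7$ and $\zeta_2$ as $c\to c_2$. * $\nu_{2,6,1}$: $a=\frac{2-5c+3\sqrt{4c-3c^2}}{16}$, $b=\frac{2-c-\sqrt{4c-3c^2}}{16}$, $0<c<c_2$; the limits are $\zeta_8$ as $c\to0$ and $\zeta_2$ as $c\to c_2$. -/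

import Mathlib

open Set Filter Topology
open scoped ComplexOrder

/-- Operators on the two-qutrit space `ℂ³ ⊗ ℂ³`, in the product basis indexed by `Fin 3 × Fin 3`. -/
abbrev TwoQutrit : Type := Matrix (Fin 3 × Fin 3) (Fin 3 × Fin 3) ℂ

/-- The partial transpose with respect to the second tensor factor. -/
def partialTranspose (ρ : TwoQutrit) : TwoQutrit :=
  Matrix.of fun p q => ρ (p.1, q.2) (q.1, p.2)

/-- A state (density matrix): positive semidefinite with trace one. -/
def IsState (ρ : TwoQutrit) : Prop := ρ.PosSemidef ∧ ρ.trace = 1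

/-- The set `AP₃,₃` of absolutely PPT two-qutrit states: `U ρ U†` has positive semidefinite partial
transpose for every unitary matrix `U` of order nine. -/
def absPPT : Set TwoQutrit :=
  {ρ | IsState ρ ∧ ∀ U ∈ Matrix.unitaryGroup (Fin 3 × Fin 3) ℂ,
    (partialTranspose (U * ρ * star U)).PosSemidef}

/-- The diagonal matrix with real diagonal entries `d 0, …, d 8` (product basis in lexicographic
order). -/
def diagOp (d : Fin 9 → ℝ) : TwoQutrit :=
  Matrix.diagonal fun p => ((d (finProdFinEquiv p) : ℝ) : ℂ)

/-- The vector `(a, a, b, …, b, c, …, c)` with `k` entries `b` and `7 - k` entries `c`. -/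
def nuSpec (k : ℕ) (a b c : ℝ) : Fin 9 → ℝ :=
  fun i => if (i : ℕ) < 2 then a else if (i : ℕ) < 2 + k then b else c

/-- `ν_{2,k,7-k} = diag(a, a, b, …, b, c, …, c)`. -/
def nu (k : ℕ) (a b c : ℝ) : TwoQutrit := diagOp (nuSpec k a b c)

/-- `ν_{2,k,7-k}` has three distinct eigenvalues `a > b > c > 0` and is an extreme point of the set
of absolutely PPT states. -/
def IsExtremeNu (k : ℕ) (a b c : ℝ) : Prop :=
  a > b ∧ b > c ∧ c > 0 ∧ nu k a b c ∈ extremePoints ℝ absPPT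

/-- The matrix `L₁(x)`; `x 0, …, x 8` are `x₁, …, x₉`. -/
def matL1 (x : Fin 9 → ℝ) : Matrix (Fin 3) (Fin 3) ℝ :=
  !![2 * x 8, x 7 - x 0, x 5 - x 1;
     x 7 - x 0, 2 * x 6, x 4 - x 2;
     x 5 - x 1, x 4 - x 2, 2 * x 3]

/-- The matrix `L₂(x)`; `x 0, …, x 8` are `x₁, …, x₉`. -/
def matL2 (x : Fin 9 → ℝ) : Matrix (Fin 3) (Fin 3) ℝ :=
  !![2 * x 8, x 7 - x 0, x 6 - x 1;
     x 7 - x 0, 2 * x 5, x 4 - x 2;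
     x 6 - x 1, x 4 - x 2, 2 * x 3]

/-- `b` is the second smallest real zero of `f`. -/
def IsSecondRoot (f : ℝ → ℝ) (b : ℝ) : Prop :=
  f b = 0 ∧ {w : ℝ | w < b ∧ f w = 0}.ncard = 1

noncomputable section

def zeta2 : TwoQutrit :=
  diagOp ((1 / (9 + 2 * √2) : ℝ) • ![√2 + 1, √2 + 1, 1, 1, 1, 1, 1, 1, 1])

def zeta3 : TwoQutrit :=
  diagOp ((1 / 12 : ℝ) • ![2, 2, 2, 1, 1, 1, 1, 1, 1])

def zeta4 : TwoQutrit :=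
  diagOp ((1 / (10 + √17) : ℝ) •
    ![(5 + √17) / 4, (5 + √17) / 4, (5 + √17) / 4, (5 + √17) / 4, 1, 1, 1, 1, 1])

/-- The state `ζ₅`; its parameter is the root `x ≈ 2.70928` of `x³ - x² - 5x + 1 = 0`. -/
def zeta5 (x : ℝ) : TwoQutrit :=
  diagOp ((1 / (5 * x + 4) : ℝ) • ![x, x, x, x, x, 1, 1, 1, 1])

def zeta6 : TwoQutrit :=
  diagOp ((1 / 21 : ℝ) • ![3, 3, 3, 3, 3, 3, 1, 1, 1])

def zeta7 : TwoQutrit :=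
  diagOp ((1 / (23 + 14 * √2) : ℝ) •
    ![3 + 2 * √2, 3 + 2 * √2, 3 + 2 * √2, 3 + 2 * √2, 3 + 2 * √2, 3 + 2 * √2, 3 + 2 * √2, 1, 1])

def zeta8 : TwoQutrit :=
  diagOp ((1 / 8 : ℝ) • ![1, 1, 1, 1, 1, 1, 1, 1, 0])

/-- The endpoint `(9 - 2√2)/73 = 0.084542…`. -/
def cZeta2 : ℝ := (9 - 2 * √2) / 73

/-- The endpoint `(10 - √17)/83 = 0.070805…`. -/
def cZeta4 : ℝ := (10 - √17) / 83

/-- The endpoint `(23 - 14√2)/137 = 0.023365…`. -/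
def cZeta7 : ℝ := (23 - 14 * √2) / 137

/-- The value `(85 - 14√10)/585 = 0.069620…` at which the two branches of `ν_{2,4,3}` meet. -/
def cMeet : ℝ := (85 - 14 * √10) / 585

/-- The value of `b` at the meeting point. -/
def bMeet : ℝ := (36 - 19 / 117 * (85 - 14 * √10)) / (7 * (85 - 14 * √10))

/-- The value of `a` at the meeting point. -/
def aMeet : ℝ := (1 - 4 * bMeet - 3 * cMeet) / 2

/-- The cubic in `b` for `ν_{2,2,5}`. -/
def cubic225 (c b : ℝ) : ℝ :=
  -4 * b ^ 3 + (4 - 30 * c) * b ^ 2 + (-37 * c ^ 2 + 14 * c - 1) * b - 2 * c ^ 3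

/-- The cubic in `b` for `ν_{2,3,4}`. -/
def cubic234 (c b : ℝ) : ℝ :=
  -9 * b ^ 3 + (6 - 45 * c) * b ^ 2 + (-56 * c ^ 2 + 18 * c - 1) * b - c * (1 - 6 * c) ^ 2

/-- The cubic in `b` for `ν_{2,4,3}⁽¹⁾`. -/
def cubic243 (c b : ℝ) : ℝ :=
  -16 * b ^ 3 + (8 - 76 * c) * b ^ 2 + (-45 * c ^ 2 + 22 * c - 1) * b - c * (1 - 3 * c) ^ 2

def a216 (c : ℝ) : ℝ := 2 * c + √(12 * c ^ 2 - c)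
def b216 (c : ℝ) : ℝ := 1 - 10 * c - 2 * √(12 * c ^ 2 - c)

/-- `a` for the second branch `ν_{2,4,3}⁽²⁾`. -/
def a243 (c : ℝ) : ℝ := (c + √(2 * c - 9 * c ^ 2)) / 2
/-- `b` for the second branch `ν_{2,4,3}⁽²⁾`. -/
def b243 (c : ℝ) : ℝ := (1 - 4 * c - √(2 * c - 9 * c ^ 2)) / 4

def a252 (c : ℝ) : ℝ := (7 - 9 * c + 5 * √(-201 * c ^ 2 + 66 * c - 1)) / 74
def b252 (c : ℝ) : ℝ := (6 - 13 * c - √(-201 * c ^ 2 + 66 * c - 1)) / 37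

def a261 (c : ℝ) : ℝ := (2 - 5 * c + 3 * √(4 * c - 3 * c ^ 2)) / 16
def b261 (c : ℝ) : ℝ := (2 - c - √(4 * c - 3 * c ^ 2)) / 16

end

/-! Absolute PPT is a condition on the spectrum. At a vector in Schmidt form with coefficients `s`,
the form of the partial transpose of σ equals tr(σH), where H has eigenvalues sᵢ² and ±sᵢsⱼ on the
Bell-type basis; local unitaries bring every vector to Schmidt form. Over all unitaries, tr(UρU†H)
is smallest when the two spectra are paired in opposite order. For s₀ ≥ s₁ ≥ s₂ ≥ 0 the order of the
eigenvalues of H depends only on which of s₁² and s₀s₂ is larger, and the two cases are the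
quadratic forms of L₁ and L₂. So a decreasing spectrum is absolutely PPT exactly when L₁ and L₂ are
positive semidefinite (`matL1_posSemidef_of_absPPT`, `matL2_posSemidef_of_absPPT`,
`diagOp_mem_absPPT`).

Extremality of ν then means that L₁ or L₂ is singular at ν (`isExtremeNu_iff`). If both are
nonsingular, ν can be moved both ways inside the set. If Lᵢ is singular, the signs of its entries
give a kernel vector s with positive coordinates, and ρ ↦ sᵀLᵢ(diag ρ)s is nonnegative on the whole
set and zero at ν. An endpoint ρ₁ of a segment through ν then satisfies Lᵢ(diag ρ₁)s = 0, also after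
conjugation by any unitary commuting with ν. Plane reflections turn this into: ρ₁ is diagonal and
constant on the blocks of ν (`eq_diagOp_of_mem_openSegment`). The three remaining parameters solve a
linear system with a one-dimensional kernel, and the trace gives ρ₁ = ν.

The rest is real algebra. For k ≠ 4 the two matrices agree at ν and the determinant gives one
equation. For k = 1, 5, 6 it reduces to a quadratic. For k = 2, 3, 4 the cubic divided by b is
strictly increasing between b = c and a = b (`CrossesUp`), so there is at most one admissible b, and
it exists exactly when the signs at the two ends differ. The end b = c always gives ζ₂; the end a =
b gives the other limit. For k = 4, l₁ factors on the curve l₂ = 0 (`cubic243_of_tangent`), which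
locates c_* and decides which constraint is active. -/

open scoped Matrix

/-! ### Singular value decomposition -/

open scoped Kronecker InnerProductSpace in
/-- Singular value decomposition of a square complex matrix, with decreasing singular values. -/
theorem exists_singularValueDecomposition {n : ℕ} (A : Matrix (Fin n) (Fin n) ℂ) :
    ∃ V ∈ Matrix.unitaryGroup (Fin n) ℂ, ∃ W ∈ Matrix.unitaryGroup (Fin n) ℂ, ∃ s : Fin n → ℝ,
      Antitone s ∧ (∀ i, 0 ≤ s i) ∧ A = V * Matrix.diagonal (fun i => (s i : ℂ)) * star W := by
  have hn : Module.finrank ℂ (EuclideanSpace ℂ (Fin n)) = n := by simp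
  set T := Matrix.toEuclideanLin A with hT
  have hS := T.isSymmetric_adjoint_comp_self
  set l := hS.eigenvalues hn with hl
  set w := hS.eigenvectorBasis hn with hw
  have hin : ∀ i j, inner ℂ (T (w i)) (T (w j)) = if i = j then (l j : ℂ) else 0 := by
    intro i j
    rw [← LinearMap.adjoint_inner_right, ← LinearMap.comp_apply, hS.apply_eigenvectorBasis hn j,
      inner_smul_right, orthonormal_iff_ite.1 w.orthonormal i j]
    simp [hl]
  have hl0 : ∀ i, 0 ≤ l i := by
    intro i
    have h := hin i i
    rw [if_pos rfl, inner_self_eq_norm_sq_to_K] at h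
    have h2 : (‖T (w i)‖ ^ 2 : ℝ) = l i := by
      have h3 := congrArg Complex.re h
      simpa [← Complex.ofReal_pow] using h3
    rw [← h2]; positivity
  set s : Fin n → ℝ := fun i => √(l i) with hs
  have hss : ∀ i, s i * s i = l i := fun i => Real.mul_self_sqrt (hl0 i)
  -- The eigenvectors of A†A have orthogonal images of norm `s i`. The normalised nonzero images are
  -- orthonormal, and any completion to a basis supplies the left singular vectors.
  have horth : Orthonormal ℂ (({i | s i ≠ 0} : Set (Fin n)).domRestrict
      (fun i => ((s i : ℂ)⁻¹) • T (w i))) := by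
    rw [orthonormal_iff_ite]
    rintro ⟨i, hi⟩ ⟨j, hj⟩
    simp only [Set.domRestrict_apply, inner_smul_left, inner_smul_right, hin, Subtype.mk.injEq]
    split_ifs with h
    · subst h
      have hi' : (s i : ℂ) ≠ 0 := by exact_mod_cast hi
      rw [← hss i]
      simp
      field_simp
    · simp
  obtain ⟨v, hv⟩ := horth.exists_orthonormalBasis_extension_of_card_eq (by simp)
  have hTw : ∀ i, T (w i) = (s i : ℂ) • v i := by
    intro i
    by_cases hi : s i = 0
    · have h := hin i i
      rw [if_pos rfl, ← hss i, hi, inner_self_eq_norm_sq_to_K] at h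
      have h2 : T (w i) = 0 := by simpa using h
      simp [h2, hi]
    · rw [hv i hi, smul_smul, mul_inv_cancel₀ (by exact_mod_cast hi), one_smul]
  have hU : ∀ b : OrthonormalBasis (Fin n) ℂ (EuclideanSpace ℂ (Fin n)),
      (Matrix.of fun i j => b j i) ∈ Matrix.unitaryGroup (Fin n) ℂ := by
    intro b
    rw [Matrix.mem_unitaryGroup_iff']
    ext i j
    have h := orthonormal_iff_ite.1 b.orthonormal i j
    rw [PiLp.inner_apply] at h
    simp only [Matrix.mul_apply, Matrix.star_apply, Matrix.of_apply, Matrix.one_apply, ← h]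
    exact Finset.sum_congr rfl fun x _ => by simp [mul_comm]
  refine ⟨_, hU v, _, hU w, s, ?_, fun i => Real.sqrt_nonneg _, ?_⟩
  · intro i j hij
    exact Real.sqrt_le_sqrt (hS.eigenvalues_antitone hn hij)
  · have h1 : A * (Matrix.of fun i j => w j i) =
        (Matrix.of fun i j => v j i) * Matrix.diagonal (fun i => (s i : ℂ)) := by
      ext i j
      have h := congrArg (fun x => x i) (hTw j)
      simp only [hT, Matrix.toLpLin_apply, Matrix.mulVec, dotProduct] at h
      rw [Matrix.mul_diagonal]
      simpa [Matrix.mul_apply, mul_comm] using h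
    rw [← h1, mul_assoc, Matrix.mem_unitaryGroup_iff.1 (hU w), mul_one]

/-! ### Partial transpose at Schmidt vectors, and the Bell-type basis -/

theorem partialTranspose_isHermitian {σ : TwoQutrit} (h : σ.IsHermitian) :
    (partialTranspose σ).IsHermitian := by
  ext p q
  have := congrFun (congrFun h (p.1, q.2)) (q.1, p.2)
  simpa [partialTranspose, Matrix.conjTranspose_apply] using this

open scoped Kronecker in
/-- Local unitaries act on the partial transpose by conjugation. -/
theorem partialTranspose_kronecker_conj (V W : Matrix (Fin 3) (Fin 3) ℂ) (Y : TwoQutrit) :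
    partialTranspose ((V ⊗ₖ W) * Y * star (V ⊗ₖ W)) =
      (V ⊗ₖ W.map star) * partialTranspose Y * star (V ⊗ₖ W.map star) := by
  ext ⟨i, j⟩ ⟨k, l⟩
  simp only [partialTranspose, Matrix.of_apply, Matrix.mul_apply, Matrix.star_apply,
    Matrix.kronecker_apply, Matrix.map_apply, Fintype.sum_prod_type, Finset.sum_mul, star_mul',
    star_star]
  refine Finset.sum_congr rfl fun p _ => ?_
  conv_lhs => rw [Finset.sum_comm]
  conv_rhs => rw [Finset.sum_comm]
  refine Finset.sum_congr rfl fun m _ => ?_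
  conv_lhs => rw [Finset.sum_comm]
  refine Finset.sum_congr rfl fun n _ => Finset.sum_congr rfl fun q _ => ?_
  ring

/-- The vector with coordinates `s m` at `(m, m)` and zero elsewhere. -/
noncomputable def schmidtVec (s : Fin 3 → ℝ) : Fin 3 × Fin 3 → ℂ :=
  fun p => if p.1 = p.2 then (s p.1 : ℂ) else 0

/-- The Bell-type orthonormal basis: `e_ii` and `(e_ij ± e_ji) / √2`. -/
noncomputable def bellBasis : TwoQutrit :=
  Matrix.of fun p q =>
    if p = q then (if p.1 = p.2 then 1 else if p.1 < p.2 then ((√2 / 2 : ℝ) : ℂ)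
      else -((√2 / 2 : ℝ) : ℂ))
    else if p = q.swap then ((√2 / 2 : ℝ) : ℂ) else 0

theorem bellBasis_mem_unitaryGroup : bellBasis ∈ Matrix.unitaryGroup (Fin 3 × Fin 3) ℂ := by
  have h2 : ((√2 / 2 : ℝ) : ℂ) * ((√2 / 2 : ℝ) : ℂ) = 1 / 2 := by
    rw [← Complex.ofReal_mul, show √2 / 2 * (√2 / 2) = (1 / 2 : ℝ) by
      nlinarith [Real.mul_self_sqrt (show (0:ℝ) ≤ 2 by norm_num)]]
    norm_num
  rw [Matrix.mem_unitaryGroup_iff]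
  ext p q
  simp only [Matrix.mul_apply, Matrix.star_apply, bellBasis, Matrix.of_apply]
  have h3 : (starRingEnd ℂ) ((√2 / 2 : ℝ) : ℂ) = ((√2 / 2 : ℝ) : ℂ) := Complex.conj_ofReal _
  generalize ((√2 / 2 : ℝ) : ℂ) = r at h2 h3
  have h4 : r * r + r * r = 1 := by rw [h2]; norm_num
  fin_cases p <;> fin_cases q <;>
    simp [Fintype.sum_prod_type, Fin.sum_univ_three, h3, h4]

/-- The coefficients of the diagonal entries in the quadratic form of `matL1`. -/
def mu1 (s : Fin 3 → ℝ) : Fin 9 → ℝ :=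
  ![-(s 0 * s 1), -(s 0 * s 2), -(s 1 * s 2), s 2 ^ 2, s 1 * s 2, s 0 * s 2, s 1 ^ 2, s 0 * s 1,
    s 0 ^ 2]

/-- The coefficients of the diagonal entries in the quadratic form of `matL2`. -/
def mu2 (s : Fin 3 → ℝ) : Fin 9 → ℝ :=
  ![-(s 0 * s 1), -(s 0 * s 2), -(s 1 * s 2), s 2 ^ 2, s 1 * s 2, s 1 ^ 2, s 0 * s 2, s 0 * s 1,
    s 0 ^ 2]

open Matrix in
theorem dotProduct_matL1 (s : Fin 3 → ℝ) (d : Fin 9 → ℝ) :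
    s ⬝ᵥ (matL1 d *ᵥ s) = 2 * ∑ i, mu1 s i * d i := by
  simp [matL1, mu1, dotProduct, mulVec, Fin.sum_univ_succ]
  ring

open Matrix in
theorem dotProduct_matL2 (s : Fin 3 → ℝ) (d : Fin 9 → ℝ) :
    s ⬝ᵥ (matL2 d *ᵥ s) = 2 * ∑ i, mu2 s i * d i := by
  simp [matL2, mu2, dotProduct, mulVec, Fin.sum_univ_succ]
  ring

-- The right side is tr(YH) for the weighted swap H sending the basis vector (m, n) to s m · s n
-- times (n, m): the partial transpose has been moved from Y to the rank-one operator of the Schmidt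
-- vector.
open Matrix in
theorem schmidtVec_form (s : Fin 3 → ℝ) (Y : TwoQutrit) :
    star (schmidtVec s) ⬝ᵥ (partialTranspose Y *ᵥ schmidtVec s) =
      ∑ m, ∑ n, (s m : ℂ) * s n * Y (m, n) (n, m) := by
  simp [dotProduct, mulVec, schmidtVec, partialTranspose, Fintype.sum_prod_type,
    Fin.sum_univ_three]
  ring

/-- The position in `Fin 9` of each vector of the Bell-type basis for `matL1`. -/
def bellIndex1 (p : Fin 3 × Fin 3) : Fin 9 := ![![8, 7, 5], ![0, 6, 4], ![1, 2, 3]] p.1 p.2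

/-- The position in `Fin 9` of each vector of the Bell-type basis for `matL2`. -/
def bellIndex2 (p : Fin 3 × Fin 3) : Fin 9 := ![![8, 7, 6], ![0, 5, 4], ![1, 2, 3]] p.1 p.2

theorem bellIndex1_bijective : Function.Bijective bellIndex1 := by decide
theorem bellIndex2_bijective : Function.Bijective bellIndex2 := by decide

theorem sum_mul_bellBasis (f : Fin 3 × Fin 3 → ℂ) (q : Fin 3 × Fin 3) :
    ∑ p, f p * bellBasis p q = if q.1 = q.2 then f q else
      ((√2 / 2 : ℝ) : ℂ) * (f q.swap + if q.1 < q.2 then f q else -f q) := by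
  simp only [bellBasis, Matrix.of_apply]
  generalize ((√2 / 2 : ℝ) : ℂ) = r
  fin_cases q <;> simp [Fintype.sum_prod_type, Fin.sum_univ_three] <;> ring

theorem bellBasis_conj_diag (Y : TwoQutrit) (q : Fin 3 × Fin 3) :
    (star bellBasis * Y * bellBasis) q q = if q.1 = q.2 then Y q q else
      (Y q q + Y q.swap q.swap + if q.1 < q.2 then Y q q.swap + Y q.swap q
        else -(Y q q.swap + Y q.swap q)) / 2 := by
  have h2 : ((√2 / 2 : ℝ) : ℂ) * ((√2 / 2 : ℝ) : ℂ) = 1 / 2 := by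
    rw [← Complex.ofReal_mul, show √2 / 2 * (√2 / 2) = (1 / 2 : ℝ) by
      nlinarith [Real.mul_self_sqrt (show (0:ℝ) ≤ 2 by norm_num)]]
    norm_num
  have h3 : ∀ p, (star bellBasis * Y) q p = ∑ x, Y x p * bellBasis x q := by
    intro p
    rw [Matrix.mul_apply]
    refine Finset.sum_congr rfl fun x _ => ?_
    rw [Matrix.star_apply, mul_comm]
    congr 1
    simp only [bellBasis, Matrix.of_apply]
    split_ifs <;> simp only [star_one, star_neg, star_zero, Complex.star_def, Complex.conj_ofReal]
  rw [Matrix.mul_apply]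
  simp only [h3, sum_mul_bellBasis]
  split_ifs
  · rfl
  · linear_combination (Y q q + Y q.swap q.swap + Y q q.swap + Y q.swap q) * h2
  · linear_combination (Y q q + Y q.swap q.swap - Y q q.swap - Y q.swap q) * h2

theorem mu1_bellIndex1_eq (s : Fin 3 → ℝ) (q : Fin 3 × Fin 3) :
    mu1 s (bellIndex1 q) = if q.1 ≤ q.2 then s q.1 * s q.2 else -(s q.1 * s q.2) := by
  obtain ⟨i, j⟩ := q
  fin_cases i <;> fin_cases j <;>
    simp only [mu1, bellIndex1, Fin.isValue, Fin.zero_eta, Fin.mk_one, Fin.reduceFinMk,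
      Matrix.cons_val, Fin.reduceLE, if_true, if_false] <;> ring

/-- The weighted swap is diagonal in the Bell-type basis, with eigenvalue sᵢ² on e_ii and ±sᵢsⱼ on
the (anti)symmetric combinations. This is its trace pairing with Y in that basis. -/
theorem bell_form (s : Fin 3 → ℝ) (Y : TwoQutrit) :
    ∑ m, ∑ n, (s m : ℂ) * s n * Y (m, n) (n, m) =
      ∑ q, (mu1 s (bellIndex1 q) : ℂ) * (star bellBasis * Y * bellBasis) q q := by
  -- The summands at (m, n) do not match individually, because the Bell vectors mix (m, n) and (n,
  -- m); only the sum over both orders matches.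
  have hsym : ∀ f g : Fin 3 → Fin 3 → ℂ, (∀ m n, f m n + f n m = g m n + g n m) →
      ∑ m, ∑ n, f m n = ∑ m, ∑ n, g m n := by
    intro f g h
    have h2 : ∀ f : Fin 3 → Fin 3 → ℂ, ∑ m, ∑ n, (f m n + f n m) = 2 * ∑ m, ∑ n, f m n := by
      intro f
      simp only [Finset.sum_add_distrib]
      rw [Finset.sum_comm (f := fun m n => f n m)]
      ring
    have h3 := h2 f
    simp only [h] at h3
    rw [h2 g] at h3
    exact (mul_left_cancel₀ two_ne_zero h3).symm
  rw [Fintype.sum_prod_type]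
  apply hsym
  intro m n
  rw [mu1_bellIndex1_eq, mu1_bellIndex1_eq, bellBasis_conj_diag, bellBasis_conj_diag]
  rcases lt_trichotomy m n with h | h | h
  · simp only [h.ne, h.ne', h.le, h.not_ge, h, h.not_gt, if_true, if_false, Prod.swap_prod_mk]
    push_cast
    ring
  · subst h
    simp only [le_refl, if_true]
    push_cast
    ring
  · simp only [h.ne, h.ne', h.le, h.not_ge, h, h.not_gt, if_true, if_false, Prod.swap_prod_mk]
    push_cast
    ring

/-- Both vectors list the same nine eigenvalues and differ only in the order of s₁² and s₀s₂, so one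
Bell form serves both matrices. -/
theorem mu1_bellIndex1 (s : Fin 3 → ℝ) (q : Fin 3 × Fin 3) :
    mu1 s (bellIndex1 q) = mu2 s (bellIndex2 q) := by
  obtain ⟨i, j⟩ := q
  fin_cases i <;> fin_cases j <;>
    simp only [mu1, mu2, bellIndex1, bellIndex2, Fin.isValue, Fin.zero_eta, Fin.mk_one,
      Fin.reduceFinMk, Matrix.cons_val]

/-! ### Necessity of the two matrix inequalities -/

/-- The lexicographic numbering of the product basis. -/
abbrev lexIndex : Fin 3 × Fin 3 ≃ Fin 9 := finProdFinEquiv (m := 3) (n := 3)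

/-- The real parts of the diagonal entries, in lexicographic order. -/
noncomputable def realDiag (σ : TwoQutrit) : Fin 9 → ℝ :=
  fun i => (σ (lexIndex.symm i) (lexIndex.symm i)).re

theorem absPPT_conj {ρ : TwoQutrit} (hρ : ρ ∈ absPPT) {W : TwoQutrit}
    (hW : W ∈ Matrix.unitaryGroup (Fin 3 × Fin 3) ℂ) : W * ρ * star W ∈ absPPT := by
  refine ⟨⟨hρ.1.1.mul_mul_conjTranspose_same W, ?_⟩, fun U hU => ?_⟩
  · rw [Matrix.trace_mul_comm, ← mul_assoc, Matrix.mem_unitaryGroup_iff'.1 hW, one_mul, hρ.1.2]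
  · have := hρ.2 (U * W) (mul_mem hU hW)
    simpa only [star_mul, mul_assoc] using this

/-- The unitary used for testing carries the product basis to the Bell-type basis in the order
prescribed by `f`, and the test vector is `schmidtVec s`. No ordering of `s` or of the diagonal is
needed, so the functional is nonnegative on all of `absPPT`. -/
theorem absPPT_sum_nonneg {ρ : TwoQutrit} (hρ : ρ ∈ absPPT) (s : Fin 3 → ℝ)
    (f : Fin 3 × Fin 3 → Fin 9) (hf : Function.Bijective f) (μ : Fin 9 → ℝ)
    (hμ : ∀ q, mu1 s (bellIndex1 q) = μ (f q)) : 0 ≤ ∑ i, μ i * realDiag ρ i := by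
  set π : Equiv.Perm (Fin 3 × Fin 3) := (Equiv.ofBijective f hf).trans lexIndex.symm
  have hB := bellBasis_mem_unitaryGroup
  have hU : bellBasis.submatrix id π.symm ∈ Matrix.unitaryGroup (Fin 3 × Fin 3) ℂ := by
    rw [Matrix.mem_unitaryGroup_iff, Matrix.star_eq_conjTranspose, Matrix.conjTranspose_submatrix,
      Matrix.submatrix_mul_equiv, ← Matrix.star_eq_conjTranspose, Matrix.mem_unitaryGroup_iff.1 hB,
      Matrix.submatrix_id_id]
  have h1 := hρ.2 _ hU
  have h2 : bellBasis.submatrix id π.symm * ρ * star (bellBasis.submatrix id π.symm) =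
      bellBasis * ρ.submatrix π π * star bellBasis := by
    have h3 : ρ = (ρ.submatrix π π).submatrix π.symm π.symm := by simp
    conv_lhs => rw [h3]
    rw [Matrix.star_eq_conjTranspose, Matrix.conjTranspose_submatrix, Matrix.submatrix_mul_equiv,
      Matrix.submatrix_mul_equiv, Matrix.submatrix_id_id, Matrix.star_eq_conjTranspose]
  rw [h2] at h1
  have h4 := h1.dotProduct_mulVec_nonneg (schmidtVec s)
  have h5 : star bellBasis * (bellBasis * ρ.submatrix π π * star bellBasis) * bellBasis =
      ρ.submatrix π π := by
    rw [← mul_assoc, ← mul_assoc, Matrix.mem_unitaryGroup_iff'.1 hB, one_mul, mul_assoc,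
      Matrix.mem_unitaryGroup_iff'.1 hB, mul_one]
  rw [schmidtVec_form, bell_form, h5] at h4
  have h6 := (Complex.le_def.1 h4).1
  rw [Complex.zero_re, Complex.re_sum] at h6
  refine h6.trans_eq ?_
  rw [← (Equiv.ofBijective f hf).sum_comp]
  refine Finset.sum_congr rfl fun q _ => ?_
  rw [Complex.re_ofReal_mul, hμ]
  rfl

theorem matL1_isHermitian (d : Fin 9 → ℝ) : (matL1 d).IsHermitian := by
  ext i j
  fin_cases i <;> fin_cases j <;> simp [matL1, Matrix.conjTranspose_apply]

theorem matL2_isHermitian (d : Fin 9 → ℝ) : (matL2 d).IsHermitian := by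
  ext i j
  fin_cases i <;> fin_cases j <;> simp [matL2, Matrix.conjTranspose_apply]

theorem matL1_posSemidef_iff {d : Fin 9 → ℝ} :
    (matL1 d).PosSemidef ↔ ∀ s, 0 ≤ ∑ i, mu1 s i * d i := by
  rw [Matrix.posSemidef_iff_dotProduct_mulVec]
  refine ⟨fun h s => ?_, fun h => ⟨matL1_isHermitian d, fun s => ?_⟩⟩
  · have := h.2 s
    rw [star_trivial, dotProduct_matL1] at this
    linarith
  · rw [star_trivial, dotProduct_matL1]
    linarith [h s]

theorem matL2_posSemidef_iff {d : Fin 9 → ℝ} :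
    (matL2 d).PosSemidef ↔ ∀ s, 0 ≤ ∑ i, mu2 s i * d i := by
  rw [Matrix.posSemidef_iff_dotProduct_mulVec]
  refine ⟨fun h s => ?_, fun h => ⟨matL2_isHermitian d, fun s => ?_⟩⟩
  · have := h.2 s
    rw [star_trivial, dotProduct_matL2] at this
    linarith
  · rw [star_trivial, dotProduct_matL2]
    linarith [h s]

/-- Here ρ need not be diagonal nor its diagonal sorted; this makes the quadratic form of L₁ a
supporting functional for the whole set. -/
theorem matL1_posSemidef_of_absPPT {ρ : TwoQutrit} (hρ : ρ ∈ absPPT) :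
    (matL1 (realDiag ρ)).PosSemidef :=
  matL1_posSemidef_iff.2 fun s =>
    absPPT_sum_nonneg hρ s bellIndex1 bellIndex1_bijective _ fun _ => rfl

theorem matL2_posSemidef_of_absPPT {ρ : TwoQutrit} (hρ : ρ ∈ absPPT) :
    (matL2 (realDiag ρ)).PosSemidef :=
  matL2_posSemidef_iff.2 fun s =>
    absPPT_sum_nonneg hρ s bellIndex2 bellIndex2_bijective _ (mu1_bellIndex1 s)

theorem realDiag_diagOp (d : Fin 9 → ℝ) : realDiag (diagOp d) = d := by
  ext i
  simp [realDiag, diagOp]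

/-! ### Sufficiency, by Birkhoff's theorem and rearrangement -/

/-- A bilinear pairing with a doubly stochastic matrix is bounded below by its smallest value on
permutations. -/
theorem doublyStochastic_sum_nonneg {n : Type*} [Fintype n] [DecidableEq n] {M : Matrix n n ℝ}
    (hM : M ∈ doublyStochastic ℝ n) (x y : n → ℝ)
    (h : ∀ σ : Equiv.Perm n, 0 ≤ ∑ i, x i * y (σ i)) : 0 ≤ ∑ i, x i * ∑ j, M i j * y j := by
  obtain ⟨w, hw0, -, rfl⟩ := exists_eq_sum_perm_of_mem_doublyStochastic hM
  have : ∑ i, x i * ∑ j, (∑ σ : Equiv.Perm n, w σ • σ.permMatrix ℝ) i j * y j =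
      ∑ σ : Equiv.Perm n, w σ * ∑ i, x i * y (σ i) := by
    simp only [Finset.mul_sum, Matrix.sum_apply, Matrix.smul_apply, Finset.sum_mul]
    rw [Finset.sum_comm_cycle]
    refine Finset.sum_congr rfl fun σ _ => Finset.sum_congr rfl fun i _ => ?_
    rw [Finset.sum_eq_single (σ i)]
    · simp [Equiv.toPEquiv_apply]
      ring
    · intro j _ hj
      simp [Equiv.toPEquiv_apply, hj.symm]
    · simp
  rw [this]
  exact Finset.sum_nonneg fun σ _ => mul_nonneg (hw0 σ) (h σ)

/-- The only comparison not forced by s₀ ≥ s₁ ≥ s₂ ≥ 0 is that of s₀s₂ with s₁². With `mu2_monotone`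
both cases are covered, which is why two matrices suffice. -/
theorem mu1_monotone {s : Fin 3 → ℝ} (h0 : 0 ≤ s 2) (h1 : s 2 ≤ s 1) (h2 : s 1 ≤ s 0)
    (h : s 0 * s 2 ≤ s 1 ^ 2) : Monotone (mu1 s) := by
  rw [Fin.monotone_iff_le_succ]
  intro i
  fin_cases i <;> simp [mu1] <;> nlinarith

theorem mu2_monotone {s : Fin 3 → ℝ} (h0 : 0 ≤ s 2) (h1 : s 2 ≤ s 1) (h2 : s 1 ≤ s 0)
    (h : s 1 ^ 2 ≤ s 0 * s 2) : Monotone (mu2 s) := by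
  rw [Fin.monotone_iff_le_succ]
  intro i
  fin_cases i <;> simp [mu2] <;> nlinarith

theorem normSq_mem_doublyStochastic {n : Type*} [Fintype n] [DecidableEq n] {Z : Matrix n n ℂ}
    (hZ : Z ∈ Matrix.unitaryGroup n ℂ) :
    (Matrix.of fun i j => Complex.normSq (Z i j)) ∈ doublyStochastic ℝ n := by
  rw [mem_doublyStochastic_iff_sum]
  refine ⟨fun i j => Complex.normSq_nonneg _, fun i => ?_, fun j => ?_⟩
  · have h := congrArg Complex.re (congrFun (congrFun (Matrix.mem_unitaryGroup_iff.1 hZ) i) i)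
    simpa [Matrix.mul_apply, Matrix.star_apply, Complex.mul_conj] using h
  · have h := congrArg Complex.re (congrFun (congrFun (Matrix.mem_unitaryGroup_iff'.1 hZ) j) j)
    simpa [Matrix.mul_apply, Matrix.star_apply, mul_comm, Complex.mul_conj] using h

theorem conj_diagonal_diag {n : Type*} [Fintype n] [DecidableEq n] (Z : Matrix n n ℂ)
    (l : n → ℝ) (q : n) : (Z * Matrix.diagonal (fun p => (l p : ℂ)) * star Z) q q =
      ((∑ p, Complex.normSq (Z q p) * l p : ℝ) : ℂ) := by
  simp only [Matrix.mul_apply (M := Z * _), Matrix.mul_diagonal, Matrix.star_apply,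
    Complex.ofReal_sum]
  refine Finset.sum_congr rfl fun p _ => ?_
  rw [Complex.ofReal_mul, ← Complex.mul_conj, Complex.star_def]
  ring

open scoped Kronecker Matrix in
/-- Sufficiency of the two linear matrix inequalities for a decreasing spectrum. -/
theorem diagOp_mem_absPPT {l : Fin 9 → ℝ} (hl : Antitone l) (h0 : ∀ i, 0 ≤ l i)
    (hsum : ∑ i, l i = 1) (h1 : (matL1 l).PosSemidef) (h2 : (matL2 l).PosSemidef) :
    diagOp l ∈ absPPT := by
  have hherm : (diagOp l).PosSemidef := by
    refine Matrix.PosSemidef.diagonal fun p => ?_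
    exact Complex.zero_le_real.2 (h0 _)
  refine ⟨⟨hherm, ?_⟩, fun U hU => ?_⟩
  · rw [diagOp, Matrix.trace_diagonal, ← Complex.ofReal_sum,
      lexIndex.sum_comp l, hsum, Complex.ofReal_one]
  have hσ := hherm.mul_mul_conjTranspose_same U
  refine Matrix.PosSemidef.of_dotProduct_mulVec_nonneg (partialTranspose_isHermitian hσ.1)
    fun ψ => ?_
  -- The singular value decomposition of ψ, reshaped to a 3 × 3 matrix, is its Schmidt
  -- decomposition.
  obtain ⟨V, hV, W, hW, s, hs, hs0, hA⟩ :=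
    exists_singularValueDecomposition (Matrix.of fun i j => ψ (i, j))
  set X := V ⊗ₖ W with hX
  have hXu : X ∈ Matrix.unitaryGroup (Fin 3 × Fin 3) ℂ := Matrix.kronecker_mem_unitary hV hW
  set Z := star bellBasis * (star X * U) with hZ
  have hZu : Z ∈ Matrix.unitaryGroup (Fin 3 × Fin 3) ℂ :=
    mul_mem (Unitary.star_mem bellBasis_mem_unitaryGroup) (mul_mem (Unitary.star_mem hXu) hU)
  set Y := star X * (U * diagOp l * star U) * X with hY
  have hYX : U * diagOp l * star U = X * Y * star X := by
    rw [hY]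
    simp only [← mul_assoc, Matrix.mem_unitaryGroup_iff.1 hXu, one_mul]
    rw [mul_assoc _ X, Matrix.mem_unitaryGroup_iff.1 hXu, mul_one]
  have hψ : star (V ⊗ₖ W.map star) *ᵥ ψ = schmidtVec s := by
    have hD : star V * (Matrix.of fun i j => ψ (i, j)) * W =
        Matrix.diagonal (fun i => (s i : ℂ)) := by
      rw [hA]
      simp only [← mul_assoc, Matrix.mem_unitaryGroup_iff'.1 hV, one_mul]
      rw [mul_assoc, Matrix.mem_unitaryGroup_iff'.1 hW, mul_one]
    ext ⟨m, n⟩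
    have h := congrFun (congrFun hD m) n
    rw [Matrix.diagonal_apply] at h
    rw [schmidtVec, ← h]
    simp only [Matrix.mulVec, dotProduct, Fintype.sum_prod_type, Matrix.star_apply,
      Matrix.kronecker_apply, Matrix.map_apply, Matrix.mul_apply, Matrix.of_apply, star_mul',
      star_star, Finset.sum_mul]
    rw [Finset.sum_comm]
    refine Finset.sum_congr rfl fun i _ => Finset.sum_congr rfl fun j _ => ?_
    ring
  have hform : star ψ ⬝ᵥ (partialTranspose (U * diagOp l * star U) *ᵥ ψ) =
      star (schmidtVec s) ⬝ᵥ (partialTranspose Y *ᵥ schmidtVec s) := by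
    rw [hYX, partialTranspose_kronecker_conj, ← hψ, ← Matrix.mulVec_mulVec,
      ← Matrix.mulVec_mulVec, Matrix.dotProduct_mulVec, Matrix.star_mulVec,
      Matrix.star_eq_conjTranspose, Matrix.conjTranspose_conjTranspose]
  have hYZ : star bellBasis * Y * bellBasis = Z * diagOp l * star Z := by
    rw [hY, hZ]
    simp only [star_mul, star_star, mul_assoc]
  rw [hform, schmidtVec_form, bell_form, hYZ]
  simp only [diagOp, conj_diagonal_diag]
  rw [← Complex.ofReal_zero]
  simp only [← Complex.ofReal_mul, ← Complex.ofReal_sum]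
  refine Complex.real_le_real.2 ?_
  -- The diagonal of ZDZ† is the image of the spectrum under the doubly stochastic matrix |Z|², so
  -- only permutations have to be checked.
  refine doublyStochastic_sum_nonneg (normSq_mem_doublyStochastic hZu)
    (fun q => mu1 s (bellIndex1 q)) (fun p => l (lexIndex p)) fun π => ?_
  have key : ∀ (f : Fin 3 × Fin 3 → Fin 9) (μ : Fin 9 → ℝ), Function.Bijective f →
      Monotone μ → (∀ q, mu1 s (bellIndex1 q) = μ (f q)) → 0 ≤ ∑ i, μ i * l i →
      0 ≤ ∑ q, mu1 s (bellIndex1 q) * l (lexIndex (π q)) := by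
    intro f μ hf hμ hq hpos
    set e := Equiv.ofBijective f hf
    -- Increasing coefficients against a decreasing spectrum: the identity matching gives the
    -- smallest sum, and that sum is the quadratic form of L₁ or L₂.
    have h := (hμ.antivary hl).sum_mul_le_sum_mul_comp_perm
      (σ := (e.symm.trans π).trans lexIndex)
    refine hpos.trans (h.trans_eq ?_)
    rw [← e.sum_comp]
    refine Finset.sum_congr rfl fun q _ => ?_
    rw [hq]
    simp [e]
  have a0 := hs0 2
  have a1 : s 2 ≤ s 1 := hs (by decide)
  have a2 : s 1 ≤ s 0 := hs (by decide)
  rcases le_total (s 0 * s 2) (s 1 ^ 2) with h | h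
  · exact key bellIndex1 _ bellIndex1_bijective (mu1_monotone a0 a1 a2 h) (fun _ => rfl)
      (matL1_posSemidef_iff.1 h1 s)
  · exact key bellIndex2 _ bellIndex2_bijective (mu2_monotone a0 a1 a2 h) (mu1_bellIndex1 s)
      (matL2_posSemidef_iff.1 h2 s)

/-! ### Plane reflections and rigidity of faces -/

/-- The reflection acting in the plane of `p` and `q` by the matrix `(α, conj β; β, -α)`. -/
noncomputable def planeReflection (p q : Fin 3 × Fin 3) (α : ℝ) (β : ℂ) : TwoQutrit :=
  Matrix.of fun a b =>
    if b = p then (if a = p then (α : ℂ) else if a = q then β else 0)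
    else if b = q then (if a = p then star β else if a = q then -(α : ℂ) else 0)
    else if a = b then 1 else 0

theorem sum_mul_planeReflection {p q : Fin 3 × Fin 3} (hpq : p ≠ q) (α : ℝ) (β : ℂ)
    (f : Fin 3 × Fin 3 → ℂ) (b : Fin 3 × Fin 3) :
    ∑ a, f a * planeReflection p q α β a b =
      if b = p then f p * α + f q * β else if b = q then f p * star β - f q * α else f b := by
  simp only [planeReflection, Matrix.of_apply]
  split_ifs with h1 h2
  · rw [Finset.sum_eq_add p q hpq (by intro c _ hc; simp [hc.1, hc.2]) (by simp) (by simp)]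
    simp [hpq.symm]
  · rw [Finset.sum_eq_add p q hpq (by intro c _ hc; simp [hc.1, hc.2]) (by simp) (by simp)]
    simp [hpq.symm, sub_eq_add_neg]
  · simp

theorem star_planeReflection {p q : Fin 3 × Fin 3} (hpq : p ≠ q) (α : ℝ) (β : ℂ) :
    star (planeReflection p q α β) = planeReflection p q α β := by
  ext a b
  simp only [planeReflection, Matrix.star_apply, Matrix.of_apply]
  by_cases ha : a = p
  · by_cases hb : b = p
    · simp [ha, hb]
    · by_cases hb' : b = q
      · simp [ha, hb', hpq.symm]
      · simp [ha, hb, hb', Ne.symm hb]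
  · by_cases ha' : a = q
    · by_cases hb : b = p
      · simp [ha', hb, hpq.symm]
      · by_cases hb' : b = q
        · simp [ha', hb', hpq.symm]
        · simp [ha', hb, hb', hpq.symm, Ne.symm hb']
    · by_cases hb : b = p
      · simp [ha, ha', hb, Ne.symm ha]
      · by_cases hb' : b = q
        · simp [ha, ha', hb', hpq.symm, Ne.symm ha']
        · simp [ha, ha', hb, hb', eq_comm, apply_ite (starRingEnd ℂ)]

theorem planeReflection_mem_unitaryGroup {p q : Fin 3 × Fin 3} (hpq : p ≠ q) {α : ℝ} {β : ℂ}
    (h : α ^ 2 + Complex.normSq β = 1) :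
    planeReflection p q α β ∈ Matrix.unitaryGroup (Fin 3 × Fin 3) ℂ := by
  have h' : (α : ℂ) ^ 2 + β * star β = 1 := by
    rw [Complex.star_def, Complex.mul_conj]
    exact_mod_cast h
  rw [Matrix.mem_unitaryGroup_iff', star_planeReflection hpq]
  ext a b
  rw [Matrix.mul_apply, sum_mul_planeReflection hpq]
  simp only [planeReflection, Matrix.of_apply, Matrix.one_apply, hpq, hpq.symm, if_true, if_false]
  split_ifs <;> simp_all <;> first | linear_combination h' | ring

theorem star_planeReflection_mul_diagOp {p q : Fin 3 × Fin 3} (hpq : p ≠ q) {α : ℝ} {β : ℂ}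
    (h : α ^ 2 + Complex.normSq β = 1) {l : Fin 9 → ℝ} (hl : l (lexIndex p) = l (lexIndex q)) :
    star (planeReflection p q α β) * diagOp l * planeReflection p q α β = diagOp l := by
  have hc : diagOp l * planeReflection p q α β = planeReflection p q α β * diagOp l := by
    ext a b
    rw [diagOp, Matrix.diagonal_mul, Matrix.mul_diagonal]
    simp only [planeReflection, Matrix.of_apply]
    split_ifs <;> simp_all [mul_comm]
  rw [mul_assoc, hc, ← mul_assoc,
    Matrix.mem_unitaryGroup_iff'.1 (planeReflection_mem_unitaryGroup hpq h), one_mul]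

theorem planeReflection_conj_apply (p q : Fin 3 × Fin 3) (α : ℝ) (β : ℂ)
    (ρ : TwoQutrit) (a b : Fin 3 × Fin 3) :
    (star (planeReflection p q α β) * ρ * planeReflection p q α β) a b =
      ∑ y, (∑ x, star (planeReflection p q α β x a) * ρ x y) * planeReflection p q α β y b := by
  simp only [Matrix.mul_apply, Matrix.star_apply]

theorem sum_star_planeReflection_mul {p q : Fin 3 × Fin 3} (hpq : p ≠ q) (α : ℝ) (β : ℂ)
    (f : Fin 3 × Fin 3 → ℂ) (b : Fin 3 × Fin 3) :
    ∑ a, star (planeReflection p q α β a b) * f a =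
      if b = p then f p * α + f q * star β else if b = q then f p * β - f q * α else f b := by
  have h := congrArg star (sum_mul_planeReflection hpq α β (fun a => star (f a)) b)
  rw [star_sum] at h
  simp only [star_mul', star_star] at h
  rw [Finset.sum_congr rfl fun a _ => mul_comm _ _, h]
  split_ifs <;> simp

/-- Only the entries at `p` and `q` change, by opposite amounts. The term linear in β sees the
off-diagonal entry, so inequalities on diagonals give information on ρ p q. -/
theorem realDiag_planeReflection {p q : Fin 3 × Fin 3} (hpq : p ≠ q) {α : ℝ} {β : ℂ}
    (h : α ^ 2 + Complex.normSq β = 1) {ρ : TwoQutrit} (hρ : ρ.IsHermitian) :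
    realDiag (star (planeReflection p q α β) * ρ * planeReflection p q α β) = realDiag ρ +
      (Complex.normSq β * (realDiag ρ (lexIndex q) - realDiag ρ (lexIndex p)) +
        2 * α * (β * ρ p q).re) •
        (Pi.single (lexIndex p) 1 - Pi.single (lexIndex q) 1 : Fin 9 → ℝ) := by
  have hqp : ρ q p = star (ρ p q) := (congrFun (congrFun hρ q) p).symm
  have him : ∀ x, (ρ x x).im = 0 := fun x => by
    have := congrArg Complex.im (congrFun (congrFun hρ x) x)
    simp [Matrix.conjTranspose_apply] at this
    linarith
  ext i
  obtain ⟨a, rfl⟩ := lexIndex.surjective i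
  have hr : ∀ (σ : TwoQutrit) (x), realDiag σ (lexIndex x) = (σ x x).re := by
    intro σ x
    simp [realDiag]
  rw [Pi.add_apply, Pi.smul_apply, Pi.sub_apply, hr, hr, hr, hr, planeReflection_conj_apply,
    sum_mul_planeReflection hpq]
  simp only [sum_star_planeReflection_mul hpq, Pi.single_apply, lexIndex.injective.eq_iff]
  rw [Complex.normSq_apply] at h ⊢
  by_cases h1 : a = p
  · subst h1
    simp [hpq, hqp, him]
    linear_combination (ρ a a).re * h
  · by_cases h2 : a = q
    · subst h2
      simp [h1, hqp, him]
      linear_combination (ρ a a).re * h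
    · simp [h1, h2]

/-- A real function that dominates zero near a simple zero has no linear term. -/
theorem eq_zero_of_forall_reflection_nonneg {A r : ℝ}
    (h : ∀ α β : ℝ, α ^ 2 + β ^ 2 = 1 → 0 ≤ β ^ 2 * A + 2 * α * β * r) : r = 0 := by
  have key : ∀ t : ℝ, 0 ≤ 4 * t ^ 2 * A + 4 * t * (1 - t ^ 2) * r := by
    intro t
    have h0 : (1 + t ^ 2) ≠ 0 := by positivity
    -- Rational parametrisation of the circle near (1, 0), the point where the expression vanishes.
    have h1 := h ((1 - t ^ 2) / (1 + t ^ 2)) (2 * t / (1 + t ^ 2)) (by field_simp; ring)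
    have h2 : (2 * t / (1 + t ^ 2)) ^ 2 * A +
        2 * ((1 - t ^ 2) / (1 + t ^ 2)) * (2 * t / (1 + t ^ 2)) * r =
        (4 * t ^ 2 * A + 4 * t * (1 - t ^ 2) * r) / (1 + t ^ 2) ^ 2 := by
      field_simp
      ring
    rw [h2] at h1
    by_contra hc
    exact absurd h1 (not_le.2 (div_neg_of_neg_of_pos (not_le.1 hc) (by positivity)))
  have l1 : Tendsto (fun t : ℝ => t * A + (1 - t ^ 2) * r) (𝓝 0) (𝓝 r) := by
    have : Continuous fun t : ℝ => t * A + (1 - t ^ 2) * r := by fun_prop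
    simpa using this.tendsto 0
  apply le_antisymm
  · refine le_of_tendsto (l1.mono_left (nhdsWithin_le_nhds (s := Iio 0))) ?_
    filter_upwards [self_mem_nhdsWithin] with t ht
    have ht' : t < 0 := ht
    nlinarith [key t]
  · refine ge_of_tendsto (l1.mono_left (nhdsWithin_le_nhds (s := Ioi 0))) ?_
    filter_upwards [self_mem_nhdsWithin] with t ht
    have ht' : 0 < t := ht
    nlinarith [key t]

theorem eq_zero_of_re_eq_zero {w : ℂ} (h1 : (1 * w).re = 0) (h2 : (Complex.I * w).re = 0) :
    w = 0 := by
  apply Complex.ext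
  · simpa using h1
  · simpa using h2

theorem absPPT_star_conj {ρ : TwoQutrit} (hρ : ρ ∈ absPPT) {W : TwoQutrit}
    (hW : W ∈ Matrix.unitaryGroup (Fin 3 × Fin 3) ℂ) : star W * ρ * W ∈ absPPT := by
  simpa using absPPT_conj hρ (Unitary.star_mem hW)

/-- Off-diagonal entries vanish where a nonnegative diagonal functional attains zero. -/
theorem apply_eq_zero_of_sum_eq_zero {μ : Fin 9 → ℝ}
    (hpos : ∀ ρ ∈ absPPT, 0 ≤ ∑ i, μ i * realDiag ρ i) {ρ : TwoQutrit} (hρ : ρ ∈ absPPT)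
    (h0 : ∑ i, μ i * realDiag ρ i = 0) {p q : Fin 3 × Fin 3}
    (hμ : μ (lexIndex p) ≠ μ (lexIndex q)) : ρ p q = 0 := by
  have hpq : p ≠ q := fun h => hμ (by rw [h])
  have key : ∀ z : ℂ, Complex.normSq z = 1 → (z * ρ p q).re = 0 := by
    intro z hz
    -- Along the reflections with parameters α and βz the functional stays nonnegative and vanishes
    -- at β = 0, so its term linear in β is zero.
    have hm : (μ (lexIndex p) - μ (lexIndex q)) * (z * ρ p q).re = 0 := by
      refine eq_zero_of_forall_reflection_nonneg (A := (μ (lexIndex p) - μ (lexIndex q)) *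
        (realDiag ρ (lexIndex q) - realDiag ρ (lexIndex p))) fun α β hαβ => ?_
      have hn : Complex.normSq ((β : ℂ) * z) = β ^ 2 := by
        rw [Complex.normSq_mul, hz, Complex.normSq_ofReal]; ring
      have hu : α ^ 2 + Complex.normSq ((β : ℂ) * z) = 1 := by rw [hn, hαβ]
      have h1 := hpos _ (absPPT_star_conj hρ (planeReflection_mem_unitaryGroup hpq hu))
      rw [realDiag_planeReflection hpq hu hρ.1.1.1, hn, mul_assoc (β : ℂ), Complex.re_ofReal_mul] at h1
      simp only [Pi.add_apply, Pi.smul_apply, Pi.sub_apply, mul_add, Finset.sum_add_distrib, h0,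
        smul_eq_mul, mul_sub, Finset.sum_sub_distrib, Pi.single_apply, mul_ite, mul_one, mul_zero,
        Finset.sum_ite_eq', Finset.mem_univ, if_true] at h1
      refine h1.trans_eq ?_
      ring
    exact (mul_eq_zero.1 hm).resolve_left (sub_ne_zero.2 hμ)
  exact eq_zero_of_re_eq_zero (key 1 (by simp)) (key Complex.I (by simp))

/-- Rigidity of a face of `absPPT` cut out by a supporting diagonal functional at a diagonal
state. -/
theorem eq_diagOp_of_mem_openSegment {l μ : Fin 9 → ℝ} (K : (Fin 9 → ℝ) →ₗ[ℝ] (Fin 3 → ℝ))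
    (hpos : ∀ ρ ∈ absPPT, 0 ≤ ∑ i, μ i * realDiag ρ i)
    (hK : ∀ ρ ∈ absPPT, ∑ i, μ i * realDiag ρ i = 0 → K (realDiag ρ) = 0)
    (hinj : ∀ i j : Fin 9, i ≠ j → K (Pi.single i 1) ≠ K (Pi.single j 1))
    (hl : ∑ i, μ i * l i = 0)
    (hsep : ∀ i j, l i ≠ l j →
      (∃ i', l i' = l i ∧ μ i' ≠ μ j) ∨ (∃ j', l j' = l j ∧ μ i ≠ μ j'))
    {ρ₁ ρ₂ : TwoQutrit} (h₁ : ρ₁ ∈ absPPT) (h₂ : ρ₂ ∈ absPPT)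
    (hseg : diagOp l ∈ openSegment ℝ ρ₁ ρ₂) :
    ρ₁ = diagOp (realDiag ρ₁) ∧ (∀ i j, l i = l j → realDiag ρ₁ i = realDiag ρ₁ j) ∧
      K (realDiag ρ₁) = 0 := by
  -- Conjugation by W gives another decomposition of the same diagonal state; the functional is
  -- nonnegative on both parts and zero on the mixture, hence zero on each.
  have hface : ∀ W ∈ Matrix.unitaryGroup (Fin 3 × Fin 3) ℂ,
      star W * diagOp l * W = diagOp l → ∑ i, μ i * realDiag (star W * ρ₁ * W) i = 0 := by
    intro W hW hWl
    obtain ⟨t, u, ht, hu, -, htu⟩ := hseg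
    have h3 : t • (star W * ρ₁ * W) + u • (star W * ρ₂ * W) = diagOp l := by
      rw [← hWl, ← htu]
      simp [mul_add, add_mul]
    have h4 : ∀ i, t * realDiag (star W * ρ₁ * W) i + u * realDiag (star W * ρ₂ * W) i = l i := by
      intro i
      rw [← congrFun (realDiag_diagOp l) i, ← h3]
      simp [realDiag]
    have h5 : t * ∑ i, μ i * realDiag (star W * ρ₁ * W) i +
        u * ∑ i, μ i * realDiag (star W * ρ₂ * W) i = 0 := by
      rw [← hl, Finset.mul_sum, Finset.mul_sum, ← Finset.sum_add_distrib]
      refine Finset.sum_congr rfl fun i _ => ?_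
      rw [← h4 i]
      ring
    have h6 := hpos _ (absPPT_star_conj h₁ hW)
    have h7 := mul_nonneg hu.le (hpos _ (absPPT_star_conj h₂ hW))
    have h8 : t * ∑ i, μ i * realDiag (star W * ρ₁ * W) i ≤ 0 := by linarith
    exact le_antisymm (nonpos_of_mul_nonpos_right h8 ht) h6
  have h0 : ∑ i, μ i * realDiag ρ₁ i = 0 := by simpa using hface 1 (one_mem _) (by simp)
  have hK0 := hK ρ₁ h₁ h0
  -- A reflection inside an eigenspace keeps `ρ₁` on the face, so K annihilates the change of its
  -- diagonal. That change is a multiple of e_p − e_q, on which K does not vanish.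
  have hblock : ∀ p q : Fin 3 × Fin 3, p ≠ q → l (lexIndex p) = l (lexIndex q) →
      ∀ (α : ℝ) (β : ℂ), α ^ 2 + Complex.normSq β = 1 →
      Complex.normSq β * (realDiag ρ₁ (lexIndex q) - realDiag ρ₁ (lexIndex p)) +
        2 * α * (β * ρ₁ p q).re = 0 := by
    intro p q hpq hlpq α β hαβ
    have hu := planeReflection_mem_unitaryGroup hpq hαβ
    have h1 := hK _ (absPPT_star_conj h₁ hu)
      (hface _ hu (star_planeReflection_mul_diagOp hpq hαβ hlpq))
    rw [realDiag_planeReflection hpq hαβ h₁.1.1.1, map_add, hK0, zero_add, map_smul, map_sub] at h1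
    exact (smul_eq_zero.1 h1).resolve_right
      (sub_ne_zero.2 (hinj _ _ (lexIndex.injective.ne hpq)))
  have hdiag : ∀ p q : Fin 3 × Fin 3, l (lexIndex p) = l (lexIndex q) →
      realDiag ρ₁ (lexIndex p) = realDiag ρ₁ (lexIndex q) := by
    intro p q hlpq
    by_cases hpq : p = q
    · rw [hpq]
    -- The reflection with α = 0, β = 1 exchanges p and q.
    · have := hblock p q hpq hlpq 0 1 (by simp)
      simp at this
      linarith
  -- If the coefficients at p and q happen to agree, p is first exchanged with an index p' of the
  -- same eigenvalue whose coefficient differs from that at q.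
  have hoff_swap : ∀ p p' q : Fin 3 × Fin 3, l (lexIndex p') = l (lexIndex p) →
      l (lexIndex p) ≠ l (lexIndex q) → μ (lexIndex p') ≠ μ (lexIndex q) → ρ₁ p q = 0 := by
    intro p p' q hl1 hl2 hm
    by_cases hpp : p = p'
    · subst hpp
      exact apply_eq_zero_of_sum_eq_zero hpos h₁ h0 hm
    · have hq1 : q ≠ p := fun h => hl2 (by rw [h])
      have hq2 : q ≠ p' := fun h => hl2 (by rw [h, hl1])
      have hαβ : (0 : ℝ) ^ 2 + Complex.normSq 1 = 1 := by simp
      have hu := planeReflection_mem_unitaryGroup hpp hαβ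
      have h1 := apply_eq_zero_of_sum_eq_zero hpos (absPPT_star_conj h₁ hu)
        (hface _ hu (star_planeReflection_mul_diagOp hpp hαβ hl1.symm)) hm
      rw [planeReflection_conj_apply, sum_mul_planeReflection hpp] at h1
      simp only [sum_star_planeReflection_mul hpp] at h1
      simpa [hq1, hq2, Ne.symm hpp] using h1
  have hherm : ∀ p q, ρ₁ p q = star (ρ₁ q p) := fun p q =>
    (congrFun (congrFun h₁.1.1.1 p) q).symm
  refine ⟨?_, fun i j hij => ?_, hK0⟩
  · ext p q
    rw [diagOp, Matrix.diagonal_apply]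
    split_ifs with hpq
    · subst hpq
      have h1 : ((ρ₁ p p).re : ℂ) = ρ₁ p p := Complex.conj_eq_iff_re.1 (hherm p p).symm
      rw [← h1]
      simp [realDiag]
    · by_cases hlpq : l (lexIndex p) = l (lexIndex q)
      · have hd := hdiag p q hlpq
        refine eq_zero_of_re_eq_zero ?_ ?_
        -- Any point of the circle with αβ ≠ 0 isolates Re(ρ₁ p q) once the diagonal gap is zero;
        -- the factor i below isolates the imaginary part.
        · have := hblock p q hpq hlpq (3 / 5) (4 / 5) (by
            rw [show (4 / 5 : ℂ) = ((4 / 5 : ℝ) : ℂ) by push_cast; rfl, Complex.normSq_ofReal]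
            norm_num)
          rw [hd, sub_self, mul_zero, zero_add,
            show (4 / 5 : ℂ) = ((4 / 5 : ℝ) : ℂ) by push_cast; rfl, Complex.re_ofReal_mul] at this
          rw [one_mul]
          linarith
        · have hc : (4 / 5 * Complex.I : ℂ) = ((4 / 5 : ℝ) : ℂ) * Complex.I := by push_cast; rfl
          have := hblock p q hpq hlpq (3 / 5) (4 / 5 * Complex.I) (by
            rw [hc, Complex.normSq_mul, Complex.normSq_ofReal, Complex.normSq_I]
            norm_num)
          rw [hd, sub_self, mul_zero, zero_add, hc, mul_assoc ((4 / 5 : ℝ) : ℂ), Complex.re_ofReal_mul] at this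
          linarith
      · rcases hsep _ _ hlpq with ⟨i', h3, h4⟩ | ⟨j', h3, h4⟩
        · obtain ⟨p', rfl⟩ := lexIndex.surjective i'
          exact hoff_swap p p' q h3 hlpq h4
        · obtain ⟨q', rfl⟩ := lexIndex.surjective j'
          rw [hherm, hoff_swap q q' p h3 (Ne.symm hlpq) (Ne.symm h4), star_zero]
  · obtain ⟨p, rfl⟩ := lexIndex.surjective i
    obtain ⟨q, rfl⟩ := lexIndex.surjective j
    exact hdiag p q hij

/-! ### Real symmetric 3 × 3 matrices -/

theorem symm3_det (p q r u v w : ℝ) : (!![p, u, v; u, q, w; v, w, r] : Matrix _ _ ℝ).det =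
    p * (q * r - w ^ 2) + 2 * u * v * w - q * v ^ 2 - r * u ^ 2 := by
  rw [Matrix.det_fin_three]
  simp
  ring

theorem symm3_isHermitian (p q r u v w : ℝ) :
    (!![p, u, v; u, q, w; v, w, r] : Matrix _ _ ℝ).IsHermitian := by
  ext i j
  fin_cases i <;> fin_cases j <;> simp [Matrix.conjTranspose_apply]

theorem symm3_form (p q r u v w : ℝ) (x : Fin 3 → ℝ) :
    star x ⬝ᵥ (!![p, u, v; u, q, w; v, w, r] *ᵥ x) = p * x 0 ^ 2 + q * x 1 ^ 2 + r * x 2 ^ 2 +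
      2 * u * x 0 * x 1 + 2 * v * x 0 * x 2 + 2 * w * x 1 * x 2 := by
  simp [dotProduct, Matrix.mulVec, Fin.sum_univ_three]
  ring

/-- Completing squares from the last coordinate: with m = qr − w², the form times rm equals
r·det·x₀² + m(vx₀ + wx₁ + rx₂)² + (mx₁ + (ur − vw)x₀)². -/
theorem symm3_posSemidef {p q r u v w : ℝ} (hr : 0 < r) (hm : w ^ 2 < q * r)
    (hdet : 0 ≤ (!![p, u, v; u, q, w; v, w, r] : Matrix _ _ ℝ).det) :
    (!![p, u, v; u, q, w; v, w, r] : Matrix _ _ ℝ).PosSemidef := by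
  refine Matrix.PosSemidef.of_dotProduct_mulVec_nonneg (symm3_isHermitian ..) fun x => ?_
  rw [symm3_det] at hdet
  rw [symm3_form]
  have h1 : 0 < r * (q * r - w ^ 2) := mul_pos hr (by linarith)
  have h2 := mul_nonneg (mul_nonneg hr.le hdet) (sq_nonneg (x 0))
  have h3 := mul_nonneg (sub_pos.2 hm).le (sq_nonneg (v * x 0 + w * x 1 + r * x 2))
  have h4 := sq_nonneg ((q * r - w ^ 2) * x 1 + (u * r - v * w) * x 0)
  refine nonneg_of_mul_nonneg_right ?_ h1
  linarith

/-- The vector (0, r, −w) gives qr ≥ w². In case of equality r·det = −(ur − vw)² ≤ 0, against det >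
0. The strict inequalities obtained are open conditions. -/
theorem symm3_minor_pos {p q r u v w : ℝ} (hr : 0 < r)
    (h : (!![p, u, v; u, q, w; v, w, r] : Matrix _ _ ℝ).PosSemidef)
    (hdet : (!![p, u, v; u, q, w; v, w, r] : Matrix _ _ ℝ).det ≠ 0) :
    w ^ 2 < q * r ∧ 0 < (!![p, u, v; u, q, w; v, w, r] : Matrix _ _ ℝ).det := by
  have hd := lt_of_le_of_ne h.det_nonneg hdet.symm
  refine ⟨?_, hd⟩
  rw [symm3_det] at hd
  have h1 := h.dotProduct_mulVec_nonneg ![0, r, -w]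
  rw [symm3_form] at h1
  simp at h1
  have h2 : 0 ≤ r * (q * r - w ^ 2) := by linarith
  have h3 := nonneg_of_mul_nonneg_right h2 hr
  rcases h3.lt_or_eq with h4 | h4
  · linarith
  · exfalso
    have h5 := mul_pos hr hd
    rw [← h4] at h5
    nlinarith [sq_nonneg (v * w - u * r)]

/-- A singular positive semidefinite matrix with nonpositive off-diagonal entries has a positive
kernel vector. -/
theorem symm3_exists_pos_kernel {p q r u v w : ℝ} (hq : 0 < q) (hr : 0 < r)
    (hu : u < 0) (hv : v < 0) (hw : w ≤ 0)
    (h : (!![p, u, v; u, q, w; v, w, r] : Matrix _ _ ℝ).PosSemidef)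
    (hdet : (!![p, u, v; u, q, w; v, w, r] : Matrix _ _ ℝ).det = 0) :
    ∃ s : Fin 3 → ℝ, (∀ i, 0 < s i) ∧ !![p, u, v; u, q, w; v, w, r] *ᵥ s = 0 := by
  obtain ⟨x, hx, hx0⟩ := Matrix.exists_mulVec_eq_zero_iff.2 hdet
  -- Perron–Frobenius argument: as the off-diagonal entries are nonpositive, replacing x by |x| does
  -- not increase the form, so |x| is again in the kernel.
  have hs : !![p, u, v; u, q, w; v, w, r] *ᵥ (fun i => |x i|) = 0 := by
    rw [← h.dotProduct_mulVec_zero_iff]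
    refine le_antisymm ?_ (h.dotProduct_mulVec_nonneg _)
    have h1 : star x ⬝ᵥ (!![p, u, v; u, q, w; v, w, r] *ᵥ x) = 0 := by rw [hx0, dotProduct_zero]
    rw [symm3_form] at h1 ⊢
    simp only [sq_abs]
    have e1 := le_abs_self (x 0 * x 1)
    have e2 := le_abs_self (x 0 * x 2)
    have e3 := le_abs_self (x 1 * x 2)
    rw [abs_mul] at e1 e2 e3
    nlinarith
  refine ⟨_, ?_, hs⟩
  have r0 := congrFun hs 0
  have r1 := congrFun hs 1
  have r2 := congrFun hs 2
  simp [Matrix.mulVec, dotProduct, Fin.sum_univ_three] at r0 r1 r2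
  have a0 := abs_nonneg (x 0)
  have a1 := abs_nonneg (x 1)
  have a2 := abs_nonneg (x 2)
  -- Only u and v are strictly negative, so coordinate 0 comes first: if it vanished, row 0 would
  -- kill the others. Rows 1 and 2 then give the other two.
  have h0 : 0 < |x 0| := by
    refine lt_of_le_of_ne a0 fun h0 => hx ?_
    rw [← h0] at r0
    have b1 : |x 1| = 0 := by nlinarith
    have b2 : |x 2| = 0 := by nlinarith
    ext i
    fin_cases i
    · exact abs_eq_zero.1 h0.symm
    · exact abs_eq_zero.1 b1
    · exact abs_eq_zero.1 b2
  intro i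
  fin_cases i
  · exact h0
  · show 0 < |x 1|
    nlinarith [mul_neg_of_neg_of_pos hu h0, mul_nonneg (neg_nonneg.2 hw) a2]
  · show 0 < |x 2|
    nlinarith [mul_neg_of_neg_of_pos hv h0, mul_nonneg (neg_nonneg.2 hw) a1]

/-! ### The kernel equation L(d)s = 0 restricted to the spectra of ν -/

/-- `matL1 · *ᵥ s` as a linear map. -/
def matL1Apply (s : Fin 3 → ℝ) : (Fin 9 → ℝ) →ₗ[ℝ] (Fin 3 → ℝ) where
  toFun d := matL1 d *ᵥ s
  map_add' d e := by
    ext i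
    fin_cases i <;> simp [matL1, Matrix.mulVec, dotProduct, Fin.sum_univ_three] <;> ring
  map_smul' t d := by
    ext i
    fin_cases i <;> simp [matL1, Matrix.mulVec, dotProduct, Fin.sum_univ_three] <;> ring

/-- `matL2 · *ᵥ s` as a linear map. -/
def matL2Apply (s : Fin 3 → ℝ) : (Fin 9 → ℝ) →ₗ[ℝ] (Fin 3 → ℝ) where
  toFun d := matL2 d *ᵥ s
  map_add' d e := by
    ext i
    fin_cases i <;> simp [matL2, Matrix.mulVec, dotProduct, Fin.sum_univ_three] <;> ring
  map_smul' t d := by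
    ext i
    fin_cases i <;> simp [matL2, Matrix.mulVec, dotProduct, Fin.sum_univ_three] <;> ring

theorem matL1Apply_eq (s : Fin 3 → ℝ) (d : Fin 9 → ℝ) : matL1Apply s d =
    ![2 * d 8 * s 0 + (d 7 - d 0) * s 1 + (d 5 - d 1) * s 2,
      (d 7 - d 0) * s 0 + 2 * d 6 * s 1 + (d 4 - d 2) * s 2,
      (d 5 - d 1) * s 0 + (d 4 - d 2) * s 1 + 2 * d 3 * s 2] := by
  ext i
  fin_cases i <;> simp [matL1Apply, matL1, dotProduct, Fin.sum_univ_three]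

theorem matL2Apply_eq (s : Fin 3 → ℝ) (d : Fin 9 → ℝ) : matL2Apply s d =
    ![2 * d 8 * s 0 + (d 7 - d 0) * s 1 + (d 6 - d 1) * s 2,
      (d 7 - d 0) * s 0 + 2 * d 5 * s 1 + (d 4 - d 2) * s 2,
      (d 6 - d 1) * s 0 + (d 4 - d 2) * s 1 + 2 * d 3 * s 2] := by
  ext i
  fin_cases i <;> simp [matL2Apply, matL2, dotProduct, Fin.sum_univ_three]

/-- The nine images are told apart by their supports and signs once s > 0. This is the injectivity
needed in `eq_diagOp_of_mem_openSegment`. -/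
theorem matL1Apply_single_ne {s : Fin 3 → ℝ} (hs : ∀ i, 0 < s i) (i j : Fin 9) (hij : i ≠ j) :
    matL1Apply s (Pi.single i 1) ≠ matL1Apply s (Pi.single j 1) := by
  intro h
  have s0 := hs 0
  have s1 := hs 1
  have s2 := hs 2
  simp only [matL1Apply_eq] at h
  have h0 := congrFun h 0
  have h1 := congrFun h 1
  have h2 := congrFun h 2
  fin_cases i <;> fin_cases j <;> first
    | exact absurd rfl hij
    | (simp at h0 h1 h2; linarith)

theorem matL2Apply_single_ne {s : Fin 3 → ℝ} (hs : ∀ i, 0 < s i) (i j : Fin 9) (hij : i ≠ j) :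
    matL2Apply s (Pi.single i 1) ≠ matL2Apply s (Pi.single j 1) := by
  intro h
  have s0 := hs 0
  have s1 := hs 1
  have s2 := hs 2
  simp only [matL2Apply_eq] at h
  have h0 := congrFun h 0
  have h1 := congrFun h 1
  have h2 := congrFun h 2
  fin_cases i <;> fin_cases j <;> first
    | exact absurd rfl hij
    | (simp at h0 h1 h2; linarith)

theorem nuSpec_of_lt_two (k : ℕ) (a b c : ℝ) {i : Fin 9} (h : (i : ℕ) < 2) :
    nuSpec k a b c i = a := if_pos h

theorem nuSpec_of_mid {k : ℕ} (a b c : ℝ) {i : Fin 9} (h : ¬ (i : ℕ) < 2) (h' : (i : ℕ) < 2 + k) :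
    nuSpec k a b c i = b := by rw [nuSpec, if_neg h, if_pos h']

theorem nuSpec_of_ge {k : ℕ} (a b c : ℝ) {i : Fin 9} (h' : ¬ (i : ℕ) < 2 + k) :
    nuSpec k a b c i = c := by rw [nuSpec, if_neg (by omega), if_neg h']

theorem nuSpec_antitone {k : ℕ} {a b c : ℝ} (hab : b ≤ a) (hbc : c ≤ b) :
    Antitone (nuSpec k a b c) := by
  intro i j hij
  have : (i : ℕ) ≤ j := hij
  simp only [nuSpec]
  split_ifs <;> linarith

theorem sum_nuSpec {k : ℕ} (hk : k ≤ 7) (a b c : ℝ) :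
    ∑ i, nuSpec k a b c i = 2 * a + k * b + (7 - k) * c := by
  interval_cases k <;> simp [nuSpec, Fin.sum_univ_succ] <;> ring

theorem nuSpec_add (k : ℕ) (a b c a' b' c' : ℝ) :
    nuSpec k a b c + nuSpec k a' b' c' = nuSpec k (a + a') (b + b') (c + c') := by
  ext i
  simp only [nuSpec, Pi.add_apply]
  split_ifs <;> rfl

theorem smul_nuSpec (k : ℕ) (t a b c : ℝ) :
    t • nuSpec k a b c = nuSpec k (t * a) (t * b) (t * c) := by
  ext i
  simp only [nuSpec, Pi.smul_apply, smul_eq_mul]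
  split_ifs <;> rfl

theorem eq_nuSpec {k : ℕ} (hk1 : 1 ≤ k) (hk6 : k ≤ 6) {a b c : ℝ} {d : Fin 9 → ℝ}
    (h : ∀ i j, nuSpec k a b c i = nuSpec k a b c j → d i = d j) :
    d = nuSpec k (d 0) (d 2) (d 8) := by
  have e8 : ¬ ((8 : Fin 9) : ℕ) < 2 + k := by
    have : ((8 : Fin 9) : ℕ) = 8 := rfl
    omega
  have e2 : ((2 : Fin 9) : ℕ) < 2 + k := by
    have : ((2 : Fin 9) : ℕ) = 2 := rfl
    omega
  ext i
  by_cases h1 : (i : ℕ) < 2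
  · rw [nuSpec_of_lt_two _ _ _ _ h1]
    exact h _ _ (by rw [nuSpec_of_lt_two _ _ _ _ h1, nuSpec_of_lt_two _ _ _ _ (by decide)])
  · by_cases h2 : (i : ℕ) < 2 + k
    · rw [nuSpec_of_mid _ _ _ h1 h2]
      exact h _ _ (by rw [nuSpec_of_mid _ _ _ h1 h2, nuSpec_of_mid _ _ _ (by decide) e2])
    · rw [nuSpec_of_ge _ _ _ h2]
      exact h _ _ (by rw [nuSpec_of_ge _ _ _ h2, nuSpec_of_ge _ _ _ e8])

/-- On the three-parameter family the equation L₁(d)s = 0 has at most a line of solutions, since no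
nonzero solution has last parameter 0. -/
theorem matL1Apply_nuSpec_injective {k : ℕ} (hk1 : 1 ≤ k) (hk6 : k ≤ 6) {s : Fin 3 → ℝ}
    (hs : ∀ i, 0 < s i) {x y : ℝ} (h : matL1Apply s (nuSpec k x y 0) = 0) : x = 0 ∧ y = 0 := by
  have s0 := hs 0
  have s1 := hs 1
  have s2 := hs 2
  rw [matL1Apply_eq] at h
  have h0 : _ = (0 : ℝ) := congrFun h 0
  have h1 : _ = (0 : ℝ) := congrFun h 1
  have h2 : _ = (0 : ℝ) := congrFun h 2
  have cancel : ∀ {z t : ℝ}, 0 < t → z * t = 0 → z = 0 := fun ht hzt =>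
    (mul_eq_zero.1 hzt).resolve_right ht.ne'
  interval_cases k <;>
    simp only [nuSpec, Fin.isValue, Fin.coe_ofNat_eq_mod, Nat.reduceMod, Nat.reduceAdd,
      Nat.reduceLT, if_true, if_false, Matrix.cons_val] at h0 h1 h2
  · have hx : x = 0 := cancel (add_pos s1 s2) (by linarith)
    rw [hx] at h1 ⊢
    exact ⟨rfl, cancel s2 (by linarith)⟩
  · have hx : x = 0 := cancel (add_pos s1 s2) (by linarith)
    rw [hx] at h1 ⊢
    exact ⟨rfl, cancel s2 (by linarith)⟩
  · have hx : x = 0 := cancel (add_pos s1 s2) (by linarith)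
    rw [hx] at h2 ⊢
    exact ⟨rfl, cancel s2 (by linarith)⟩
  · have hx : x = 0 := cancel s0 (by linarith)
    rw [hx] at h0 ⊢
    exact ⟨rfl, cancel s2 (by linarith)⟩
  -- For k = 5 and y ≠ 0, eliminating x leaves s₀ = 2(s₁ − s₂) and s₀s₂ = 2s₁(s₁ + s₂), that is s₁²
  -- + s₂² = 0.
  · by_cases hy : y = 0
    · rw [hy] at h1 ⊢
      exact ⟨cancel s0 (by linarith), rfl⟩
    · exfalso
      have e1 : s 0 + 2 * s 2 - 2 * s 1 = 0 :=
        (mul_eq_zero.1 (show y * (s 0 + 2 * s 2 - 2 * s 1) = 0 by linarith)).resolve_left hy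
      have e2 : s 2 * s 0 - 2 * s 1 * (s 1 + s 2) = 0 :=
        (mul_eq_zero.1 (show y * (s 2 * s 0 - 2 * s 1 * (s 1 + s 2)) = 0 by
          linear_combination s 0 * h0 - (s 1 + s 2) * h1)).resolve_left hy
      have e3 : s 0 = 2 * s 1 - 2 * s 2 := by linarith
      rw [e3] at e2
      nlinarith
  · have hx : y - x = 0 := cancel (add_pos s1 s2) (by linarith)
    rw [hx] at h1
    have hy : y = 0 := cancel s1 (by linarith)
    exact ⟨by linarith, hy⟩

theorem matL2Apply_nuSpec_injective {k : ℕ} (hk1 : 1 ≤ k) (hk6 : k ≤ 6) {s : Fin 3 → ℝ}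
    (hs : ∀ i, 0 < s i) {x y : ℝ} (h : matL2Apply s (nuSpec k x y 0) = 0) : x = 0 ∧ y = 0 := by
  have s0 := hs 0
  have s1 := hs 1
  have s2 := hs 2
  rw [matL2Apply_eq] at h
  have h0 : _ = (0 : ℝ) := congrFun h 0
  have h1 : _ = (0 : ℝ) := congrFun h 1
  have h2 : _ = (0 : ℝ) := congrFun h 2
  have cancel : ∀ {z t : ℝ}, 0 < t → z * t = 0 → z = 0 := fun ht hzt =>
    (mul_eq_zero.1 hzt).resolve_right ht.ne'
  interval_cases k <;>
    simp only [nuSpec, Fin.isValue, Fin.coe_ofNat_eq_mod, Nat.reduceMod, Nat.reduceAdd,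
      Nat.reduceLT, if_true, if_false, Matrix.cons_val] at h0 h1 h2
  · have hx : x = 0 := cancel (add_pos s1 s2) (by linarith)
    rw [hx] at h1 ⊢
    exact ⟨rfl, cancel s2 (by linarith)⟩
  · have hx : x = 0 := cancel (add_pos s1 s2) (by linarith)
    rw [hx] at h1 ⊢
    exact ⟨rfl, cancel s2 (by linarith)⟩
  · have hx : x = 0 := cancel (add_pos s1 s2) (by linarith)
    rw [hx] at h2 ⊢
    exact ⟨rfl, cancel s2 (by linarith)⟩
  · have hx : x = 0 := cancel (add_pos s1 s2) (by linarith)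
    rw [hx] at h2 ⊢
    exact ⟨rfl, cancel s2 (by linarith)⟩
  · by_cases hy : y = 0
    · rw [hy] at h1 ⊢
      exact ⟨cancel s0 (by linarith), rfl⟩
    · exfalso
      have e1 : s 0 + 2 * s 2 - 2 * s 1 = 0 :=
        (mul_eq_zero.1 (show y * (s 0 + 2 * s 2 - 2 * s 1) = 0 by linarith)).resolve_left hy
      have e2 : s 2 * s 0 - 2 * s 1 * (s 1 + s 2) = 0 :=
        (mul_eq_zero.1 (show y * (s 2 * s 0 - 2 * s 1 * (s 1 + s 2)) = 0 by
          linear_combination s 0 * h0 - (s 1 + s 2) * h1)).resolve_left hy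
      have e3 : s 0 = 2 * s 1 - 2 * s 2 := by linarith
      rw [e3] at e2
      nlinarith
  · have hx : y - x = 0 := cancel (add_pos s1 s2) (by linarith)
    rw [hx] at h1
    have hy : y = 0 := cancel s1 (by linarith)
    exact ⟨by linarith, hy⟩

/-- Within block-preserving relabelings, coefficients at different eigenvalues can be separated. -/
theorem nuSpec_separated {k : ℕ} (hk1 : 1 ≤ k) (a b c : ℝ) {μ : Fin 9 → ℝ}
    (hneg : ∀ i : Fin 9, (i : ℕ) < 3 → μ i < 0) (hpos : ∀ i : Fin 9, 3 ≤ (i : ℕ) → 0 < μ i)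
    (h1 : k = 1 → μ 0 ≠ μ 2 ∨ μ 1 ≠ μ 2) (i j : Fin 9)
    (hij : nuSpec k a b c i ≠ nuSpec k a b c j) :
    (∃ i', nuSpec k a b c i' = nuSpec k a b c i ∧ μ i' ≠ μ j) ∨
      (∃ j', nuSpec k a b c j' = nuSpec k a b c j ∧ μ i ≠ μ j') := by
  have key : ∀ i j : Fin 9, (i : ℕ) < j → nuSpec k a b c i ≠ nuSpec k a b c j →
      (∃ i', nuSpec k a b c i' = nuSpec k a b c i ∧ μ i' ≠ μ j) ∨
      (∃ j', nuSpec k a b c j' = nuSpec k a b c j ∧ μ i ≠ μ j') := by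
    clear hij i j
    intro i j hlt hij
    have e2 : ((2 : Fin 9) : ℕ) = 2 := rfl
    have e3 : ((3 : Fin 9) : ℕ) = 3 := rfl
    -- Coefficients are negative exactly at positions 0, 1, 2, and the middle block starts at 2. It
    -- thus contains a negative coefficient, and also a positive one unless k = 1, the case left to
    -- `h1`.
    by_cases hj : 3 ≤ (j : ℕ)
    · left
      by_cases hi : (i : ℕ) < 3
      · exact ⟨i, rfl, ((hneg i hi).trans (hpos j hj)).ne⟩
      · refine ⟨2, ?_, ((hneg 2 (by decide)).trans (hpos j hj)).ne⟩
        have hi2 : (i : ℕ) < 2 + k := by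
          by_contra hc
          exact hij (by rw [nuSpec_of_ge _ _ _ hc, nuSpec_of_ge _ _ _ (by omega)])
        rw [nuSpec_of_mid _ _ _ (by decide) (by omega), nuSpec_of_mid _ _ _ (by omega) hi2]
    · have hi : (i : ℕ) < 2 := by omega
      have hj2 : ¬ (j : ℕ) < 2 := fun hc => hij (by
        rw [nuSpec_of_lt_two _ _ _ _ hi, nuSpec_of_lt_two _ _ _ _ hc])
      by_cases hk : k = 1
      · left
        have hj' : j = 2 := Fin.ext (by omega)
        rw [hj', nuSpec_of_lt_two _ _ _ _ hi]
        rcases h1 hk with h | h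
        · exact ⟨0, nuSpec_of_lt_two _ _ _ _ (by decide), h⟩
        · exact ⟨1, nuSpec_of_lt_two _ _ _ _ (by decide), h⟩
      · right
        refine ⟨3, ?_, ((hneg i (by omega)).trans (hpos 3 (by decide))).ne⟩
        rw [nuSpec_of_mid _ _ _ (by decide) (by omega), nuSpec_of_mid _ _ _ hj2 (by omega)]
  have hne : (i : ℕ) ≠ j := fun h => hij (by rw [Fin.ext h])
  rcases lt_or_gt_of_ne hne with h | h
  · exact key i j h hij
  · rcases key j i h hij.symm with ⟨x, hx, hx'⟩ | ⟨x, hx, hx'⟩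
    · exact Or.inr ⟨x, hx, hx'.symm⟩
    · exact Or.inl ⟨x, hx, hx'.symm⟩

theorem mu1_neg {s : Fin 3 → ℝ} (hs : ∀ i, 0 < s i) (i : Fin 9) (hi : (i : ℕ) < 3) :
    mu1 s i < 0 := by
  have h01 := mul_pos (hs 0) (hs 1)
  have h02 := mul_pos (hs 0) (hs 2)
  have h12 := mul_pos (hs 1) (hs 2)
  fin_cases i <;> simp [mu1] at hi ⊢ <;> assumption

theorem mu1_pos {s : Fin 3 → ℝ} (hs : ∀ i, 0 < s i) (i : Fin 9) (hi : 3 ≤ (i : ℕ)) :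
    0 < mu1 s i := by
  have s0 := hs 0
  have s1 := hs 1
  have s2 := hs 2
  fin_cases i <;> simp [mu1] at hi ⊢ <;> positivity

theorem mu2_neg {s : Fin 3 → ℝ} (hs : ∀ i, 0 < s i) (i : Fin 9) (hi : (i : ℕ) < 3) :
    mu2 s i < 0 := by
  have h01 := mul_pos (hs 0) (hs 1)
  have h02 := mul_pos (hs 0) (hs 2)
  have h12 := mul_pos (hs 1) (hs 2)
  fin_cases i <;> simp [mu2] at hi ⊢ <;> assumption

theorem mu2_pos {s : Fin 3 → ℝ} (hs : ∀ i, 0 < s i) (i : Fin 9) (hi : 3 ≤ (i : ℕ)) :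
    0 < mu2 s i := by
  have s0 := hs 0
  have s1 := hs 1
  have s2 := hs 2
  fin_cases i <;> simp [mu2] at hi ⊢ <;> positivity

theorem sum_realDiag {ρ : TwoQutrit} (hρ : ρ ∈ absPPT) : ∑ i, realDiag ρ i = 1 := by
  have h := congrArg Complex.re hρ.1.2
  rw [Matrix.trace, Complex.re_sum, Complex.one_re] at h
  rw [← h, ← lexIndex.sum_comp]
  exact Finset.sum_congr rfl fun p _ => by simp [realDiag]

/-! ### The extremality criterion -/

/-- A diagonal state `ν` in `absPPT` annihilated by a supporting functional is extreme. -/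
theorem nu_mem_extremePoints_of_kernel {k : ℕ} (hk1 : 1 ≤ k) (hk6 : k ≤ 6) {a b c : ℝ}
    (hc : c ≠ 0) {μ : Fin 9 → ℝ} (K : (Fin 9 → ℝ) →ₗ[ℝ] (Fin 3 → ℝ)) (hmem : nu k a b c ∈ absPPT)
    (hpos : ∀ ρ ∈ absPPT, 0 ≤ ∑ i, μ i * realDiag ρ i)
    (hK : ∀ ρ ∈ absPPT, ∑ i, μ i * realDiag ρ i = 0 → K (realDiag ρ) = 0)
    (hinj : ∀ i j : Fin 9, i ≠ j → K (Pi.single i 1) ≠ K (Pi.single j 1))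
    (hl : ∑ i, μ i * nuSpec k a b c i = 0) (hKl : K (nuSpec k a b c) = 0)
    (hsep : ∀ i j, nuSpec k a b c i ≠ nuSpec k a b c j →
      (∃ i', nuSpec k a b c i' = nuSpec k a b c i ∧ μ i' ≠ μ j) ∨
        (∃ j', nuSpec k a b c j' = nuSpec k a b c j ∧ μ i ≠ μ j'))
    (hnu : ∀ x y, K (nuSpec k x y 0) = 0 → x = 0 ∧ y = 0) :
    nu k a b c ∈ extremePoints ℝ absPPT := by
  refine ⟨hmem, fun ρ₁ h₁ ρ₂ h₂ hseg => ?_⟩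
  obtain ⟨e1, e2, e3⟩ := eq_diagOp_of_mem_openSegment K hpos hK hinj hl hsep h₁ h₂ hseg
  have e4 := eq_nuSpec hk1 hk6 e2
  set α := realDiag ρ₁ 0
  set β := realDiag ρ₁ 2
  set γ := realDiag ρ₁ 8
  -- Subtracting γ/c times ν removes the last parameter; the trace condition later forces γ/c = 1.
  have e5 : K (nuSpec k (α + -(γ / c) * a) (β + -(γ / c) * b) 0) = 0 := by
    have h0 : γ + -(γ / c) * c = 0 := by field_simp; ring
    rw [← h0, ← nuSpec_add, ← smul_nuSpec, map_add, map_smul, hKl, ← e4, e3]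
    simp
  obtain ⟨e6, e7⟩ := hnu _ _ e5
  have e8 : realDiag ρ₁ = (γ / c) • nuSpec k a b c := by
    rw [e4, smul_nuSpec]
    congr 1
    · linarith
    · linarith
    · field_simp
  have e9 := sum_realDiag h₁
  have e10 := sum_realDiag hmem
  rw [nu, realDiag_diagOp] at e10
  rw [e8] at e9
  simp only [Pi.smul_apply, smul_eq_mul, ← Finset.mul_sum, e10, mul_one] at e9
  rw [e1, e8, e9, one_smul]
  rfl

/-- These are the sign conditions on the entries of both matrices required by
`symm3_exists_pos_kernel`. -/
theorem nuSpec_bounds {k : ℕ} (hk1 : 1 ≤ k) (hk6 : k ≤ 6) {a b c : ℝ} (hab : b < a) (hbc : c < b)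
    (hc : 0 < c) : 0 < nuSpec k a b c 3 ∧ 0 < nuSpec k a b c 5 ∧ 0 < nuSpec k a b c 6 ∧
      nuSpec k a b c 8 = c ∧ nuSpec k a b c 7 < nuSpec k a b c 0 ∧
      nuSpec k a b c 5 < nuSpec k a b c 1 ∧ nuSpec k a b c 6 < nuSpec k a b c 1 ∧
      nuSpec k a b c 4 ≤ nuSpec k a b c 2 := by
  have hb := hc.trans hbc
  have ha := hb.trans hab
  have hca := hbc.trans hab
  refine ⟨?_, ?_, ?_, ?_, ?_, ?_, ?_, nuSpec_antitone hab.le hbc.le (by decide)⟩ <;>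
    interval_cases k <;> simp [nuSpec] <;> assumption

theorem sum_mu_eq_zero_of_apply {s : Fin 3 → ℝ} {d : Fin 9 → ℝ} (h : matL1Apply s d = 0) :
    ∑ i, mu1 s i * d i = 0 := by
  have h1 := dotProduct_matL1 s d
  rw [show matL1 d *ᵥ s = 0 from h, dotProduct_zero] at h1
  linarith

theorem sum_mu2_eq_zero_of_apply {s : Fin 3 → ℝ} {d : Fin 9 → ℝ} (h : matL2Apply s d = 0) :
    ∑ i, mu2 s i * d i = 0 := by
  have h1 := dotProduct_matL2 s d
  rw [show matL2 d *ᵥ s = 0 from h, dotProduct_zero] at h1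
  linarith

theorem matL1Apply_eq_zero {ρ : TwoQutrit} (hρ : ρ ∈ absPPT) {s : Fin 3 → ℝ}
    (h : ∑ i, mu1 s i * realDiag ρ i = 0) : matL1Apply s (realDiag ρ) = 0 := by
  refine ((matL1_posSemidef_of_absPPT hρ).dotProduct_mulVec_zero_iff s).1 ?_
  rw [star_trivial, dotProduct_matL1, h, mul_zero]

theorem matL2Apply_eq_zero {ρ : TwoQutrit} (hρ : ρ ∈ absPPT) {s : Fin 3 → ℝ}
    (h : ∑ i, mu2 s i * realDiag ρ i = 0) : matL2Apply s (realDiag ρ) = 0 := by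
  refine ((matL2_posSemidef_of_absPPT hρ).dotProduct_mulVec_zero_iff s).1 ?_
  rw [star_trivial, dotProduct_matL2, h, mul_zero]

/-- A constant kernel vector would give a = 2c and a + b = 4c, hence a = b. This settles the case k
= 1 of `nuSpec_separated`. -/
theorem not_const_kernel {s : Fin 3 → ℝ} (hs : ∀ i, 0 < s i) {a b c : ℝ} (hab : b < a)
    (h0 : 2 * c * s 0 + (c - a) * s 1 + (c - a) * s 2 = 0)
    (h1 : (c - a) * s 0 + 2 * c * s 1 + (c - b) * s 2 = 0) : s 0 ≠ s 2 ∨ s 0 ≠ s 1 := by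
  by_contra! h
  have s0 := hs 0
  rw [← h.1, ← h.2] at h0 h1
  have e0 : (4 * c - 2 * a) = 0 := (mul_eq_zero.1 (show (4 * c - 2 * a) * s 0 = 0 by
    linarith)).resolve_right s0.ne'
  have e1 : (4 * c - a - b) = 0 := (mul_eq_zero.1 (show (4 * c - a - b) * s 0 = 0 by
    linarith)).resolve_right s0.ne'
  linarith

theorem nu_mem_absPPT {k : ℕ} (hk6 : k ≤ 6) {a b c : ℝ} (hab : b ≤ a) (hbc : c ≤ b) (hc : 0 ≤ c)
    (hsum : 2 * a + k * b + (7 - k) * c = 1) (h1 : (matL1 (nuSpec k a b c)).PosSemidef)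
    (h2 : (matL2 (nuSpec k a b c)).PosSemidef) : nu k a b c ∈ absPPT := by
  refine diagOp_mem_absPPT (nuSpec_antitone hab hbc) (fun i => ?_) ?_ h1 h2
  · simp only [nuSpec]
    split_ifs <;> linarith
  · rw [sum_nuSpec (by omega), hsum]

/-- The positive kernel vector of the singular matrix defines the supporting functional and the map
K for `nu_mem_extremePoints_of_kernel`. -/
theorem nu_mem_extremePoints {k : ℕ} (hk1 : 1 ≤ k) (hk6 : k ≤ 6) {a b c : ℝ} (hab : b < a)
    (hbc : c < b) (hc : 0 < c) (hsum : 2 * a + k * b + (7 - k) * c = 1)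
    (h1 : (matL1 (nuSpec k a b c)).PosSemidef) (h2 : (matL2 (nuSpec k a b c)).PosSemidef)
    (hdet : (matL1 (nuSpec k a b c)).det = 0 ∨ (matL2 (nuSpec k a b c)).det = 0) :
    nu k a b c ∈ extremePoints ℝ absPPT := by
  have hmem := nu_mem_absPPT hk6 hab.le hbc.le hc.le hsum h1 h2
  obtain ⟨p3, p5, p6, p8, p7, p51, p61, p42⟩ := nuSpec_bounds hk1 hk6 hab hbc hc
  rcases hdet with hdet | hdet
  · obtain ⟨s, hs, hs0⟩ := symm3_exists_pos_kernel (by linarith) (by linarith) (by linarith)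
      (by linarith) (by linarith) h1 hdet
    have hs0' : matL1Apply s (nuSpec k a b c) = 0 := hs0
    refine nu_mem_extremePoints_of_kernel hk1 hk6 hc.ne' (matL1Apply s) hmem
      (fun ρ hρ => matL1_posSemidef_iff.1 (matL1_posSemidef_of_absPPT hρ) s)
      (fun ρ hρ => matL1Apply_eq_zero hρ) (matL1Apply_single_ne hs) (sum_mu_eq_zero_of_apply hs0')
      hs0' ?_ (fun x y => matL1Apply_nuSpec_injective hk1 hk6 hs)
    refine nuSpec_separated hk1 a b c (mu1_neg hs) (mu1_pos hs) fun hk => ?_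
    subst hk
    rw [matL1Apply_eq] at hs0'
    have h0 : _ = (0 : ℝ) := congrFun hs0' 0
    have h1 : _ = (0 : ℝ) := congrFun hs0' 1
    simp [nuSpec] at h0 h1
    refine (not_const_kernel hs hab h0 h1).imp (fun h h' => h ?_)
      (fun h h' => h ?_)
    · simp [mu1] at h'
      exact mul_right_cancel₀ (hs 1).ne' (h'.trans (mul_comm _ _))
    · simp [mu1] at h'
      exact h'.resolve_right (hs 2).ne'
  · obtain ⟨s, hs, hs0⟩ := symm3_exists_pos_kernel (by linarith) (by linarith) (by linarith)
      (by linarith) (by linarith) h2 hdet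
    have hs0' : matL2Apply s (nuSpec k a b c) = 0 := hs0
    refine nu_mem_extremePoints_of_kernel hk1 hk6 hc.ne' (matL2Apply s) hmem
      (fun ρ hρ => matL2_posSemidef_iff.1 (matL2_posSemidef_of_absPPT hρ) s)
      (fun ρ hρ => matL2Apply_eq_zero hρ) (matL2Apply_single_ne hs)
      (sum_mu2_eq_zero_of_apply hs0') hs0' ?_ (fun x y => matL2Apply_nuSpec_injective hk1 hk6 hs)
    refine nuSpec_separated hk1 a b c (mu2_neg hs) (mu2_pos hs) fun hk => ?_
    subst hk
    rw [matL2Apply_eq] at hs0'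
    have h0 : _ = (0 : ℝ) := congrFun hs0' 0
    have h1 : _ = (0 : ℝ) := congrFun hs0' 1
    simp [nuSpec] at h0 h1
    refine (not_const_kernel hs hab h0 h1).imp (fun h h' => h ?_)
      (fun h h' => h ?_)
    · simp [mu2] at h'
      exact mul_right_cancel₀ (hs 1).ne' (h'.trans (mul_comm _ _))
    · simp [mu2] at h'
      exact h'.resolve_right (hs 2).ne'

theorem continuous_det_matL1 : Continuous fun d : Fin 9 → ℝ => (matL1 d).det := by
  unfold matL1
  simp only [symm3_det]
  fun_prop

theorem continuous_det_matL2 : Continuous fun d : Fin 9 → ℝ => (matL2 d).det := by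
  unfold matL2
  simp only [symm3_det]
  fun_prop

theorem matL1_eventually_posSemidef {d : Fin 9 → ℝ} (h3 : 0 < d 3)
    (h : (matL1 d).PosSemidef) (hdet : (matL1 d).det ≠ 0) : ∀ᶠ e in 𝓝 d, (matL1 e).PosSemidef := by
  obtain ⟨hm, hd⟩ := symm3_minor_pos (by linarith) h hdet
  have e1 : ∀ᶠ e : Fin 9 → ℝ in 𝓝 d, 0 < e 3 :=
    continuousAt_const.eventually_lt (continuous_apply 3).continuousAt h3
  have e2 : ∀ᶠ e : Fin 9 → ℝ in 𝓝 d, (e 4 - e 2) ^ 2 < 2 * e 6 * (2 * e 3) :=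
    ContinuousAt.eventually_lt (by fun_prop) (by fun_prop) hm
  have e3 : ∀ᶠ e : Fin 9 → ℝ in 𝓝 d, 0 < (matL1 e).det :=
    continuousAt_const.eventually_lt continuous_det_matL1.continuousAt hd
  filter_upwards [e1, e2, e3] with e h1 h2 h3
  exact symm3_posSemidef (by linarith) h2 h3.le

theorem matL2_eventually_posSemidef {d : Fin 9 → ℝ} (h3 : 0 < d 3)
    (h : (matL2 d).PosSemidef) (hdet : (matL2 d).det ≠ 0) : ∀ᶠ e in 𝓝 d, (matL2 e).PosSemidef := by
  obtain ⟨hm, hd⟩ := symm3_minor_pos (by linarith) h hdet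
  have e1 : ∀ᶠ e : Fin 9 → ℝ in 𝓝 d, 0 < e 3 :=
    continuousAt_const.eventually_lt (continuous_apply 3).continuousAt h3
  have e2 : ∀ᶠ e : Fin 9 → ℝ in 𝓝 d, (e 4 - e 2) ^ 2 < 2 * e 5 * (2 * e 3) :=
    ContinuousAt.eventually_lt (by fun_prop) (by fun_prop) hm
  have e3 : ∀ᶠ e : Fin 9 → ℝ in 𝓝 d, 0 < (matL2 e).det :=
    continuousAt_const.eventually_lt continuous_det_matL2.continuousAt hd
  filter_upwards [e1, e2, e3] with e h1 h2 h3
  exact symm3_posSemidef (by linarith) h2 h3.le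

theorem continuous_nuSpec {X : Type*} [TopologicalSpace X] (k : ℕ) {a b c : X → ℝ}
    (ha : Continuous a) (hb : Continuous b) (hc : Continuous c) :
    Continuous fun x => nuSpec k (a x) (b x) (c x) := by
  refine continuous_pi fun i => ?_
  simp only [nuSpec]
  split_ifs <;> assumption

theorem diagOp_injective : Function.Injective diagOp := fun d e h => by
  rw [← realDiag_diagOp d, h, realDiag_diagOp]

/-- If both matrices are nonsingular, both inequalities persist nearby and ν is the midpoint of a
segment in `absPPT`. -/
theorem det_eq_zero_of_mem_extremePoints {k : ℕ} (hk1 : 1 ≤ k) (hk6 : k ≤ 6) {a b c : ℝ}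
    (hab : b < a) (hbc : c < b) (hc : 0 < c) (h : nu k a b c ∈ extremePoints ℝ absPPT) :
    (matL1 (nuSpec k a b c)).det = 0 ∨ (matL2 (nuSpec k a b c)).det = 0 := by
  by_contra! hdet
  obtain ⟨p3, -⟩ := nuSpec_bounds hk1 hk6 hab hbc hc
  have hsum := sum_realDiag h.1
  have h1 := matL1_posSemidef_of_absPPT h.1
  have h2 := matL2_posSemidef_of_absPPT h.1
  rw [nu, realDiag_diagOp] at hsum h1 h2
  rw [sum_nuSpec (by omega)] at hsum
  -- The slope −k/2 in a keeps the trace equal to one.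
  set F : ℝ → Fin 9 → ℝ := fun t => nuSpec k (a - k / 2 * t) (b + t) c with hF
  have hFc : Continuous F := continuous_nuSpec k (by fun_prop) (by fun_prop) (by fun_prop)
  have hF0 : F 0 = nuSpec k a b c := by simp [hF]
  have hmem : ∀ᶠ t in 𝓝 (0 : ℝ), nu k (a - k / 2 * t) (b + t) c ∈ absPPT := by
    have l1 := hFc.tendsto 0
    rw [hF0] at l1
    have e1 : ∀ᶠ t : ℝ in 𝓝 0, b + t < a - k / 2 * t :=
      ContinuousAt.eventually_lt (by fun_prop) (by fun_prop) (by simpa)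
    have e2 : ∀ᶠ t : ℝ in 𝓝 0, c < b + t :=
      ContinuousAt.eventually_lt (by fun_prop) (by fun_prop) (by simpa)
    filter_upwards [e1, e2, l1.eventually (matL1_eventually_posSemidef p3 h1 hdet.1),
      l1.eventually (matL2_eventually_posSemidef p3 h2 hdet.2)] with t h3 h4 h5 h6
    exact nu_mem_absPPT hk6 h3.le h4.le hc.le (by linarith) h5 h6
  have hneg : ∀ᶠ t in 𝓝 (0 : ℝ), nu k (a - k / 2 * (-t)) (b + -t) c ∈ absPPT := by
    have : Tendsto (fun t : ℝ => -t) (𝓝 0) (𝓝 0) := by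
      simpa using (continuous_neg (G := ℝ)).tendsto 0
    exact this.eventually hmem
  obtain ⟨ε, hε, hball⟩ := Metric.eventually_nhds_iff.1 (hmem.and hneg)
  obtain ⟨m1, m2⟩ := hball (y := ε / 2) (by
    rw [Real.dist_eq, sub_zero, abs_of_pos (by linarith)]
    linarith)
  have hseg : nu k a b c ∈ openSegment ℝ (nu k (a - k / 2 * (ε / 2)) (b + ε / 2) c)
      (nu k (a - k / 2 * (-(ε / 2))) (b + -(ε / 2)) c) := by
    refine ⟨1 / 2, 1 / 2, by norm_num, by norm_num, by norm_num, ?_⟩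
    ext p q
    simp only [nu, diagOp, Matrix.add_apply, Matrix.smul_apply, Matrix.diagonal_apply]
    split_ifs
    · simp only [nuSpec]
      split_ifs <;> simp <;> ring
    · simp
  have := congrFun (diagOp_injective (h.2 m1 m2 hseg)) 2
  have e2 : ((2 : Fin 9) : ℕ) < 2 + k := by
    have : ((2 : Fin 9) : ℕ) = 2 := rfl
    omega
  rw [nuSpec_of_mid _ _ _ (by decide) e2, nuSpec_of_mid _ _ _ (by decide) e2] at this
  linarith

/-- Extremality of `ν_{2,k,7-k}` in terms of the two linear matrix inequalities. -/
theorem isExtremeNu_iff {k : ℕ} (hk1 : 1 ≤ k) (hk6 : k ≤ 6) {a b c : ℝ} :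
    IsExtremeNu k a b c ↔ a > b ∧ b > c ∧ c > 0 ∧ 2 * a + k * b + (7 - k) * c = 1 ∧
      (matL1 (nuSpec k a b c)).PosSemidef ∧ (matL2 (nuSpec k a b c)).PosSemidef ∧
      ((matL1 (nuSpec k a b c)).det = 0 ∨ (matL2 (nuSpec k a b c)).det = 0) := by
  constructor
  · rintro ⟨hab, hbc, hc, h⟩
    have hsum := sum_realDiag h.1
    have h1 := matL1_posSemidef_of_absPPT h.1
    have h2 := matL2_posSemidef_of_absPPT h.1
    rw [nu, realDiag_diagOp] at hsum h1 h2
    rw [sum_nuSpec (by omega)] at hsum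
    exact ⟨hab, hbc, hc, hsum, h1, h2, det_eq_zero_of_mem_extremePoints hk1 hk6 hab hbc hc h⟩
  · rintro ⟨hab, hbc, hc, hsum, h1, h2, hdet⟩
    exact ⟨hab, hbc, hc, nu_mem_extremePoints hk1 hk6 hab hbc hc hsum h1 h2 hdet⟩

/-! ### The determinantal equation for each k -/

theorem matL1_nuSpec_one (a b c : ℝ) : matL1 (nuSpec 1 a b c) =
    !![2 * c, c - a, c - a; c - a, 2 * c, c - b; c - a, c - b, 2 * c] := by
  simp [matL1, nuSpec]

theorem matL2_nuSpec_one (a b c : ℝ) : matL2 (nuSpec 1 a b c) =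
    !![2 * c, c - a, c - a; c - a, 2 * c, c - b; c - a, c - b, 2 * c] := by
  simp [matL2, nuSpec]

theorem matL1_nuSpec_two (a b c : ℝ) : matL1 (nuSpec 2 a b c) =
    !![2 * c, c - a, c - a; c - a, 2 * c, c - b; c - a, c - b, 2 * b] := by
  simp [matL1, nuSpec]

theorem matL2_nuSpec_two (a b c : ℝ) : matL2 (nuSpec 2 a b c) =
    !![2 * c, c - a, c - a; c - a, 2 * c, c - b; c - a, c - b, 2 * b] := by
  simp [matL2, nuSpec]

theorem matL1_nuSpec_three (a b c : ℝ) : matL1 (nuSpec 3 a b c) =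
    !![2 * c, c - a, c - a; c - a, 2 * c, 0; c - a, 0, 2 * b] := by
  simp [matL1, nuSpec]

theorem matL2_nuSpec_three (a b c : ℝ) : matL2 (nuSpec 3 a b c) =
    !![2 * c, c - a, c - a; c - a, 2 * c, 0; c - a, 0, 2 * b] := by
  simp [matL2, nuSpec]

theorem matL1_nuSpec_four (a b c : ℝ) : matL1 (nuSpec 4 a b c) =
    !![2 * c, c - a, b - a; c - a, 2 * c, 0; b - a, 0, 2 * b] := by
  simp [matL1, nuSpec]

theorem matL2_nuSpec_four (a b c : ℝ) : matL2 (nuSpec 4 a b c) =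
    !![2 * c, c - a, c - a; c - a, 2 * b, 0; c - a, 0, 2 * b] := by
  simp [matL2, nuSpec]

theorem matL1_nuSpec_five (a b c : ℝ) : matL1 (nuSpec 5 a b c) =
    !![2 * c, c - a, b - a; c - a, 2 * b, 0; b - a, 0, 2 * b] := by
  simp [matL1, nuSpec]

theorem matL2_nuSpec_five (a b c : ℝ) : matL2 (nuSpec 5 a b c) =
    !![2 * c, c - a, b - a; c - a, 2 * b, 0; b - a, 0, 2 * b] := by
  simp [matL2, nuSpec]

theorem matL1_nuSpec_six (a b c : ℝ) : matL1 (nuSpec 6 a b c) =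
    !![2 * c, b - a, b - a; b - a, 2 * b, 0; b - a, 0, 2 * b] := by
  simp [matL1, nuSpec]

theorem matL2_nuSpec_six (a b c : ℝ) : matL2 (nuSpec 6 a b c) =
    !![2 * c, b - a, b - a; b - a, 2 * b, 0; b - a, 0, 2 * b] := by
  simp [matL2, nuSpec]

/-- L₁ and L₂ differ only in exchanging the entries 5 and 6 of the spectrum (counted from 0), so
they agree at ν unless k = 4. After removal of a positive factor, det = 0 itself makes the lower
right minor positive, so no semidefiniteness condition survives; k = 2, 3, 5, 6 go the same way. -/
theorem isExtremeNu_one_iff {a b c : ℝ} : IsExtremeNu 1 a b c ↔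
    a > b ∧ b > c ∧ c > 0 ∧ 2 * a + b + 6 * c = 1 ∧ (a - c) ^ 2 = c * (3 * c - b) := by
  rw [isExtremeNu_iff le_rfl (by norm_num), matL1_nuSpec_one, matL2_nuSpec_one, or_self]
  refine and_congr_right fun hab => and_congr_right fun hbc => and_congr_right fun hc =>
    and_congr (by norm_num) ⟨?_, fun h => ?_⟩
  · rintro ⟨-, -, h⟩
    rw [symm3_det] at h
    have h2 : (2 * (b + c)) * ((a - c) ^ 2 - c * (3 * c - b)) = 0 := by linear_combination -h
    linarith [(mul_eq_zero.1 h2).resolve_left (by linarith)]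
  · have hdet : (!![2 * c, c - a, c - a; c - a, 2 * c, c - b; c - a, c - b, 2 * c] :
        Matrix _ _ ℝ).det = 0 := by
      rw [symm3_det]
      linear_combination -(2 * (b + c)) * h
    have hb : 0 < 3 * c - b := pos_of_mul_pos_right
      (h ▸ pow_pos (show 0 < a - c by linarith) 2) hc.le
    have := symm3_posSemidef (by linarith) (by nlinarith) hdet.ge
    exact ⟨this, this, hdet⟩

theorem isExtremeNu_two_iff {a b c : ℝ} : IsExtremeNu 2 a b c ↔
    a > b ∧ b > c ∧ c > 0 ∧ 2 * a + 2 * b + 5 * c = 1 ∧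
      2 * b * (a - c) ^ 2 = c * (6 * b * c - b ^ 2 - c ^ 2) := by
  rw [isExtremeNu_iff (by norm_num) (by norm_num), matL1_nuSpec_two, matL2_nuSpec_two, or_self]
  refine and_congr_right fun hab => and_congr_right fun hbc => and_congr_right fun hc =>
    and_congr (by norm_num) ⟨?_, fun h => ?_⟩
  · rintro ⟨-, -, h⟩
    rw [symm3_det] at h
    linear_combination -h / 2
  · have hdet : (!![2 * c, c - a, c - a; c - a, 2 * c, c - b; c - a, c - b, 2 * b] :
        Matrix _ _ ℝ).det = 0 := by
      rw [symm3_det]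
      linear_combination -2 * h
    have hb : 0 < 6 * b * c - b ^ 2 - c ^ 2 := pos_of_mul_pos_right
      (h ▸ mul_pos (show 0 < 2 * b by linarith) (pow_pos (show 0 < a - c by linarith) 2)) hc.le
    have := symm3_posSemidef (by linarith) (by nlinarith) hdet.ge
    exact ⟨this, this, hdet⟩

theorem isExtremeNu_three_iff {a b c : ℝ} : IsExtremeNu 3 a b c ↔
    a > b ∧ b > c ∧ c > 0 ∧ 2 * a + 3 * b + 4 * c = 1 ∧
      (b + c) * (a - c) ^ 2 = 4 * b * c ^ 2 := by
  rw [isExtremeNu_iff (by norm_num) (by norm_num), matL1_nuSpec_three, matL2_nuSpec_three, or_self]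
  refine and_congr_right fun hab => and_congr_right fun hbc => and_congr_right fun hc =>
    and_congr (by norm_num) ⟨?_, fun h => ?_⟩
  · rintro ⟨-, -, h⟩
    rw [symm3_det] at h
    linear_combination -h / 2
  · have hdet : (!![2 * c, c - a, c - a; c - a, 2 * c, 0; c - a, 0, 2 * b] :
        Matrix _ _ ℝ).det = 0 := by
      rw [symm3_det]
      linear_combination -2 * h
    have := symm3_posSemidef (by linarith) (by nlinarith) hdet.ge
    exact ⟨this, this, hdet⟩

theorem det_matL1_nuSpec_four (a b c : ℝ) : (matL1 (nuSpec 4 a b c)).det =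
    2 * (4 * b * c ^ 2 - b * (a - c) ^ 2 - c * (a - b) ^ 2) := by
  rw [matL1_nuSpec_four, symm3_det]
  ring

theorem det_matL2_nuSpec_four (a b c : ℝ) : (matL2 (nuSpec 4 a b c)).det =
    4 * b * (2 * b * c - (a - c) ^ 2) := by
  rw [matL2_nuSpec_four, symm3_det]
  ring

theorem matL1_nuSpec_four_posSemidef_iff {a b c : ℝ} (hb : 0 < b) (hc : 0 < c) :
    (matL1 (nuSpec 4 a b c)).PosSemidef ↔
      b * (a - c) ^ 2 + c * (a - b) ^ 2 ≤ 4 * b * c ^ 2 := by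
  have hd := det_matL1_nuSpec_four a b c
  refine ⟨fun h => by linarith [h.det_nonneg], fun h => ?_⟩
  rw [matL1_nuSpec_four] at hd ⊢
  exact symm3_posSemidef (by linarith) (by nlinarith [mul_pos hb hc]) (by linarith)

theorem matL2_nuSpec_four_posSemidef_iff {a b c : ℝ} (hb : 0 < b) :
    (matL2 (nuSpec 4 a b c)).PosSemidef ↔ (a - c) ^ 2 ≤ 2 * b * c := by
  have hd := det_matL2_nuSpec_four a b c
  refine ⟨fun h => ?_, fun h => ?_⟩
  · have h1 := h.det_nonneg
    rw [hd] at h1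
    linarith [nonneg_of_mul_nonneg_right h1 (by linarith)]
  · have h1 := mul_nonneg (show 0 ≤ 4 * b by linarith) (sub_nonneg.2 h)
    rw [matL2_nuSpec_four] at hd ⊢
    exact symm3_posSemidef (by linarith) (by nlinarith) (by linarith)

theorem isExtremeNu_four_iff {a b c : ℝ} : IsExtremeNu 4 a b c ↔
    a > b ∧ b > c ∧ c > 0 ∧ 2 * a + 4 * b + 3 * c = 1 ∧
      (((matL1 (nuSpec 4 a b c)).det = 0 ∧ (matL2 (nuSpec 4 a b c)).PosSemidef) ∨
        ((matL2 (nuSpec 4 a b c)).det = 0 ∧ (matL1 (nuSpec 4 a b c)).PosSemidef)) := by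
  rw [isExtremeNu_iff (by norm_num) (by norm_num)]
  refine and_congr_right fun hab => and_congr_right fun hbc => and_congr_right fun hc =>
    and_congr (by norm_num) ⟨?_, ?_⟩
  · rintro ⟨h1, h2, h | h⟩
    · exact Or.inl ⟨h, h2⟩
    · exact Or.inr ⟨h, h1⟩
  · have hb : 0 < b := hc.trans hbc
    rintro (⟨h, h2⟩ | ⟨h, h1⟩)
    · refine ⟨(matL1_nuSpec_four_posSemidef_iff hb hc).2 ?_, h2, Or.inl h⟩
      rw [det_matL1_nuSpec_four] at h
      linarith
    · refine ⟨h1, (matL2_nuSpec_four_posSemidef_iff hb).2 ?_, Or.inr h⟩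
      rw [det_matL2_nuSpec_four] at h
      linarith [(mul_eq_zero.1 h).resolve_left (by linarith)]

theorem isExtremeNu_five_iff {a b c : ℝ} : IsExtremeNu 5 a b c ↔
    a > b ∧ b > c ∧ c > 0 ∧ 2 * a + 5 * b + 2 * c = 1 ∧
      (a - c) ^ 2 + (a - b) ^ 2 = 4 * b * c := by
  rw [isExtremeNu_iff (by norm_num) (by norm_num), matL1_nuSpec_five, matL2_nuSpec_five, or_self]
  refine and_congr_right fun hab => and_congr_right fun hbc => and_congr_right fun hc =>
    and_congr (by norm_num) ⟨?_, fun h => ?_⟩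
  · rintro ⟨-, -, h⟩
    rw [symm3_det] at h
    have h2 : (2 * b) * ((a - c) ^ 2 + (a - b) ^ 2 - 4 * b * c) = 0 := by linear_combination -h
    linarith [(mul_eq_zero.1 h2).resolve_left (by linarith)]
  · have hdet : (!![2 * c, c - a, b - a; c - a, 2 * b, 0; b - a, 0, 2 * b] :
        Matrix _ _ ℝ).det = 0 := by
      rw [symm3_det]
      linear_combination -(2 * b) * h
    have := symm3_posSemidef (by linarith) (by nlinarith) hdet.ge
    exact ⟨this, this, hdet⟩

theorem isExtremeNu_six_iff {a b c : ℝ} : IsExtremeNu 6 a b c ↔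
    a > b ∧ b > c ∧ c > 0 ∧ 2 * a + 6 * b + c = 1 ∧ (a - b) ^ 2 = 2 * b * c := by
  rw [isExtremeNu_iff (by norm_num) (by norm_num), matL1_nuSpec_six, matL2_nuSpec_six, or_self]
  refine and_congr_right fun hab => and_congr_right fun hbc => and_congr_right fun hc =>
    and_congr (by norm_num) ⟨?_, fun h => ?_⟩
  · rintro ⟨-, -, h⟩
    rw [symm3_det] at h
    have h2 : (4 * b) * ((a - b) ^ 2 - 2 * b * c) = 0 := by linear_combination -h
    linarith [(mul_eq_zero.1 h2).resolve_left (by linarith)]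
  · have hdet : (!![2 * c, b - a, b - a; b - a, 2 * b, 0; b - a, 0, 2 * b] :
        Matrix _ _ ℝ).det = 0 := by
      rw [symm3_det]
      linear_combination -(4 * b) * h
    have := symm3_posSemidef (by linarith) (by nlinarith) hdet.ge
    exact ⟨this, this, hdet⟩

/-! ### Second roots of cubics and limits of crossing points -/

/-- A root of a cubic with negative leading coefficient between a point of negative and a point of
positive value is the second smallest root. -/
theorem isSecondRoot_of_sign_change {A B C D : ℝ} (hA : 0 < A) {f : ℝ → ℝ}
    (hf : ∀ x, f x = -A * x ^ 3 + B * x ^ 2 + C * x + D) {p b q : ℝ} (hpb : p < b) (hbq : b < q)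
    (hp : f p < 0) (hq : 0 < f q) (hb : f b = 0) : IsSecondRoot f b := by
  refine ⟨hb, ?_⟩
  -- Division by x − b: f = (x − b)g with g a concave quadratic, positive at p and q. Both p and q,
  -- hence b, lie strictly between the roots of g, and only the smaller of these is below b.
  set E := B - A * b
  set H := C + E * b
  set r := √(E ^ 2 + 4 * A * H)
  have hfac : ∀ x, f x = (x - b) * (-A * x ^ 2 + E * x + H) := by
    intro x
    have h0 := hf b
    rw [hb] at h0
    rw [hf x]
    simp only [H, E]
    linear_combination -h0
  have gp : 0 < -A * p ^ 2 + E * p + H := by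
    have h := hfac p
    by_contra hc
    nlinarith
  have gq : 0 < -A * q ^ 2 + E * q + H := by
    have h := hfac q
    by_contra hc
    nlinarith
  have hdisc : 0 < E ^ 2 + 4 * A * H := by nlinarith [sq_nonneg (2 * A * p - E)]
  have hr : r ^ 2 = E ^ 2 + 4 * A * H := Real.sq_sqrt hdisc.le
  have hr0 : 0 ≤ r := Real.sqrt_nonneg _
  have hg : ∀ x, 4 * A * (-A * x ^ 2 + E * x + H) = (r - (2 * A * x - E)) * (r + (2 * A * x - E)) := by
    intro x
    linear_combination -hr
  have hp1 : (2 * A * p - E) ^ 2 < r ^ 2 := by nlinarith [hg p, mul_pos hA gp]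
  have hq1 : (2 * A * q - E) ^ 2 < r ^ 2 := by nlinarith [hg q, mul_pos hA gq]
  have hp2 := abs_lt.1 (abs_lt_of_sq_lt_sq hp1 hr0)
  have hq2 := abs_lt.1 (abs_lt_of_sq_lt_sq hq1 hr0)
  rw [Set.ncard_eq_one]
  refine ⟨(E - r) / (2 * A), ?_⟩
  ext w
  simp only [Set.mem_ofPred_eq, Set.mem_singleton_iff]
  rw [eq_div_iff (by positivity)]
  constructor
  · rintro ⟨h1, h2⟩
    rw [hfac] at h2
    have h3 := (mul_eq_zero.1 h2).resolve_left (by linarith)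
    have h4 := hg w
    rw [h3, mul_zero] at h4
    rcases mul_eq_zero.1 h4.symm with h5 | h5
    · nlinarith
    · linarith
  · intro h
    have h4 := hg w
    rw [show r + (2 * A * w - E) = 0 by linarith, mul_zero] at h4
    have h5 := (mul_eq_zero.1 h4).resolve_left (by positivity)
    refine ⟨by nlinarith, ?_⟩
    rw [hfac, h5, mul_zero]

/-- `F c` changes sign exactly once on `[c, q c]`, from negative to positive. -/
def CrossesUp (F : ℝ → ℝ → ℝ) (q : ℝ → ℝ) : Prop :=
  ∀ c > 0, ∀ b₁ b₂, c ≤ b₁ → b₁ < b₂ → b₂ ≤ q c → 0 ≤ F c b₁ → 0 < F c b₂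

/-- Limits of the crossing point, including at the parameters where it reaches an endpoint. -/
theorem CrossesUp.tendsto {F : ℝ → ℝ → ℝ} {q : ℝ → ℝ} (h : CrossesUp F q)
    (hF : ∀ w, Continuous fun c => F c w) (hq : Continuous q) {c₀ b₀ : ℝ} (hc₀ : 0 < c₀)
    (h1 : c₀ ≤ b₀) (h2 : b₀ ≤ q c₀) (h0 : F c₀ b₀ = 0) {b : ℝ → ℝ} {S : Set ℝ}
    (hb : ∀ c ∈ S, c < b c ∧ b c < q c ∧ F c (b c) = 0) : Tendsto b (𝓝[S] c₀) (𝓝 b₀) := by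
  have hpos : ∀ᶠ c in 𝓝 c₀, 0 < c := lt_mem_nhds hc₀
  rw [tendsto_order]
  refine ⟨fun w hw => ?_, fun w hw => ?_⟩
  · rcases lt_or_ge w c₀ with hwc | hwc
    · filter_upwards [self_mem_nhdsWithin, nhdsWithin_le_nhds (lt_mem_nhds hwc)] with c hc hcw
      exact hcw.trans (hb c hc).1
    -- At v the sign of `F c₀` is strict, so it persists for c near c₀; v > w supplies the strict
    -- inequality that the crossing property needs.
    · set v := (w + b₀) / 2 with hv
      have hwv : w < v := by simp only [hv]; linarith
      have hvb : v < b₀ := by simp only [hv]; linarith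
      have hneg : F c₀ v < 0 := by
        by_contra hc
        exact (h c₀ hc₀ v b₀ (by linarith) hvb h2 (not_lt.1 hc)).ne' h0
      have e1 : ∀ᶠ c in 𝓝 c₀, F c v < 0 := (hF v).continuousAt.eventually_lt continuousAt_const hneg
      have e2 : ∀ᶠ c in 𝓝 c₀, v < q c :=
        continuousAt_const.eventually_lt hq.continuousAt (by linarith)
      filter_upwards [self_mem_nhdsWithin, nhdsWithin_le_nhds e1, nhdsWithin_le_nhds e2,
        nhdsWithin_le_nhds hpos] with c hc hc1 hc2 hc3
      obtain ⟨k1, k2, k3⟩ := hb c hc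
      by_contra hcon
      exact (h c hc3 (b c) v k1.le (by linarith) hc2.le k3.ge).not_gt hc1
  · rcases lt_or_ge (q c₀) w with hwq | hwq
    · have e2 : ∀ᶠ c in 𝓝 c₀, q c < w := hq.continuousAt.eventually_lt continuousAt_const hwq
      filter_upwards [self_mem_nhdsWithin, nhdsWithin_le_nhds e2] with c hc hcw
      exact (hb c hc).2.1.trans hcw
    · set v := (w + b₀) / 2 with hv
      have hwv : v < w := by simp only [hv]; linarith
      have hvb : b₀ < v := by simp only [hv]; linarith
      have hvpos : 0 < F c₀ v := h c₀ hc₀ b₀ v h1 hvb (by linarith) h0.ge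
      have e1 : ∀ᶠ c in 𝓝 c₀, 0 < F c v :=
        continuousAt_const.eventually_lt (hF v).continuousAt hvpos
      have e2 : ∀ᶠ c in 𝓝 c₀, c < v := gt_mem_nhds (by linarith)
      filter_upwards [self_mem_nhdsWithin, nhdsWithin_le_nhds e1, nhdsWithin_le_nhds e2,
        nhdsWithin_le_nhds hpos] with c hc hc1 hc2 hc3
      obtain ⟨k1, k2, k3⟩ := hb c hc
      by_contra hcon
      exact (h c hc3 v (b c) hc2.le (by linarith) k2.le hc1.le).ne' k3

theorem exists_zero_of_neg_of_pos {f : ℝ → ℝ} (hf : Continuous f) {p q : ℝ} (hpq : p ≤ q)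
    (h1 : f p < 0) (h2 : 0 < f q) : ∃ b, p < b ∧ b < q ∧ f b = 0 := by
  obtain ⟨b, ⟨hb1, hb2⟩, hb⟩ := intermediate_value_Icc hpq hf.continuousOn ⟨h1.le, h2.le⟩
  refine ⟨b, lt_of_le_of_ne hb1 ?_, lt_of_le_of_ne hb2 ?_, hb⟩
  · rintro rfl
    exact h1.ne hb
  · rintro rfl
    exact h2.ne' hb

theorem CrossesUp.unique {F : ℝ → ℝ → ℝ} {q : ℝ → ℝ} (h : CrossesUp F q) {c : ℝ} (hc : 0 < c)
    {b b' : ℝ} (hb : c < b ∧ b < q c ∧ F c b = 0) (hb' : c < b' ∧ b' < q c ∧ F c b' = 0) :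
    b = b' := by
  rcases lt_trichotomy b b' with hlt | heq | hgt
  · exact absurd hb'.2.2 (h c hc b b' hb.1.le hlt hb'.2.1.le hb.2.2.ge).ne'
  · exact heq
  · exact absurd hb.2.2 (h c hc b' b hb'.1.le hgt hb.2.1.le hb'.2.2.ge).ne'

theorem tendsto_nu {l : Filter ℝ} {k : ℕ} {a b c : ℝ → ℝ} {a₀ b₀ c₀ : ℝ}
    (ha : Tendsto a l (𝓝 a₀)) (hb : Tendsto b l (𝓝 b₀)) (hc : Tendsto c l (𝓝 c₀)) :
    Tendsto (fun t => nu k (a t) (b t) (c t)) l (𝓝 (nu k a₀ b₀ c₀)) := by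
  have h1 : Continuous diagOp := by
    have h3 : Continuous fun d : Fin 9 → ℝ => fun p : Fin 3 × Fin 3 => ((d (lexIndex p) : ℝ) : ℂ) :=
      continuous_pi fun p => Complex.continuous_ofReal.comp (continuous_apply _)
    exact h3.matrix_diagonal
  have h2 : Continuous fun x : ℝ × ℝ × ℝ => nuSpec k x.1 x.2.1 x.2.2 :=
    continuous_nuSpec k (by fun_prop) (by fun_prop) (by fun_prop)
  have h4 := ((h1.comp h2).tendsto (a₀, b₀, c₀)).comp (ha.prodMk_nhds (hb.prodMk_nhds hc))
  simpa only [nu, Function.comp_def] using h4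

/-! ### Endpoint constants and their minimal polynomials -/

theorem sqrt_two_sq : √2 ^ 2 = (2 : ℝ) := Real.sq_sqrt (by norm_num)
theorem sqrt_ten_sq : √10 ^ 2 = (10 : ℝ) := Real.sq_sqrt (by norm_num)
theorem sqrt_seventeen_sq : √17 ^ 2 = (17 : ℝ) := Real.sq_sqrt (by norm_num)

theorem sqrt_two_bounds : 1.41421 < √2 ∧ √2 < 1.41422 :=
  ⟨Real.lt_sqrt_of_sq_lt (by norm_num), (Real.sqrt_lt' (by norm_num)).2 (by norm_num)⟩
theorem sqrt_ten_bounds : 3.16227 < √10 ∧ √10 < 3.16228 :=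
  ⟨Real.lt_sqrt_of_sq_lt (by norm_num), (Real.sqrt_lt' (by norm_num)).2 (by norm_num)⟩
theorem sqrt_seventeen_bounds : 4.1231 < √17 ∧ √17 < 4.1232 :=
  ⟨Real.lt_sqrt_of_sq_lt (by norm_num), (Real.sqrt_lt' (by norm_num)).2 (by norm_num)⟩

theorem cZeta2_mul : cZeta2 * (9 + 2 * √2) = 1 := by
  rw [cZeta2]
  linear_combination (-4 / 73) * sqrt_two_sq

theorem cZeta2_bounds : 0.0845 < cZeta2 ∧ cZeta2 < 0.0846 := by
  have := sqrt_two_bounds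
  constructor <;> rw [cZeta2] <;> linarith

theorem cZeta2_quadratic : 73 * cZeta2 ^ 2 - 18 * cZeta2 + 1 = 0 := by
  rw [cZeta2]
  linear_combination (4 / 73) * sqrt_two_sq

/-- The other root of the quadratic exceeds 1/9, while a > b > c and the trace condition give 9c <
1. The lemmas for the other endpoints work alike. -/
theorem lt_cZeta2_iff {c : ℝ} (hc : 9 * c ≤ 1) :
    c < cZeta2 ↔ 0 < 73 * c ^ 2 - 18 * c + 1 := by
  have h1 := cZeta2_bounds
  have h2 : 73 * c ^ 2 - 18 * c + 1 = (cZeta2 - c) * (18 - 73 * cZeta2 - 73 * c) := by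
    linear_combination cZeta2_quadratic
  rw [h2, mul_pos_iff_of_pos_right (by linarith), sub_pos]

theorem cZeta4_bounds : 0.0708 < cZeta4 ∧ cZeta4 < 0.0709 := by
  have := sqrt_seventeen_bounds
  constructor <;> rw [cZeta4] <;> linarith

theorem cZeta4_quadratic : 83 * cZeta4 ^ 2 - 20 * cZeta4 + 1 = 0 := by
  rw [cZeta4]
  linear_combination (1 / 83) * sqrt_seventeen_sq

theorem cZeta4_lt_iff {c : ℝ} (hc : 9 * c ≤ 1) : cZeta4 < c ↔ 83 * c ^ 2 - 20 * c + 1 < 0 := by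
  have h1 := cZeta4_bounds
  have h2 : 83 * c ^ 2 - 20 * c + 1 = -((c - cZeta4) * (20 - 83 * cZeta4 - 83 * c)) := by
    linear_combination cZeta4_quadratic
  rw [h2, neg_lt_zero, mul_pos_iff_of_pos_right (by linarith), sub_pos]

theorem cZeta7_bounds : 0.0233 < cZeta7 ∧ cZeta7 < 0.0234 := by
  have := sqrt_two_bounds
  constructor <;> rw [cZeta7] <;> linarith

theorem cZeta7_quadratic : 137 * cZeta7 ^ 2 - 46 * cZeta7 + 1 = 0 := by
  rw [cZeta7]
  linear_combination (196 / 137) * sqrt_two_sq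

theorem cZeta7_lt_iff {c : ℝ} (hc : 9 * c ≤ 1) : cZeta7 < c ↔ 137 * c ^ 2 - 46 * c + 1 < 0 := by
  have h1 := cZeta7_bounds
  have h2 : 137 * c ^ 2 - 46 * c + 1 = -((c - cZeta7) * (46 - 137 * cZeta7 - 137 * c)) := by
    linear_combination cZeta7_quadratic
  rw [h2, neg_lt_zero, mul_pos_iff_of_pos_right (by linarith), sub_pos]

theorem cMeet_bounds : 0.0696 < cMeet ∧ cMeet < 0.0697 := by
  have := sqrt_ten_bounds
  constructor <;> rw [cMeet] <;> linarith

theorem cMeet_quadratic : 585 * cMeet ^ 2 - 170 * cMeet + 9 = 0 := by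
  rw [cMeet]
  linear_combination (196 / 585) * sqrt_ten_sq

theorem cMeet_factor (c : ℝ) : 585 * c ^ 2 - 170 * c + 9 =
    -((c - cMeet) * (170 - 585 * cMeet - 585 * c)) := by
  linear_combination cMeet_quadratic

theorem nuSpec_one (x y z : ℝ) : nuSpec 1 x y z = ![x, x, y, z, z, z, z, z, z] := by
  ext i; fin_cases i <;> simp [nuSpec]
theorem nuSpec_two (x y z : ℝ) : nuSpec 2 x y z = ![x, x, y, y, z, z, z, z, z] := by
  ext i; fin_cases i <;> simp [nuSpec]
theorem nuSpec_three (x y z : ℝ) : nuSpec 3 x y z = ![x, x, y, y, y, z, z, z, z] := by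
  ext i; fin_cases i <;> simp [nuSpec]
theorem nuSpec_four (x y z : ℝ) : nuSpec 4 x y z = ![x, x, y, y, y, y, z, z, z] := by
  ext i; fin_cases i <;> simp [nuSpec]
theorem nuSpec_five (x y z : ℝ) : nuSpec 5 x y z = ![x, x, y, y, y, y, y, z, z] := by
  ext i; fin_cases i <;> simp [nuSpec]
theorem nuSpec_six (x y z : ℝ) : nuSpec 6 x y z = ![x, x, y, y, y, y, y, y, z] := by
  ext i; fin_cases i <;> simp [nuSpec]

/-- When b = c the value of k no longer matters, so all six families share the limit ζ₂. -/
theorem nuSpec_const (k : ℕ) (x y : ℝ) : nuSpec k x y y = nuSpec 1 x y y := by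
  ext i
  simp only [nuSpec]
  split_ifs <;> rfl

theorem nu_cZeta2 (k : ℕ) : nu k ((√2 + 1) * cZeta2) cZeta2 cZeta2 = zeta2 := by
  have h : cZeta2 = 1 / (9 + 2 * √2) := eq_one_div_of_mul_eq_one_left cZeta2_mul
  have e : nuSpec 1 (√2 + 1) 1 1 = ![√2 + 1, √2 + 1, 1, 1, 1, 1, 1, 1, 1] := nuSpec_one _ _ _
  rw [nu, nuSpec_const, zeta2, ← h, ← e, smul_nuSpec, mul_one, mul_comm]

theorem one_sub_seven_cZeta2 : (1 - 7 * cZeta2) / 2 = (√2 + 1) * cZeta2 := by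
  linear_combination (-1 / 2) * cZeta2_mul

/-! ### Families given by square roots: k = 1, 5, 6 -/

theorem isExtremeNu_one_iff_param (a b c : ℝ) : IsExtremeNu 1 a b c ↔
    c ∈ Ioo (1 / 12) cZeta2 ∧ a = a216 c ∧ b = b216 c := by
  rw [isExtremeNu_one_iff, a216, b216]
  have hz := cZeta2_bounds
  constructor
  · rintro ⟨hab, hbc, hc, hs, he⟩
    have h1 : (a - 2 * c) ^ 2 = 12 * c ^ 2 - c := by nlinarith
    -- This selects the sign of the root: a ≤ 2c would give (a − c)² ≤ c², hence b ≥ 2c ≥ a.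
    have h2 : 0 < a - 2 * c := by
      by_contra hcon
      have h3 : (a - c) ^ 2 ≤ c * c := by nlinarith
      have h4 : 3 * c - b ≤ c := le_of_mul_le_mul_left (he ▸ h3) hc
      linarith
    have h3 : √(12 * c ^ 2 - c) = a - 2 * c := by rw [← h1, Real.sqrt_sq h2.le]
    have h4 : 1 / 12 < c := by nlinarith
    refine ⟨⟨h4, (lt_cZeta2_iff (by linarith)).2 ?_⟩, by linarith, by linarith⟩
    nlinarith
  · rintro ⟨⟨h1, h2⟩, h3, h4⟩
    have hc : 0 < c := by linarith
    have hq := (lt_cZeta2_iff (by linarith)).1 h2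
    have hr0 : 0 < 12 * c ^ 2 - c := by nlinarith
    have hr := Real.sq_sqrt hr0.le
    have hrp := Real.sqrt_pos.2 hr0
    have hlt : 2 * √(12 * c ^ 2 - c) < 1 - 11 * c :=
      lt_of_pow_lt_pow_left₀ 2 (by linarith) (by nlinarith)
    generalize √(12 * c ^ 2 - c) = r at *
    subst h3 h4
    exact ⟨by linarith, by linarith, hc, by ring, by linear_combination hr⟩

theorem sqrt_216_cZeta2 : √(12 * cZeta2 ^ 2 - cZeta2) = (√2 - 1) * cZeta2 := by
  rw [show 12 * cZeta2 ^ 2 - cZeta2 = ((√2 - 1) * cZeta2) ^ 2 by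
    linear_combination (cZeta2 : ℝ) * cZeta2_mul - cZeta2 ^ 2 * sqrt_two_sq]
  exact Real.sqrt_sq (mul_nonneg (by linarith [sqrt_two_bounds]) (by linarith [cZeta2_bounds]))

theorem continuous_a216 : Continuous a216 := by unfold a216; fun_prop
theorem continuous_b216 : Continuous b216 := by unfold b216; fun_prop

theorem tendsto_nu_216_right :
    Tendsto (fun c => nu 1 (a216 c) (b216 c) c) (𝓝[<] cZeta2) (𝓝 zeta2) := by
  have h := (tendsto_nu (k := 1) (continuous_a216.tendsto cZeta2) (continuous_b216.tendsto cZeta2)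
    tendsto_id).mono_left (nhdsWithin_le_nhds (s := Iio cZeta2))
  have ha : a216 cZeta2 = (√2 + 1) * cZeta2 := by
    rw [a216, sqrt_216_cZeta2]
    ring
  have hb : b216 cZeta2 = cZeta2 := by
    rw [b216, sqrt_216_cZeta2]
    linear_combination -cZeta2_mul
  rwa [ha, hb, nu_cZeta2] at h

theorem tendsto_nu_216_left :
    Tendsto (fun c => nu 1 (a216 c) (b216 c) c) (𝓝[>] (1 / 12)) (𝓝 zeta3) := by
  have h := (tendsto_nu (k := 1) (continuous_a216.tendsto (1 / 12))
    (continuous_b216.tendsto (1 / 12)) tendsto_id).mono_left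
      (nhdsWithin_le_nhds (s := Ioi (1 / 12)))
  have hs : √(12 * (1 / 12 : ℝ) ^ 2 - 1 / 12) = 0 := by
    rw [show 12 * (1 / 12 : ℝ) ^ 2 - 1 / 12 = 0 by norm_num, Real.sqrt_zero]
  have ha : a216 (1 / 12) = 1 / 12 * 2 := by
    rw [a216, hs]
    norm_num
  have hb : b216 (1 / 12) = 1 / 12 * 2 := by
    rw [b216, hs]
    norm_num
  have hz : nu 1 (1 / 12 * 2) (1 / 12 * 2) (1 / 12) = zeta3 := by
    rw [nu, zeta3, ← nuSpec_one, smul_nuSpec, mul_one]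
  rwa [ha, hb, hz] at h

theorem isExtremeNu_five_iff_param (a b c : ℝ) : IsExtremeNu 5 a b c ↔
    c ∈ Ioo cZeta7 cZeta2 ∧ a = a252 c ∧ b = b252 c := by
  rw [isExtremeNu_five_iff, a252, b252]
  have hz := cZeta2_bounds
  have hz7 := cZeta7_bounds
  constructor
  · rintro ⟨hab, hbc, hc, hs, he⟩
    have ha : a = (1 - 5 * b - 2 * c) / 2 := by linarith
    have h1 : (6 - 13 * c - 37 * b) ^ 2 = -201 * c ^ 2 + 66 * c - 1 := by
      rw [ha] at he
      linear_combination 74 * he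
    have h2 : 0 < 6 - 13 * c - 37 * b := by linarith
    have h3 : √(-201 * c ^ 2 + 66 * c - 1) = 6 - 13 * c - 37 * b := by rw [← h1, Real.sqrt_sq h2.le]
    have h9 : 9 * c ≤ 1 := by linarith
    refine ⟨⟨(cZeta7_lt_iff h9).2 ?_, (lt_cZeta2_iff h9).2 ?_⟩, by linarith, by linarith⟩
    -- In terms of the square root 6 − 13c − 37b, the condition a > b is the bound (5 − 17c)/7 and b
    -- > c is the bound 6 − 50c; squaring gives the two endpoint quadratics.
    · have h4 : 0 < (5 - 17 * c) / 7 := by linarith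
      have h5 : (5 - 17 * c) / 7 < 6 - 13 * c - 37 * b := by linarith
      have h6 := pow_lt_pow_left₀ h5 h4.le two_ne_zero
      rw [h1] at h6
      linarith
    · have h5 : 6 - 13 * c - 37 * b < 6 - 50 * c := by linarith
      have h6 := pow_lt_pow_left₀ h5 h2.le two_ne_zero
      rw [h1] at h6
      linarith
  · rintro ⟨⟨h1, h2⟩, h3, h4⟩
    have hc : 0 < c := by linarith
    have hq := (lt_cZeta2_iff (by linarith)).1 h2
    have hq7 := (cZeta7_lt_iff (by linarith)).1 h1
    have hr0 : 0 < -201 * c ^ 2 + 66 * c - 1 := by nlinarith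
    have hr := Real.sq_sqrt hr0.le
    have hrp := Real.sqrt_pos.2 hr0
    have hlt : √(-201 * c ^ 2 + 66 * c - 1) < 6 - 50 * c :=
      lt_of_pow_lt_pow_left₀ 2 (by linarith) (by linarith)
    have hgt : (5 - 17 * c) / 7 < √(-201 * c ^ 2 + 66 * c - 1) :=
      lt_of_pow_lt_pow_left₀ 2 hrp.le (by linarith)
    generalize √(-201 * c ^ 2 + 66 * c - 1) = r at *
    subst h3 h4
    exact ⟨by linarith, by linarith, hc, by ring, by linear_combination (1 / 74) * hr⟩

theorem continuous_a252 : Continuous a252 := by unfold a252; fun_prop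
theorem continuous_b252 : Continuous b252 := by unfold b252; fun_prop

theorem tendsto_nu_252_right :
    Tendsto (fun c => nu 5 (a252 c) (b252 c) c) (𝓝[<] cZeta2) (𝓝 zeta2) := by
  have h := (tendsto_nu (k := 5) (continuous_a252.tendsto cZeta2) (continuous_b252.tendsto cZeta2)
    tendsto_id).mono_left (nhdsWithin_le_nhds (s := Iio cZeta2))
  have hs : √(-201 * cZeta2 ^ 2 + 66 * cZeta2 - 1) = 6 - 50 * cZeta2 := by
    rw [show -201 * cZeta2 ^ 2 + 66 * cZeta2 - 1 = (6 - 50 * cZeta2) ^ 2 by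
      linear_combination -37 * cZeta2_quadratic]
    exact Real.sqrt_sq (by linarith [cZeta2_bounds])
  have ha : a252 cZeta2 = (√2 + 1) * cZeta2 := by
    rw [a252, hs]
    linear_combination (-1 / 2) * cZeta2_mul
  have hb : b252 cZeta2 = cZeta2 := by
    rw [b252, hs]
    ring
  rwa [ha, hb, nu_cZeta2] at h

theorem cZeta7_mul : cZeta7 * (23 + 14 * √2) = 1 := by
  rw [cZeta7]
  linear_combination (-196 / 137) * sqrt_two_sq

theorem tendsto_nu_252_left :
    Tendsto (fun c => nu 5 (a252 c) (b252 c) c) (𝓝[>] cZeta7) (𝓝 zeta7) := by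
  have h := (tendsto_nu (k := 5) (continuous_a252.tendsto cZeta7) (continuous_b252.tendsto cZeta7)
    tendsto_id).mono_left (nhdsWithin_le_nhds (s := Ioi cZeta7))
  have hs : √(-201 * cZeta7 ^ 2 + 66 * cZeta7 - 1) = (5 - 17 * cZeta7) / 7 := by
    rw [show -201 * cZeta7 ^ 2 + 66 * cZeta7 - 1 = ((5 - 17 * cZeta7) / 7) ^ 2 by
      linear_combination (-74 / 49) * cZeta7_quadratic]
    exact Real.sqrt_sq (by linarith [cZeta7_bounds])
  have hb : b252 cZeta7 = cZeta7 * (3 + 2 * √2) := by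
    rw [b252, hs]
    linear_combination (-1 / 7) * cZeta7_mul
  have ha : a252 cZeta7 = cZeta7 * (3 + 2 * √2) := by
    rw [a252, hs]
    linear_combination (-1 / 7) * cZeta7_mul
  have hc : cZeta7 = 1 / (23 + 14 * √2) := eq_one_div_of_mul_eq_one_left cZeta7_mul
  have hz : nu 5 (cZeta7 * (3 + 2 * √2)) (cZeta7 * (3 + 2 * √2)) cZeta7 = zeta7 := by
    rw [nu, zeta7, ← nuSpec_five, ← hc, smul_nuSpec, mul_one]
  rwa [ha, hb, hz] at h

theorem isExtremeNu_six_iff_param (a b c : ℝ) : IsExtremeNu 6 a b c ↔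
    c ∈ Ioo 0 cZeta2 ∧ a = a261 c ∧ b = b261 c := by
  rw [isExtremeNu_six_iff, a261, b261]
  have hz := cZeta2_bounds
  constructor
  · rintro ⟨hab, hbc, hc, hs, he⟩
    have ha : a = (1 - 6 * b - c) / 2 := by linarith
    have h1 : (2 - c - 16 * b) ^ 2 = 4 * c - 3 * c ^ 2 := by
      rw [ha] at he
      linear_combination 16 * he
    have h2 : 0 < 2 - c - 16 * b := by linarith
    have h3 : √(4 * c - 3 * c ^ 2) = 2 - c - 16 * b := by rw [← h1, Real.sqrt_sq h2.le]
    have h9 : 9 * c ≤ 1 := by linarith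
    refine ⟨⟨hc, (lt_cZeta2_iff h9).2 ?_⟩, by linarith, by linarith⟩
    have h5 : 2 - c - 16 * b < 2 - 17 * c := by linarith
    have h6 := pow_lt_pow_left₀ h5 h2.le two_ne_zero
    rw [h1] at h6
    linarith
  · rintro ⟨⟨h1, h2⟩, h3, h4⟩
    have hq := (lt_cZeta2_iff (by linarith)).1 h2
    have hr0 : 0 < 4 * c - 3 * c ^ 2 := by nlinarith
    have hr := Real.sq_sqrt hr0.le
    have hrp := Real.sqrt_pos.2 hr0
    have hlt : √(4 * c - 3 * c ^ 2) < 2 - 17 * c :=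
      lt_of_pow_lt_pow_left₀ 2 (by linarith) (by linarith)
    have hgt : c < √(4 * c - 3 * c ^ 2) := lt_of_pow_lt_pow_left₀ 2 hrp.le (by nlinarith)
    generalize √(4 * c - 3 * c ^ 2) = r at *
    subst h3 h4
    exact ⟨by linarith, by linarith, h1, by ring, by linear_combination (1 / 16) * hr⟩

theorem continuous_a261 : Continuous a261 := by unfold a261; fun_prop
theorem continuous_b261 : Continuous b261 := by unfold b261; fun_prop

theorem tendsto_nu_261_right :
    Tendsto (fun c => nu 6 (a261 c) (b261 c) c) (𝓝[<] cZeta2) (𝓝 zeta2) := by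
  have h := (tendsto_nu (k := 6) (continuous_a261.tendsto cZeta2) (continuous_b261.tendsto cZeta2)
    tendsto_id).mono_left (nhdsWithin_le_nhds (s := Iio cZeta2))
  have hs : √(4 * cZeta2 - 3 * cZeta2 ^ 2) = 2 - 17 * cZeta2 := by
    rw [show 4 * cZeta2 - 3 * cZeta2 ^ 2 = (2 - 17 * cZeta2) ^ 2 by
      linear_combination -4 * cZeta2_quadratic]
    exact Real.sqrt_sq (by linarith [cZeta2_bounds])
  have ha : a261 cZeta2 = (√2 + 1) * cZeta2 := by
    rw [a261, hs]
    linear_combination (-1 / 2) * cZeta2_mul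
  have hb : b261 cZeta2 = cZeta2 := by
    rw [b261, hs]
    ring
  rwa [ha, hb, nu_cZeta2] at h

theorem tendsto_nu_261_left :
    Tendsto (fun c => nu 6 (a261 c) (b261 c) c) (𝓝[>] 0) (𝓝 zeta8) := by
  have h := (tendsto_nu (k := 6) (continuous_a261.tendsto 0) (continuous_b261.tendsto 0)
    tendsto_id).mono_left (nhdsWithin_le_nhds (s := Ioi 0))
  have ha : a261 0 = 1 / 8 * 1 := by norm_num [a261]
  have hb : b261 0 = 1 / 8 * 1 := by norm_num [b261]
  have hz : nu 6 (1 / 8 * 1) (1 / 8 * 1) 0 = zeta8 := by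
    rw [nu, zeta8, ← nuSpec_six, smul_nuSpec, mul_zero]
  rwa [ha, hb, hz] at h

/-! ### Families given by cubics: k = 2, 3 -/

theorem cubic225_eq {a b c : ℝ} (h : 2 * a + 2 * b + 5 * c = 1) :
    cubic225 c b = 2 * (c * (6 * b * c - b ^ 2 - c ^ 2) - 2 * b * (a - c) ^ 2) := by
  have ha : a = (1 - 2 * b - 5 * c) / 2 := by linarith
  rw [cubic225, ha]
  ring

theorem cubic234_eq {a b c : ℝ} (h : 2 * a + 3 * b + 4 * c = 1) :
    cubic234 c b = 4 * (4 * b * c ^ 2 - (b + c) * (a - c) ^ 2) := by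
  have ha : a = (1 - 3 * b - 4 * c) / 2 := by linarith
  rw [cubic234, ha]
  ring

/-- The bound (1 − 5c)/4 is the value of b at which a = b. Up to there the cubic divided by b is
strictly increasing; `key` is the positivity of its difference quotient, cleared of denominators. -/
theorem crossesUp_cubic225 : CrossesUp cubic225 fun c => (1 - 5 * c) / 4 := by
  intro c hc b₁ b₂ h1 h12 h2 h
  set a₁ := (1 - 2 * b₁ - 5 * c) / 2
  set a₂ := (1 - 2 * b₂ - 5 * c) / 2
  have e1 : 2 * a₁ + 2 * b₁ + 5 * c = 1 := by ring
  have e2 : 2 * a₂ + 2 * b₂ + 5 * c = 1 := by ring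
  have h2' : b₂ ≤ (1 - 5 * c) / 4 := h2
  clear_value a₁ a₂
  rw [cubic225_eq e1] at h
  rw [cubic225_eq e2]
  have hb1 : 0 < b₁ := by linarith
  have hb2 : 0 < b₂ := by linarith
  have ha : a₁ = a₂ + (b₂ - b₁) := by linarith
  have key : 0 < 2 * b₁ * b₂ * (a₁ + a₂ - 2 * c) - c * (b₁ * b₂ - c ^ 2) := by
    have k1 : b₁ + b₂ - 2 * c < a₁ + a₂ - 2 * c := by linarith
    have k2 := mul_lt_mul_of_pos_left k1 (show 0 < 2 * b₁ * b₂ by positivity)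
    have k3 : c * (b₁ * (b₂ - c)) ≤ b₂ * (b₁ * (b₂ - c)) :=
      mul_le_mul_of_nonneg_right (by linarith) (mul_nonneg hb1.le (by linarith))
    have k4 : c * (c * (b₁ - c)) ≤ b₁ * (b₂ * (b₁ - c)) :=
      mul_le_mul h1 (mul_le_mul_of_nonneg_right (by linarith) (by linarith))
        (mul_nonneg hc.le (by linarith)) hb1.le
    have k5 : 0 ≤ b₁ * b₂ * (b₂ - c) := mul_nonneg (by positivity) (by linarith)
    have k6 : 0 ≤ b₁ * b₂ * (b₁ - c) := mul_nonneg (by positivity) (by linarith)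
    nlinarith
  have h3 : b₁ * (c * (6 * b₂ * c - b₂ ^ 2 - c ^ 2) - 2 * b₂ * (a₂ - c) ^ 2) =
      b₂ * (c * (6 * b₁ * c - b₁ ^ 2 - c ^ 2) - 2 * b₁ * (a₁ - c) ^ 2) +
      (b₂ - b₁) * (2 * b₁ * b₂ * (a₁ + a₂ - 2 * c) - c * (b₁ * b₂ - c ^ 2)) := by
    rw [ha]
    ring
  have h4 := mul_pos (sub_pos.2 h12) key
  have h5 := mul_nonneg hb2.le (show 0 ≤ c * (6 * b₁ * c - b₁ ^ 2 - c ^ 2) -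
    2 * b₁ * (a₁ - c) ^ 2 by linarith)
  have h6 := pos_of_mul_pos_right (show 0 < b₁ * (c * (6 * b₂ * c - b₂ ^ 2 - c ^ 2) -
    2 * b₂ * (a₂ - c) ^ 2) by linarith) hb1.le
  linarith

/-- The cubic divided by 4b is 4c² − (1 + c/b)(a − c)², and both factors of the subtracted term
decrease as b grows, while a ≥ b. -/
theorem crossesUp_cubic234 : CrossesUp cubic234 fun c => (1 - 4 * c) / 5 := by
  intro c hc b₁ b₂ h1 h12 h2 h
  set a₁ := (1 - 3 * b₁ - 4 * c) / 2
  set a₂ := (1 - 3 * b₂ - 4 * c) / 2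
  have e1 : 2 * a₁ + 3 * b₁ + 4 * c = 1 := by ring
  have e2 : 2 * a₂ + 3 * b₂ + 4 * c = 1 := by ring
  have h2' : b₂ ≤ (1 - 4 * c) / 5 := h2
  clear_value a₁ a₂
  rw [cubic234_eq e1] at h
  rw [cubic234_eq e2]
  have hb1 : 0 < b₁ := by linarith
  have hb2 : 0 < b₂ := by linarith
  have k1 : (a₂ - c) ^ 2 < (a₁ - c) ^ 2 := pow_lt_pow_left₀ (by linarith) (by linarith) two_ne_zero
  have k2 : b₁ * (b₂ + c) * (a₂ - c) ^ 2 ≤ b₂ * (b₁ + c) * (a₂ - c) ^ 2 :=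
    mul_le_mul_of_nonneg_right (by nlinarith) (sq_nonneg _)
  have k3 := mul_lt_mul_of_pos_left k1 (show 0 < b₂ * (b₁ + c) by positivity)
  have k4 := mul_nonneg hb2.le (show 0 ≤ 4 * b₁ * c ^ 2 - (b₁ + c) * (a₁ - c) ^ 2 by linarith)
  have k5 := pos_of_mul_pos_right (show 0 < b₁ * (4 * b₂ * c ^ 2 - (b₂ + c) * (a₂ - c) ^ 2) by
    linarith) hb1.le
  linarith

theorem continuous_cubic225 (c : ℝ) : Continuous (cubic225 c) := by unfold cubic225; fun_prop
theorem continuous_cubic234 (c : ℝ) : Continuous (cubic234 c) := by unfold cubic234; fun_prop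
theorem continuous_cubic243 (c : ℝ) : Continuous (cubic243 c) := by unfold cubic243; fun_prop
theorem continuous_cubic225_left (w : ℝ) : Continuous fun c => cubic225 c w := by
  unfold cubic225; fun_prop
theorem continuous_cubic234_left (w : ℝ) : Continuous fun c => cubic234 c w := by
  unfold cubic234; fun_prop
theorem continuous_cubic243_left (w : ℝ) : Continuous fun c => cubic243 c w := by
  unfold cubic243; fun_prop

/-- The values of the cubics at b = c and at a = b contain the polynomials that define the
endpoints, so the range of c is exactly where the signs at the two ends differ. -/
theorem cubic225_self (c : ℝ) : cubic225 c c = -(c * (73 * c ^ 2 - 18 * c + 1)) := by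
  rw [cubic225]; ring
theorem cubic234_self (c : ℝ) : cubic234 c c = -(2 * c * (73 * c ^ 2 - 18 * c + 1)) := by
  rw [cubic234]; ring
theorem cubic243_self (c : ℝ) : cubic243 c c = -(2 * c * (73 * c ^ 2 - 18 * c + 1)) := by
  rw [cubic243]; ring

theorem cubic225_diag (c : ℝ) : cubic225 c ((1 - 5 * c) / 4) =
    -((1 - c) * (83 * c ^ 2 - 20 * c + 1) / 16) := by
  rw [cubic225]; ring

theorem cubic234_diag (c : ℝ) : cubic234 c ((1 - 4 * c) / 5) =
    -(4 / 125 * (481 * c ^ 3 - 37 * c ^ 2 - 17 * c + 1)) := by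
  rw [cubic234]; ring

/-- A choice of zeros of `F c` in `(c, q c)` for `c` in the range. -/
structure RootChoice (F : ℝ → ℝ → ℝ) (q : ℝ → ℝ) (S : Set ℝ) (b : ℝ → ℝ) : Prop where
  zero : ∀ c ∈ S, c < b c ∧ b c < q c ∧ F c (b c) = 0
  second : ∀ c ∈ S, IsSecondRoot (F c) (b c)

theorem exists_rootChoice225 :
    ∃ b, RootChoice cubic225 (fun c => (1 - 5 * c) / 4) (Ioo cZeta4 cZeta2) b := by
  have key : ∀ c, ∃ b, c ∈ Ioo cZeta4 cZeta2 →
      (c < b ∧ b < (1 - 5 * c) / 4 ∧ cubic225 c b = 0) ∧ IsSecondRoot (cubic225 c) b := by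
    intro c
    by_cases hc : c ∈ Ioo cZeta4 cZeta2
    · have hz := cZeta2_bounds
      have hz4 := cZeta4_bounds
      have hc0 : 0 < c := by linarith [hc.1]
      have h9 : 9 * c ≤ 1 := by linarith [hc.2]
      have h1 : cubic225 c c < 0 := by
        rw [cubic225_self, neg_lt_zero]
        exact mul_pos hc0 ((lt_cZeta2_iff h9).1 hc.2)
      have h2 : 0 < cubic225 c ((1 - 5 * c) / 4) := by
        rw [cubic225_diag]
        nlinarith [(cZeta4_lt_iff h9).1 hc.1]
      obtain ⟨b, hb1, hb2, hb⟩ :=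
        exists_zero_of_neg_of_pos (continuous_cubic225 c) (by linarith [hc.2]) h1 h2
      refine ⟨b, fun _ => ⟨⟨hb1, hb2, hb⟩, isSecondRoot_of_sign_change (A := 4)
        (B := 4 - 30 * c) (C := -37 * c ^ 2 + 14 * c - 1) (D := -(2 * c ^ 3)) (by norm_num)
        (fun x => ?_) hb1 hb2 h1 h2 hb⟩⟩
      rw [cubic225]
      ring
    · exact ⟨0, fun h => absurd h hc⟩
  choose b hb using key
  exact ⟨b, fun c hc => (hb c hc).1, fun c hc => (hb c hc).2⟩

theorem isExtremeNu_two_iff_param {b₁ : ℝ → ℝ}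
    (hb : RootChoice cubic225 (fun c => (1 - 5 * c) / 4) (Ioo cZeta4 cZeta2) b₁) (a b c : ℝ) :
    IsExtremeNu 2 a b c ↔
      c ∈ Ioo cZeta4 cZeta2 ∧ a = (1 - 2 * b₁ c - 5 * c) / 2 ∧ b = b₁ c := by
  rw [isExtremeNu_two_iff]
  have hz := cZeta2_bounds
  have hz4 := cZeta4_bounds
  constructor
  · rintro ⟨hab, hbc, hc, hs, he⟩
    have h9 : 9 * c ≤ 1 := by linarith
    have h0 : cubic225 c b = 0 := by
      rw [cubic225_eq hs]
      linear_combination -2 * he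
    have hbq : b < (1 - 5 * c) / 4 := by linarith
    have h1 : c < cZeta2 := by
      rw [lt_cZeta2_iff h9]
      by_contra hcon
      refine (crossesUp_cubic225 c hc c b le_rfl hbc hbq.le ?_).ne' h0
      rw [cubic225_self]
      nlinarith
    have h2 : cZeta4 < c := by
      rw [cZeta4_lt_iff h9]
      have := crossesUp_cubic225 c hc b _ hbc.le hbq le_rfl h0.ge
      rw [cubic225_diag] at this
      by_contra hcon
      nlinarith
    have h3 : b = b₁ c :=
      crossesUp_cubic225.unique hc ⟨hbc, hbq, h0⟩ (hb.zero c ⟨h2, h1⟩)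
    exact ⟨⟨h2, h1⟩, by linarith, h3⟩
  · rintro ⟨hc, h3, h4⟩
    obtain ⟨k1, k2, k3⟩ := hb.zero c hc
    rw [← h4] at k1 k2 k3 h3
    have hs : 2 * a + 2 * b + 5 * c = 1 := by linarith
    rw [cubic225_eq hs] at k3
    exact ⟨by linarith, k1, by linarith [hc.1], hs, by linarith⟩

/-- As c → c₂ the crossing merges with the end b = c. At the other end of the range it merges with a
= b. -/
theorem tendsto_nu_225_right {b₁ : ℝ → ℝ}
    (hb : RootChoice cubic225 (fun c => (1 - 5 * c) / 4) (Ioo cZeta4 cZeta2) b₁) :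
    Tendsto (fun c => nu 2 ((1 - 2 * b₁ c - 5 * c) / 2) (b₁ c) c) (𝓝[<] cZeta2) (𝓝 zeta2) := by
  have hz := cZeta2_bounds
  have hz4 := cZeta4_bounds
  have h1 := crossesUp_cubic225.tendsto continuous_cubic225_left (by fun_prop)
    (c₀ := cZeta2) (b₀ := cZeta2) (by linarith) le_rfl (by linarith)
    (by rw [cubic225_self, cZeta2_quadratic]; simp) hb.zero
  rw [nhdsWithin_Ioo_eq_nhdsLT (by linarith)] at h1
  have h2 : Tendsto (fun c : ℝ => c) (𝓝[<] cZeta2) (𝓝 cZeta2) := nhdsWithin_le_nhds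
  have h := tendsto_nu (k := 2) (((tendsto_const_nhds (x := 1).sub (h1.const_mul 2)).sub
    (h2.const_mul 5)).div_const 2) h1 h2
  rwa [show (1 - 2 * cZeta2 - 5 * cZeta2) / 2 = (√2 + 1) * cZeta2 by
    rw [← one_sub_seven_cZeta2]; ring, nu_cZeta2] at h

theorem cZeta4_mul : cZeta4 * (10 + √17) = 1 := by
  rw [cZeta4]
  linear_combination (-1 / 83) * sqrt_seventeen_sq

theorem tendsto_nu_225_left {b₁ : ℝ → ℝ}
    (hb : RootChoice cubic225 (fun c => (1 - 5 * c) / 4) (Ioo cZeta4 cZeta2) b₁) :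
    Tendsto (fun c => nu 2 ((1 - 2 * b₁ c - 5 * c) / 2) (b₁ c) c) (𝓝[>] cZeta4) (𝓝 zeta4) := by
  have hz := cZeta2_bounds
  have hz4 := cZeta4_bounds
  have h1 := crossesUp_cubic225.tendsto continuous_cubic225_left (by fun_prop)
    (c₀ := cZeta4) (b₀ := (1 - 5 * cZeta4) / 4) (by linarith) (by linarith) le_rfl
    (by rw [cubic225_diag, cZeta4_quadratic]; simp) hb.zero
  rw [nhdsWithin_Ioo_eq_nhdsGT (by linarith)] at h1
  have h2 : Tendsto (fun c : ℝ => c) (𝓝[>] cZeta4) (𝓝 cZeta4) := nhdsWithin_le_nhds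
  have h := tendsto_nu (k := 2) (((tendsto_const_nhds (x := 1).sub (h1.const_mul 2)).sub
    (h2.const_mul 5)).div_const 2) h1 h2
  have hc : cZeta4 = 1 / (10 + √17) := eq_one_div_of_mul_eq_one_left cZeta4_mul
  have hz : nu 2 (cZeta4 * ((5 + √17) / 4)) (cZeta4 * ((5 + √17) / 4)) cZeta4 = zeta4 := by
    rw [nu, zeta4, ← nuSpec_two, ← hc, smul_nuSpec, mul_one]
  rwa [show (1 - 2 * ((1 - 5 * cZeta4) / 4) - 5 * cZeta4) / 2 = cZeta4 * ((5 + √17) / 4) by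
      linear_combination (-1 / 4) * cZeta4_mul,
    show (1 - 5 * cZeta4) / 4 = cZeta4 * ((5 + √17) / 4) by
      linear_combination (-1 / 4) * cZeta4_mul, hz] at h

/-- The second root of `481 y³ - 37 y² - 17 y + 1`. -/
theorem exists_y : ∃ y : ℝ, IsSecondRoot (fun w => 481 * w ^ 3 - 37 * w ^ 2 - 17 * w + 1) y ∧
    481 * y ^ 3 - 37 * y ^ 2 - 17 * y + 1 = 0 ∧ 0.0569917 < y ∧ y < 0.0569919 := by
  -- The sign is reversed to obtain a negative leading coefficient, as `isSecondRoot_of_sign_change`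
  -- requires.
  have hcont : Continuous fun w : ℝ => -(481 * w ^ 3 - 37 * w ^ 2 - 17 * w + 1) := by fun_prop
  obtain ⟨y, h1, h2, h3⟩ := exists_zero_of_neg_of_pos hcont
    (show (0.0569917 : ℝ) ≤ 0.0569919 by norm_num) (by norm_num) (by norm_num)
  refine ⟨y, ?_, by linarith, h1, h2⟩
  have h4 := isSecondRoot_of_sign_change (A := 481) (B := 37) (C := 17) (D := -1) (by norm_num)
    (f := fun w : ℝ => -(481 * w ^ 3 - 37 * w ^ 2 - 17 * w + 1))
    (fun x => by ring) h1 h2 (by norm_num) (by norm_num) h3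
  simpa only [IsSecondRoot, neg_eq_zero] using h4

/-- Division by c − y leaves a cofactor of constant sign for 0 < c ≤ 1/9. -/
theorem lt_iff_of_root {y c : ℝ} (hy : 481 * y ^ 3 - 37 * y ^ 2 - 17 * y + 1 = 0)
    (hy1 : 0.0569917 < y) (hy2 : y < 0.0569919) (hc : 0 < c) (h9 : 9 * c ≤ 1) :
    y < c ↔ 481 * c ^ 3 - 37 * c ^ 2 - 17 * c + 1 < 0 := by
  have h1 : 481 * c ^ 3 - 37 * c ^ 2 - 17 * c + 1 =
      -((c - y) * (17 + 37 * (c + y) - 481 * (c ^ 2 + c * y + y ^ 2))) := by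
    linear_combination hy
  have h2 : 0 < 17 + 37 * (c + y) - 481 * (c ^ 2 + c * y + y ^ 2) := by nlinarith
  rw [h1, neg_lt_zero, mul_pos_iff_of_pos_right h2, sub_pos]

theorem exists_rootChoice234 {y : ℝ} (hy : 481 * y ^ 3 - 37 * y ^ 2 - 17 * y + 1 = 0)
    (hy1 : 0.0569917 < y) (hy2 : y < 0.0569919) :
    ∃ b, RootChoice cubic234 (fun c => (1 - 4 * c) / 5) (Ioo y cZeta2) b := by
  have key : ∀ c, ∃ b, c ∈ Ioo y cZeta2 →
      (c < b ∧ b < (1 - 4 * c) / 5 ∧ cubic234 c b = 0) ∧ IsSecondRoot (cubic234 c) b := by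
    intro c
    by_cases hc : c ∈ Ioo y cZeta2
    · have hz := cZeta2_bounds
      have hc0 : 0 < c := by linarith [hc.1]
      have h9 : 9 * c ≤ 1 := by linarith [hc.2]
      have h1 : cubic234 c c < 0 := by
        rw [cubic234_self, neg_lt_zero]
        exact mul_pos (by linarith) ((lt_cZeta2_iff h9).1 hc.2)
      have h2 : 0 < cubic234 c ((1 - 4 * c) / 5) := by
        rw [cubic234_diag]
        linarith [(lt_iff_of_root hy hy1 hy2 hc0 h9).1 hc.1]
      obtain ⟨b, hb1, hb2, hb⟩ :=
        exists_zero_of_neg_of_pos (continuous_cubic234 c) (by linarith [hc.2]) h1 h2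
      refine ⟨b, fun _ => ⟨⟨hb1, hb2, hb⟩, isSecondRoot_of_sign_change (A := 9)
        (B := 6 - 45 * c) (C := -56 * c ^ 2 + 18 * c - 1) (D := -(c * (1 - 6 * c) ^ 2)) (by norm_num)
        (fun x => ?_) hb1 hb2 h1 h2 hb⟩⟩
      rw [cubic234]
      ring
    · exact ⟨0, fun h => absurd h hc⟩
  choose b hb using key
  exact ⟨b, fun c hc => (hb c hc).1, fun c hc => (hb c hc).2⟩

theorem isExtremeNu_three_iff_param {y : ℝ} (hy : 481 * y ^ 3 - 37 * y ^ 2 - 17 * y + 1 = 0)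
    (hy1 : 0.0569917 < y) (hy2 : y < 0.0569919) {b₂ : ℝ → ℝ}
    (hb : RootChoice cubic234 (fun c => (1 - 4 * c) / 5) (Ioo y cZeta2) b₂) (a b c : ℝ) :
    IsExtremeNu 3 a b c ↔
      c ∈ Ioo y cZeta2 ∧ a = (1 - 3 * b₂ c - 4 * c) / 2 ∧ b = b₂ c := by
  rw [isExtremeNu_three_iff]
  have hz := cZeta2_bounds
  constructor
  · rintro ⟨hab, hbc, hc, hs, he⟩
    have h9 : 9 * c ≤ 1 := by linarith
    have h0 : cubic234 c b = 0 := by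
      rw [cubic234_eq hs]
      linear_combination -4 * he
    have hbq : b < (1 - 4 * c) / 5 := by linarith
    have h1 : c < cZeta2 := by
      rw [lt_cZeta2_iff h9]
      by_contra hcon
      refine (crossesUp_cubic234 c hc c b le_rfl hbc hbq.le ?_).ne' h0
      rw [cubic234_self]
      nlinarith
    have h2 : y < c := by
      rw [lt_iff_of_root hy hy1 hy2 hc h9]
      have := crossesUp_cubic234 c hc b _ hbc.le hbq le_rfl h0.ge
      rw [cubic234_diag] at this
      linarith
    have h3 : b = b₂ c :=
      crossesUp_cubic234.unique hc ⟨hbc, hbq, h0⟩ (hb.zero c ⟨h2, h1⟩)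
    exact ⟨⟨h2, h1⟩, by linarith, h3⟩
  · rintro ⟨hc, h3, h4⟩
    obtain ⟨k1, k2, k3⟩ := hb.zero c hc
    rw [← h4] at k1 k2 k3 h3
    have hs : 2 * a + 3 * b + 4 * c = 1 := by linarith
    rw [cubic234_eq hs] at k3
    exact ⟨by linarith, k1, by linarith [hc.1], hs, by linarith⟩

theorem tendsto_nu_234_right {y : ℝ} (hy2 : y < 0.0569919) {b₂ : ℝ → ℝ}
    (hb : RootChoice cubic234 (fun c => (1 - 4 * c) / 5) (Ioo y cZeta2) b₂) :
    Tendsto (fun c => nu 3 ((1 - 3 * b₂ c - 4 * c) / 2) (b₂ c) c) (𝓝[<] cZeta2) (𝓝 zeta2) := by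
  have hz := cZeta2_bounds
  have h1 := crossesUp_cubic234.tendsto continuous_cubic234_left (by fun_prop)
    (c₀ := cZeta2) (b₀ := cZeta2) (by linarith) le_rfl (by linarith)
    (by rw [cubic234_self, cZeta2_quadratic]; simp) hb.zero
  rw [nhdsWithin_Ioo_eq_nhdsLT (by linarith)] at h1
  have h2 : Tendsto (fun c : ℝ => c) (𝓝[<] cZeta2) (𝓝 cZeta2) := nhdsWithin_le_nhds
  have h := tendsto_nu (k := 3) (((tendsto_const_nhds (x := 1).sub (h1.const_mul 3)).sub
    (h2.const_mul 4)).div_const 2) h1 h2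
  rwa [show (1 - 3 * cZeta2 - 4 * cZeta2) / 2 = (√2 + 1) * cZeta2 by
    rw [← one_sub_seven_cZeta2]; ring, nu_cZeta2] at h

theorem tendsto_nu_234_left {x y : ℝ} (hy : 481 * y ^ 3 - 37 * y ^ 2 - 17 * y + 1 = 0)
    (hy1 : 0.0569917 < y) (hy2 : y < 0.0569919) (hxy : y * (5 * x + 4) = 1) {b₂ : ℝ → ℝ}
    (hb : RootChoice cubic234 (fun c => (1 - 4 * c) / 5) (Ioo y cZeta2) b₂) :
    Tendsto (fun c => nu 3 ((1 - 3 * b₂ c - 4 * c) / 2) (b₂ c) c) (𝓝[>] y) (𝓝 (zeta5 x)) := by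
  have hz := cZeta2_bounds
  have h1 := crossesUp_cubic234.tendsto continuous_cubic234_left (by fun_prop)
    (c₀ := y) (b₀ := (1 - 4 * y) / 5) (by linarith) (by linarith) le_rfl
    (by rw [cubic234_diag, hy]; simp) hb.zero
  rw [nhdsWithin_Ioo_eq_nhdsGT (by linarith)] at h1
  have h2 : Tendsto (fun c : ℝ => c) (𝓝[>] y) (𝓝 y) := nhdsWithin_le_nhds
  have h := tendsto_nu (k := 3) (((tendsto_const_nhds (x := 1).sub (h1.const_mul 3)).sub
    (h2.const_mul 4)).div_const 2) h1 h2
  have hc : y = 1 / (5 * x + 4) := eq_one_div_of_mul_eq_one_left hxy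
  have hz : nu 3 (y * x) (y * x) y = zeta5 x := by
    rw [nu, zeta5, ← nuSpec_three, ← hc, smul_nuSpec, mul_one]
  rwa [show (1 - 3 * ((1 - 4 * y) / 5) - 4 * y) / 2 = y * x by
      linear_combination (-1 / 5) * hxy,
    show (1 - 4 * y) / 5 = y * x by linear_combination (-1 / 5) * hxy, hz] at h

theorem exists_x {y : ℝ} (hy : 481 * y ^ 3 - 37 * y ^ 2 - 17 * y + 1 = 0)
    (hy1 : 0.0569917 < y) (hy2 : y < 0.0569919) :
    ∃ x : ℝ, (x ^ 3 - x ^ 2 - 5 * x + 1 = 0 ∧ |x - 2.70928| < 0.00001) ∧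
      y * (5 * x + 4) = 1 := by
  have hy0 : 0 < y := by linarith
  -- This x is the ratio b/c at the end a = b, where 5b + 4c = 1 and c = y.
  refine ⟨(1 - 4 * y) / (5 * y), ⟨?_, ?_⟩, ?_⟩
  · field_simp
    linear_combination hy
  · rw [abs_lt]
    constructor
    · rw [lt_sub_iff_add_lt, lt_div_iff₀ (by linarith)]
      linarith
    · rw [sub_lt_iff_lt_add, div_lt_iff₀ (by linarith)]
      linarith
  · field_simp
    ring

/-! ### The two branches for k = 4 -/

theorem cubic243_eq {a b c : ℝ} (h : 2 * a + 4 * b + 3 * c = 1) :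
    cubic243 c b = 4 * (4 * b * c ^ 2 - b * (a - c) ^ 2 - c * (a - b) ^ 2) := by
  have ha : a = (1 - 4 * b - 3 * c) / 2 := by linarith
  rw [cubic243, ha]
  ring

/-- The cubic divided by 4b is 4c² − (a − c)² − (c/b)(a − b)², whose subtracted terms decrease as b
grows, while a ≥ b. -/
theorem crossesUp_cubic243 : CrossesUp cubic243 fun c => (1 - 3 * c) / 6 := by
  intro c hc b₁ b₂ h1 h12 h2 h
  set a₁ := (1 - 4 * b₁ - 3 * c) / 2
  set a₂ := (1 - 4 * b₂ - 3 * c) / 2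
  have e1 : 2 * a₁ + 4 * b₁ + 3 * c = 1 := by ring
  have e2 : 2 * a₂ + 4 * b₂ + 3 * c = 1 := by ring
  have h2' : b₂ ≤ (1 - 3 * c) / 6 := h2
  clear_value a₁ a₂
  rw [cubic243_eq e1] at h
  rw [cubic243_eq e2]
  have hb1 : 0 < b₁ := by linarith
  have hb2 : 0 < b₂ := by linarith
  have k1 : (a₂ - c) ^ 2 < (a₁ - c) ^ 2 := pow_lt_pow_left₀ (by linarith) (by linarith) two_ne_zero
  have k2 : (a₂ - b₂) ^ 2 ≤ (a₁ - b₁) ^ 2 := pow_le_pow_left₀ (by linarith) (by linarith) 2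
  have k3 := mul_lt_mul_of_pos_left k1 (mul_pos hb1 hb2)
  have k4 : b₁ * (a₂ - b₂) ^ 2 ≤ b₂ * (a₁ - b₁) ^ 2 := mul_le_mul h12.le k2 (sq_nonneg _) hb2.le
  have k5 := mul_le_mul_of_nonneg_left k4 hc.le
  have k6 := mul_nonneg hb2.le
    (show 0 ≤ 4 * b₁ * c ^ 2 - b₁ * (a₁ - c) ^ 2 - c * (a₁ - b₁) ^ 2 by linarith)
  have k7 := pos_of_mul_pos_right
    (show 0 < b₁ * (4 * b₂ * c ^ 2 - b₂ * (a₂ - c) ^ 2 - c * (a₂ - b₂) ^ 2) by linarith) hb1.le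
  linarith

theorem cubic243_diag (c : ℝ) : cubic243 c ((1 - 3 * c) / 6) =
    (1 - 3 * c) * (1 + 3 * c) * (21 * c - 1) / 54 := by
  rw [cubic243]; ring

/-- The choice extends beyond c_* because the bound c ≤ c_* in the first branch is obtained only
after b has been identified with the chosen root. -/
theorem exists_rootChoice243 :
    ∃ b, RootChoice cubic243 (fun c => (1 - 3 * c) / 6) (Ioo (1 / 21) cZeta2) b := by
  have key : ∀ c, ∃ b, c ∈ Ioo (1 / 21) cZeta2 →
      (c < b ∧ b < (1 - 3 * c) / 6 ∧ cubic243 c b = 0) ∧ IsSecondRoot (cubic243 c) b := by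
    intro c
    by_cases hc : c ∈ Ioo (1 / 21) cZeta2
    · have hz := cZeta2_bounds
      obtain ⟨hc1, hc2⟩ := hc
      have h9 : 9 * c ≤ 1 := by linarith
      have h1 : cubic243 c c < 0 := by
        rw [cubic243_self, neg_lt_zero]
        exact mul_pos (by linarith) ((lt_cZeta2_iff h9).1 hc2)
      have h2 : 0 < cubic243 c ((1 - 3 * c) / 6) := by
        rw [cubic243_diag]
        exact div_pos (mul_pos (mul_pos (by linarith) (by linarith)) (by linarith)) (by norm_num)
      obtain ⟨b, hb1, hb2, hb⟩ :=
        exists_zero_of_neg_of_pos (continuous_cubic243 c) (by linarith) h1 h2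
      refine ⟨b, fun _ => ⟨⟨hb1, hb2, hb⟩, isSecondRoot_of_sign_change (A := 16)
        (B := 8 - 76 * c) (C := -45 * c ^ 2 + 22 * c - 1) (D := -(c * (1 - 3 * c) ^ 2))
        (by norm_num) (fun x => ?_) hb1 hb2 h1 h2 hb⟩⟩
      rw [cubic243]
      ring
    · exact ⟨0, fun h => absurd h hc⟩
  choose b hb using key
  exact ⟨b, fun c hc => (hb c hc).1, fun c hc => (hb c hc).2⟩

theorem eq_a243_b243 {a b c : ℝ} (hab : a > b) (hbc : b > c) (hc : c > 0)
    (hs : 2 * a + 4 * b + 3 * c = 1) (h : 2 * b * c = (a - c) ^ 2) :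
    c < cZeta2 ∧ a = a243 c ∧ b = b243 c := by
  -- Elimination of b between the trace condition and l₂ = 0.
  have h1 : 2 * c - 9 * c ^ 2 = (2 * a - c) ^ 2 := by
    linear_combination (2 * c) * (-hs) + 4 * h
  have h2 : √(2 * c - 9 * c ^ 2) = 2 * a - c := by
    rw [h1, Real.sqrt_sq (by linarith)]
  refine ⟨(lt_cZeta2_iff (by linarith)).2 ?_, by rw [a243, h2]; ring, by rw [b243, h2]; linarith⟩
  nlinarith

/-- The curve l₂ = 0 is needed on the wider range c > 1/21, where it is the comparison point for the
first branch. -/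
theorem a243_b243_spec {c : ℝ} (h1 : 1 / 21 < c) (h2 : c < cZeta2) :
    a243 c > b243 c ∧ b243 c > c ∧ 2 * a243 c + 4 * b243 c + 3 * c = 1 ∧
      2 * b243 c * c = (a243 c - c) ^ 2 := by
  have hz := cZeta2_bounds
  have hq := (lt_cZeta2_iff (by linarith)).1 h2
  have hr := Real.sq_sqrt (show 0 ≤ 2 * c - 9 * c ^ 2 by nlinarith)
  have hr0 := Real.sqrt_nonneg (2 * c - 9 * c ^ 2)
  rw [a243, b243]
  have k1 : √(2 * c - 9 * c ^ 2) < 1 - 8 * c :=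
    lt_of_pow_lt_pow_left₀ 2 (by linarith) (by nlinarith)
  have k2 : 1 - 6 * c < 3 * √(2 * c - 9 * c ^ 2) :=
    lt_of_pow_lt_pow_left₀ 2 (by linarith) (by nlinarith)
  generalize √(2 * c - 9 * c ^ 2) = r at *
  exact ⟨by linarith, by linarith, by ring, by linear_combination (-1 / 4) * hr⟩

/-- On the curve l₂ = 0 the cubic, which is 2l₁, has the sign of 1 − 4c − 7b when b > c > 0. This
links the two branches. -/
theorem cubic243_of_tangent {a b c : ℝ} (hs : 2 * a + 4 * b + 3 * c = 1)
    (h : 2 * b * c = (a - c) ^ 2) : cubic243 c b = 4 * (c * (b - c) * (1 - 4 * c - 7 * b)) := by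
  rw [cubic243_eq hs]
  linear_combination (4 * (b + c)) * h + 4 * c * (b - c) * hs

/-- The inequality reads 3(1 − 4c) < 7√(2c − 9c²); squaring gives 585c² − 170c + 9 < 0, which is the
origin of c_*. -/
theorem seven_b243_lt_iff {c : ℝ} (h0 : 0 < c) (h9 : 9 * c ≤ 1) :
    7 * b243 c < 1 - 4 * c ↔ cMeet < c := by
  have hm := cMeet_bounds
  have hr := Real.sq_sqrt (show 0 ≤ 2 * c - 9 * c ^ 2 by nlinarith)
  have hr0 := Real.sqrt_nonneg (2 * c - 9 * c ^ 2)
  have hf := cMeet_factor c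
  have hp : 0 < 170 - 585 * cMeet - 585 * c := by linarith
  rw [← sub_pos (a := c), ← mul_pos_iff_of_pos_right hp, b243]
  generalize √(2 * c - 9 * c ^ 2) = r at *
  have e : (c - cMeet) * (170 - 585 * cMeet - 585 * c) = (7 * r) ^ 2 - (3 * (1 - 4 * c)) ^ 2 := by
    linear_combination hf - 49 * hr
  rw [e, sub_pos, sq_lt_sq₀ (by linarith) (by linarith)]
  constructor <;> intro h <;> linarith

theorem lt_seven_b243_iff {c : ℝ} (h0 : 0 < c) (h9 : 9 * c ≤ 1) :
    1 - 4 * c < 7 * b243 c ↔ c < cMeet := by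
  have hm := cMeet_bounds
  have hr := Real.sq_sqrt (show 0 ≤ 2 * c - 9 * c ^ 2 by nlinarith)
  have hr0 := Real.sqrt_nonneg (2 * c - 9 * c ^ 2)
  have hf := cMeet_factor c
  have hp : 0 < 170 - 585 * cMeet - 585 * c := by linarith
  rw [← sub_pos (b := c), ← mul_pos_iff_of_pos_right hp, b243]
  generalize √(2 * c - 9 * c ^ 2) = r at *
  have e : (cMeet - c) * (170 - 585 * cMeet - 585 * c) = (3 * (1 - 4 * c)) ^ 2 - (7 * r) ^ 2 := by
    linear_combination -hf + 49 * hr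
  rw [e, sub_pos, sq_lt_sq₀ (by linarith) (by linarith)]
  constructor <;> intro h <;> linarith

/-- For fixed c, L₂ ⪰ 0 means (a − c)² ≤ 2bc, which along the trace line means b ≥ `b243 c`. By the
single crossing this holds for the root of the cubic exactly when the cubic is nonpositive at `b243
c`, i.e. when c ≤ c_*. -/
theorem branch_one_iff {b₃ : ℝ → ℝ}
    (hb : RootChoice cubic243 (fun c => (1 - 3 * c) / 6) (Ioo (1 / 21) cZeta2) b₃) (a b c : ℝ) :
    (a > b ∧ b > c ∧ c > 0 ∧ 2 * a + 4 * b + 3 * c = 1 ∧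
      (matL1 (nuSpec 4 a b c)).det = 0 ∧ (matL2 (nuSpec 4 a b c)).PosSemidef) ↔
    (c ∈ Ioc (1 / 21) cMeet ∧ a = (1 - 4 * b₃ c - 3 * c) / 2 ∧ b = b₃ c) := by
  have hz := cZeta2_bounds
  have hm := cMeet_bounds
  rw [det_matL1_nuSpec_four]
  constructor
  · rintro ⟨hab, hbc, hc, hs, he, hL⟩
    rw [matL2_nuSpec_four_posSemidef_iff (by linarith)] at hL
    have h9 : 9 * c ≤ 1 := by linarith
    have h0 : cubic243 c b = 0 := by
      rw [cubic243_eq hs]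
      linear_combination 2 * he
    have hbq : b < (1 - 3 * c) / 6 := by linarith
    have h1 : c < cZeta2 := by
      rw [lt_cZeta2_iff h9]
      by_contra hcon
      refine (crossesUp_cubic243 c hc c b le_rfl hbc hbq.le ?_).ne' h0
      rw [cubic243_self]
      nlinarith
    have h2 : 1 / 21 < c := by
      have := crossesUp_cubic243 c hc b _ hbc.le hbq le_rfl h0.ge
      rw [cubic243_diag] at this
      by_contra hcon
      have h3 : 0 < (1 - 3 * c) * (1 + 3 * c) := mul_pos (by linarith) (by linarith)
      nlinarith
    have h3 : b = b₃ c :=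
      crossesUp_cubic243.unique hc ⟨hbc, hbq, h0⟩ (hb.zero c ⟨h2, h1⟩)
    refine ⟨⟨h2, ?_⟩, by linarith, h3⟩
    -- Beyond c_* the cubic is positive at `b243 c`, so its crossing lies strictly below and L₂ ⪰ 0
    -- fails.
    by_contra! hcm
    obtain ⟨k1, k2, k3, k4⟩ := a243_b243_spec h2 h1
    have k5 := (seven_b243_lt_iff hc h9).2 hcm
    have k6 : 0 < cubic243 c (b243 c) := by
      rw [cubic243_of_tangent k3 k4]
      exact mul_pos (by norm_num) (mul_pos (mul_pos hc (by linarith)) (by linarith))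
    have k7 : b < b243 c := by
      by_contra! hcon
      rcases hcon.eq_or_lt with heq | hlt
      · rw [heq, h0] at k6
        exact k6.false
      · exact (crossesUp_cubic243 c hc _ b k2.le hlt hbq.le k6.le).ne' h0
    have k8 : (a243 c - c) ^ 2 < (a - c) ^ 2 :=
      pow_lt_pow_left₀ (by linarith) (by linarith) two_ne_zero
    have k9 := mul_lt_mul_of_pos_right k7 hc
    linarith
  · rintro ⟨hc, h3, h4⟩
    obtain ⟨h1, h2⟩ := hc
    have hcz : c < cZeta2 := by linarith
    have hc : 0 < c := by linarith
    have h9 : 9 * c ≤ 1 := by linarith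
    obtain ⟨j1, j2, j3⟩ := hb.zero c ⟨h1, hcz⟩
    rw [← h4] at j1 j2 j3 h3
    have hs : 2 * a + 4 * b + 3 * c = 1 := by linarith
    obtain ⟨k1, k2, k3, k4⟩ := a243_b243_spec h1 hcz
    have k5 : 1 - 4 * c ≤ 7 * b243 c := by
      by_contra! hcon
      exact ((seven_b243_lt_iff hc h9).1 hcon).not_ge h2
    have k6 : cubic243 c (b243 c) ≤ 0 := by
      rw [cubic243_of_tangent k3 k4]
      have := mul_nonneg (mul_nonneg hc.le (sub_nonneg.2 k2.le)) (sub_nonneg.2 k5)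
      linarith
    have k7 : b243 c ≤ b := by
      by_contra! hcon
      exact (crossesUp_cubic243 c hc b _ j1.le hcon (by linarith) j3.ge).not_ge k6
    refine ⟨by linarith, j1, hc, hs, ?_, ?_⟩
    · rw [cubic243_eq hs] at j3
      linarith
    · rw [matL2_nuSpec_four_posSemidef_iff (by linarith)]
      have k8 : (a - c) ^ 2 ≤ (a243 c - c) ^ 2 := pow_le_pow_left₀ (by linarith) (by linarith) 2
      have k9 := mul_le_mul_of_nonneg_right k7 hc.le
      linarith

theorem det_matL2_nuSpec_four_eq_zero_iff {a b c : ℝ} (hb : 0 < b) :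
    (matL2 (nuSpec 4 a b c)).det = 0 ↔ 2 * b * c = (a - c) ^ 2 := by
  rw [det_matL2_nuSpec_four, mul_eq_zero, sub_eq_zero]
  simp [hb.ne']

theorem branch_two_iff (a b c : ℝ) :
    (a > b ∧ b > c ∧ c > 0 ∧ 2 * a + 4 * b + 3 * c = 1 ∧
      (matL2 (nuSpec 4 a b c)).det = 0 ∧ (matL1 (nuSpec 4 a b c)).PosSemidef) ↔
    (c ∈ Ico cMeet cZeta2 ∧ a = a243 c ∧ b = b243 c) := by
  have hz := cZeta2_bounds
  have hm := cMeet_bounds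
  constructor
  · rintro ⟨hab, hbc, hc, hs, he, hL⟩
    rw [matL1_nuSpec_four_posSemidef_iff (by linarith) hc] at hL
    rw [det_matL2_nuSpec_four_eq_zero_iff (by linarith)] at he
    obtain ⟨h1, h2, h3⟩ := eq_a243_b243 hab hbc hc hs he
    refine ⟨⟨?_, h1⟩, h2, h3⟩
    by_contra! hcon
    have h4 := (lt_seven_b243_iff hc (by linarith)).2 hcon
    rw [← h3] at h4
    have h5 := cubic243_of_tangent hs he
    rw [cubic243_eq hs] at h5
    have h6 := mul_pos (mul_pos hc (sub_pos.2 hbc)) (sub_pos.2 h4)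
    linarith
  · rintro ⟨⟨h1, h2⟩, rfl, rfl⟩
    have hc : 0 < c := by linarith
    obtain ⟨k1, k2, k3, k4⟩ := a243_b243_spec (by linarith) h2
    refine ⟨k1, k2, hc, k3, (det_matL2_nuSpec_four_eq_zero_iff (by linarith)).2 k4, ?_⟩
    rw [matL1_nuSpec_four_posSemidef_iff (by linarith) hc]
    have k5 : 7 * b243 c ≤ 1 - 4 * c := by
      by_contra! hcon
      exact ((lt_seven_b243_iff hc (by linarith)).1 hcon).not_ge h1
    have k6 := cubic243_of_tangent k3 k4
    rw [cubic243_eq k3] at k6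
    have k7 := mul_nonneg (mul_nonneg hc.le (sub_nonneg.2 k2.le)) (sub_nonneg.2 k5)
    linarith

/-- Modulo the quadratic equation of c_*, the stated fraction is (1 − 4c_*)/7, the zero of the
factor in `cubic243_of_tangent`. -/
theorem bMeet_eq : 7 * bMeet = 1 - 4 * cMeet := by
  have hm := cMeet_bounds
  have h1 : 85 - 14 * √10 = 585 * cMeet := by rw [cMeet]; ring
  rw [bMeet, h1]
  have : cMeet ≠ 0 := by linarith
  field_simp
  linear_combination 468 * cMeet_quadratic

theorem b243_cMeet : b243 cMeet = bMeet := by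
  have hm := cMeet_bounds
  have h1 := (seven_b243_lt_iff (c := cMeet) (by linarith) (by linarith)).not.2 (lt_irrefl _)
  have h2 := (lt_seven_b243_iff (c := cMeet) (by linarith) (by linarith)).not.2 (lt_irrefl _)
  linarith [bMeet_eq]

theorem a243_cMeet : a243 cMeet = aMeet := by
  have hm := cMeet_bounds
  have hz := cZeta2_bounds
  have h := (a243_b243_spec (c := cMeet) (by linarith) (by linarith)).2.2.1
  rw [b243_cMeet] at h
  rw [aMeet]
  linarith

theorem cubic243_meet : cubic243 cMeet bMeet = 0 := by
  have hm := cMeet_bounds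
  have hz := cZeta2_bounds
  obtain ⟨-, -, k3, k4⟩ := a243_b243_spec (c := cMeet) (by linarith) (by linarith)
  have h := cubic243_of_tangent k3 k4
  rw [b243_cMeet, bMeet_eq, sub_self, mul_zero, mul_zero] at h
  exact h

theorem meet_iff (a b c : ℝ) :
    (a > b ∧ b > c ∧ c > 0 ∧ 2 * a + 4 * b + 3 * c = 1 ∧
      (matL1 (nuSpec 4 a b c)).det = 0 ∧ (matL2 (nuSpec 4 a b c)).det = 0) ↔
    (a = aMeet ∧ b = bMeet ∧ c = cMeet) := by
  have hz := cZeta2_bounds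
  have hm := cMeet_bounds
  rw [det_matL1_nuSpec_four]
  constructor
  · rintro ⟨hab, hbc, hc, hs, he1, he2⟩
    rw [det_matL2_nuSpec_four_eq_zero_iff (by linarith)] at he2
    obtain ⟨h1, h2, h3⟩ := eq_a243_b243 hab hbc hc hs he2
    have h5 := cubic243_of_tangent hs he2
    rw [cubic243_eq hs] at h5
    have h6 : c * (b - c) * (1 - 4 * c - 7 * b) = 0 := by linarith
    have h7 : 1 - 4 * c - 7 * b = 0 :=
      (mul_eq_zero.1 h6).resolve_left (mul_pos hc (sub_pos.2 hbc)).ne'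
    have h8 : c = cMeet := by
      refine le_antisymm ?_ ?_
      · rw [← not_lt, ← seven_b243_lt_iff hc (by linarith), ← h3]
        linarith
      · rw [← not_lt, ← lt_seven_b243_iff hc (by linarith), ← h3]
        linarith
    subst h8
    exact ⟨h2.trans a243_cMeet, h3.trans b243_cMeet, rfl⟩
  · rintro ⟨rfl, rfl, rfl⟩
    obtain ⟨k1, k2, k3, k4⟩ := a243_b243_spec (c := cMeet) (by linarith) (by linarith)
    rw [b243_cMeet, a243_cMeet] at *
    have h := cubic243_meet
    rw [cubic243_eq k3] at h
    exact ⟨k1, k2, by linarith, k3, by linarith,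
      (det_matL2_nuSpec_four_eq_zero_iff (by linarith)).2 k4⟩

theorem isExtremeNu_four_iff_param {b₃ : ℝ → ℝ}
    (hb : RootChoice cubic243 (fun c => (1 - 3 * c) / 6) (Ioo (1 / 21) cZeta2) b₃) (a b c : ℝ) :
    IsExtremeNu 4 a b c ↔
      (c ∈ Ioc (1 / 21) cMeet ∧ a = (1 - 4 * b₃ c - 3 * c) / 2 ∧ b = b₃ c) ∨
      (c ∈ Ico cMeet cZeta2 ∧ a = a243 c ∧ b = b243 c) := by
  rw [← branch_one_iff hb, ← branch_two_iff, isExtremeNu_four_iff]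
  tauto

theorem tendsto_nu_243_one {b₃ : ℝ → ℝ} {l : Filter ℝ} {b₀ c₀ : ℝ} (hl : l ≤ 𝓝 c₀)
    (h1 : Tendsto b₃ l (𝓝 b₀)) :
    Tendsto (fun c => nu 4 ((1 - 4 * b₃ c - 3 * c) / 2) (b₃ c) c) l
      (𝓝 (nu 4 ((1 - 4 * b₀ - 3 * c₀) / 2) b₀ c₀)) := by
  have h2 : Tendsto (fun c : ℝ => c) l (𝓝 c₀) := hl
  exact tendsto_nu (((tendsto_const_nhds (x := 1).sub (h1.const_mul 4)).sub
    (h2.const_mul 3)).div_const 2) h1 h2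

theorem tendsto_nu_243_one_left {b₃ : ℝ → ℝ}
    (hb : RootChoice cubic243 (fun c => (1 - 3 * c) / 6) (Ioo (1 / 21) cZeta2) b₃) :
    Tendsto (fun c => nu 4 ((1 - 4 * b₃ c - 3 * c) / 2) (b₃ c) c) (𝓝[>] (1 / 21)) (𝓝 zeta6) := by
  have hz := cZeta2_bounds
  have h1 := crossesUp_cubic243.tendsto continuous_cubic243_left (by fun_prop)
    (c₀ := 1 / 21) (b₀ := (1 - 3 * (1 / 21)) / 6) (by norm_num) (by norm_num) le_rfl
    (by rw [cubic243_diag]; norm_num) hb.zero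
  rw [nhdsWithin_Ioo_eq_nhdsGT (by linarith)] at h1
  have h := tendsto_nu_243_one nhdsWithin_le_nhds h1
  have hz : nu 4 (1 / 21 * 3) (1 / 21 * 3) (1 / 21) = zeta6 := by
    rw [nu, zeta6, ← nuSpec_four, smul_nuSpec, mul_one]
  rwa [show (1 - 4 * ((1 - 3 * (1 / 21 : ℝ)) / 6) - 3 * (1 / 21)) / 2 = 1 / 21 * 3 by norm_num,
    show (1 - 3 * (1 / 21 : ℝ)) / 6 = 1 / 21 * 3 by norm_num, hz] at h

theorem tendsto_nu_243_one_right {b₃ : ℝ → ℝ}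
    (hb : RootChoice cubic243 (fun c => (1 - 3 * c) / 6) (Ioo (1 / 21) cZeta2) b₃) :
    Tendsto (fun c => nu 4 ((1 - 4 * b₃ c - 3 * c) / 2) (b₃ c) c) (𝓝[<] cMeet)
      (𝓝 (nu 4 aMeet bMeet cMeet)) := by
  have hz := cZeta2_bounds
  have hm := cMeet_bounds
  have h1 := crossesUp_cubic243.tendsto continuous_cubic243_left (by fun_prop)
    (c₀ := cMeet) (b₀ := bMeet) (by linarith) (by linarith [bMeet_eq]) (by linarith [bMeet_eq])
    cubic243_meet (S := Ioo (1 / 21) cMeet) (fun c hc => hb.zero c ⟨hc.1, by linarith [hc.2]⟩)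
  rw [nhdsWithin_Ioo_eq_nhdsLT (by linarith)] at h1
  exact tendsto_nu_243_one nhdsWithin_le_nhds h1

theorem continuous_a243 : Continuous a243 := by unfold a243; fun_prop
theorem continuous_b243 : Continuous b243 := by unfold b243; fun_prop

theorem tendsto_nu_243_two_left :
    Tendsto (fun c => nu 4 (a243 c) (b243 c) c) (𝓝[>] cMeet) (𝓝 (nu 4 aMeet bMeet cMeet)) := by
  have h := (tendsto_nu (k := 4) (continuous_a243.tendsto cMeet) (continuous_b243.tendsto cMeet)
    tendsto_id).mono_left (nhdsWithin_le_nhds (s := Ioi cMeet))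
  rwa [a243_cMeet, b243_cMeet] at h

theorem tendsto_nu_243_two_right :
    Tendsto (fun c => nu 4 (a243 c) (b243 c) c) (𝓝[<] cZeta2) (𝓝 zeta2) := by
  have h := (tendsto_nu (k := 4) (continuous_a243.tendsto cZeta2) (continuous_b243.tendsto cZeta2)
    tendsto_id).mono_left (nhdsWithin_le_nhds (s := Iio cZeta2))
  have hs : √(2 * cZeta2 - 9 * cZeta2 ^ 2) = 1 - 8 * cZeta2 := by
    rw [show 2 * cZeta2 - 9 * cZeta2 ^ 2 = (1 - 8 * cZeta2) ^ 2 by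
      linear_combination -cZeta2_quadratic]
    exact Real.sqrt_sq (by linarith [cZeta2_bounds])
  have ha : a243 cZeta2 = (√2 + 1) * cZeta2 := by
    rw [a243, hs, ← one_sub_seven_cZeta2]
    ring
  have hb : b243 cZeta2 = cZeta2 := by
    rw [b243, hs]
    ring
  rwa [ha, hb, nu_cZeta2] at h

/-! ### Assembly -/

theorem mainTheorem6 :
    ∃ (x y : ℝ) (b₁ b₂ b₃ : ℝ → ℝ),
      -- the constants `x` and `y`
      (x ^ 3 - x ^ 2 - 5 * x + 1 = 0 ∧ |x - 2.70928| < 0.00001) ∧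
      (IsSecondRoot (fun w => 481 * w ^ 3 - 37 * w ^ 2 - 17 * w + 1) y ∧
        0.056991 < y ∧ y < 0.056992) ∧
      -- the second roots of the three cubics
      (∀ c ∈ Ioo cZeta4 cZeta2, IsSecondRoot (cubic225 c) (b₁ c)) ∧
      (∀ c ∈ Ioo y cZeta2, IsSecondRoot (cubic234 c) (b₂ c)) ∧
      (∀ c ∈ Ioc (1 / 21) cMeet, IsSecondRoot (cubic243 c) (b₃ c)) ∧
      -- `ν_{2,1,6}`
      (∀ a b c : ℝ, IsExtremeNu 1 a b c ↔
        c ∈ Ioo (1 / 12) cZeta2 ∧ a = a216 c ∧ b = b216 c) ∧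
      Tendsto (fun c => nu 1 (a216 c) (b216 c) c) (𝓝[<] cZeta2) (𝓝 zeta2) ∧
      Tendsto (fun c => nu 1 (a216 c) (b216 c) c) (𝓝[>] (1 / 12)) (𝓝 zeta3) ∧
      -- `ν_{2,2,5}`
      (∀ a b c : ℝ, IsExtremeNu 2 a b c ↔
        c ∈ Ioo cZeta4 cZeta2 ∧ a = (1 - 2 * b₁ c - 5 * c) / 2 ∧ b = b₁ c) ∧
      Tendsto (fun c => nu 2 ((1 - 2 * b₁ c - 5 * c) / 2) (b₁ c) c) (𝓝[<] cZeta2) (𝓝 zeta2) ∧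
      Tendsto (fun c => nu 2 ((1 - 2 * b₁ c - 5 * c) / 2) (b₁ c) c) (𝓝[>] cZeta4) (𝓝 zeta4) ∧
      -- `ν_{2,3,4}`
      (∀ a b c : ℝ, IsExtremeNu 3 a b c ↔
        c ∈ Ioo y cZeta2 ∧ a = (1 - 3 * b₂ c - 4 * c) / 2 ∧ b = b₂ c) ∧
      Tendsto (fun c => nu 3 ((1 - 3 * b₂ c - 4 * c) / 2) (b₂ c) c) (𝓝[<] cZeta2) (𝓝 zeta2) ∧
      Tendsto (fun c => nu 3 ((1 - 3 * b₂ c - 4 * c) / 2) (b₂ c) c) (𝓝[>] y) (𝓝 (zeta5 x)) ∧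
      -- `ν_{2,4,3}`: both branches together
      (∀ a b c : ℝ, IsExtremeNu 4 a b c ↔
        (c ∈ Ioc (1 / 21) cMeet ∧ a = (1 - 4 * b₃ c - 3 * c) / 2 ∧ b = b₃ c) ∨
        (c ∈ Ico cMeet cZeta2 ∧ a = a243 c ∧ b = b243 c)) ∧
      -- the first branch: `l₁ = 0` and `L₂ ⪰ 0`
      (∀ a b c : ℝ,
        (a > b ∧ b > c ∧ c > 0 ∧ 2 * a + 4 * b + 3 * c = 1 ∧
          (matL1 (nuSpec 4 a b c)).det = 0 ∧ (matL2 (nuSpec 4 a b c)).PosSemidef) ↔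
        (c ∈ Ioc (1 / 21) cMeet ∧ a = (1 - 4 * b₃ c - 3 * c) / 2 ∧ b = b₃ c)) ∧
      -- the second branch: `l₂ = 0` and `L₁ ⪰ 0`
      (∀ a b c : ℝ,
        (a > b ∧ b > c ∧ c > 0 ∧ 2 * a + 4 * b + 3 * c = 1 ∧
          (matL2 (nuSpec 4 a b c)).det = 0 ∧ (matL1 (nuSpec 4 a b c)).PosSemidef) ↔
        (c ∈ Ico cMeet cZeta2 ∧ a = a243 c ∧ b = b243 c)) ∧
      -- the common point `ν_{2,4,3}⁽³⁾`: `l₁ = l₂ = 0`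
      (∀ a b c : ℝ,
        (a > b ∧ b > c ∧ c > 0 ∧ 2 * a + 4 * b + 3 * c = 1 ∧
          (matL1 (nuSpec 4 a b c)).det = 0 ∧ (matL2 (nuSpec 4 a b c)).det = 0) ↔
        (a = aMeet ∧ b = bMeet ∧ c = cMeet)) ∧
      Tendsto (fun c => nu 4 ((1 - 4 * b₃ c - 3 * c) / 2) (b₃ c) c) (𝓝[>] (1 / 21)) (𝓝 zeta6) ∧
      Tendsto (fun c => nu 4 ((1 - 4 * b₃ c - 3 * c) / 2) (b₃ c) c) (𝓝[<] cMeet)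
        (𝓝 (nu 4 aMeet bMeet cMeet)) ∧
      Tendsto (fun c => nu 4 (a243 c) (b243 c) c) (𝓝[>] cMeet) (𝓝 (nu 4 aMeet bMeet cMeet)) ∧
      Tendsto (fun c => nu 4 (a243 c) (b243 c) c) (𝓝[<] cZeta2) (𝓝 zeta2) ∧
      -- `ν_{2,5,2}`
      (∀ a b c : ℝ, IsExtremeNu 5 a b c ↔
        c ∈ Ioo cZeta7 cZeta2 ∧ a = a252 c ∧ b = b252 c) ∧
      Tendsto (fun c => nu 5 (a252 c) (b252 c) c) (𝓝[<] cZeta2) (𝓝 zeta2) ∧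
      Tendsto (fun c => nu 5 (a252 c) (b252 c) c) (𝓝[>] cZeta7) (𝓝 zeta7) ∧
      -- `ν_{2,6,1}`
      (∀ a b c : ℝ, IsExtremeNu 6 a b c ↔
        c ∈ Ioo 0 cZeta2 ∧ a = a261 c ∧ b = b261 c) ∧
      Tendsto (fun c => nu 6 (a261 c) (b261 c) c) (𝓝[<] cZeta2) (𝓝 zeta2) ∧
      Tendsto (fun c => nu 6 (a261 c) (b261 c) c) (𝓝[>] 0) (𝓝 zeta8) := by
  obtain ⟨y, hy2, hy, hy1, hy3⟩ := exists_y
  obtain ⟨x, hx, hxy⟩ := exists_x hy hy1 hy3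
  obtain ⟨b₁, h₁⟩ := exists_rootChoice225
  obtain ⟨b₂, h₂⟩ := exists_rootChoice234 hy hy1 hy3
  obtain ⟨b₃, h₃⟩ := exists_rootChoice243
  exact ⟨x, y, b₁, b₂, b₃, hx, ⟨hy2, by linarith, by linarith⟩, h₁.second, h₂.second,
    fun c hc => h₃.second c ⟨hc.1, by linarith [hc.2, cMeet_bounds.2, cZeta2_bounds.1]⟩,
    isExtremeNu_one_iff_param, tendsto_nu_216_right, tendsto_nu_216_left,
    isExtremeNu_two_iff_param h₁, tendsto_nu_225_right h₁, tendsto_nu_225_left h₁,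
    isExtremeNu_three_iff_param hy hy1 hy3 h₂, tendsto_nu_234_right hy3 h₂,
    tendsto_nu_234_left hy hy1 hy3 hxy h₂,
    isExtremeNu_four_iff_param h₃, branch_one_iff h₃, branch_two_iff, meet_iff,
    tendsto_nu_243_one_left h₃, tendsto_nu_243_one_right h₃, tendsto_nu_243_two_left,
    tendsto_nu_243_two_right,
    isExtremeNu_five_iff_param, tendsto_nu_252_right, tendsto_nu_252_left,
    isExtremeNu_six_iff_param, tendsto_nu_261_right, tendsto_nu_261_left⟩
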